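/- For $2\pi$-periodic measurable $a,b$ on $\mathbb R$ that are bounded above and bounded below away from zero, let $C(a,b)>0$ denote the best (smallest) constant in the inequality \[ \int_0^{2\pi} a\,w^2\,d\theta\le C(a,b)\int_0^{2\pi} b\,w'^2\,d\theta \qquad (1) \] for all $2\pi$-periodic $w\in H^1_{\mathrm{loc}}(\mathbb R)$ satisfying $\int_0^{2\pi}a\,w\,d\theta=0$ (2). For $M>1$ let $\mathcal B(M)$ be the set of $2\pi$-periodic $\gamma\in L^\infty(\mathbb R)$ with $\operatorname{ess\,inf}\gamma=1$ and $\operatorname{ess\,sup}\gamma=M$. Functions are identified when they agree almost everywhere. Theorem. Let $M>1$ and let $p,q\in\mathbb R$ with $p+q\ge0$. Then for every $\gamma\in\mathcal B(M)$ the best constant exists and \[ C(\gamma^p,\gamma^q)\le\left(\frac{\frac1{2\pi}\int_0^{2\pi}\gamma^{(p-q)/2}\,d\theta}{\frac4\pi\arctan\left(M^{-(p+q)/4}\right)}\right)^2. \qquad (3) \] (i) Suppose $p+q>0$ and put $c=\dfrac{2}{1+M^{-(p-q)/2}}$ and $\sqrt\mu=\frac4\pi\arctan\left(M^{-(p+q)/4}\right)$.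 Let $\bar\gamma_{p,q}$ be the $2\pi$-periodic function equal to $1$ on $[0,c\frac\pi2)\cup[\pi,\pi+c\frac\pi2)$ and to $M$ on $[c\frac\pi2,\pi)\cup[\pi+c\frac\pi2,2\pi)$. Then $\gamma\in\mathcal B(M)$ satisfies (3) with equality if and only if $\gamma(\theta)=\bar\gamma_{p,q}(\theta+\varphi)$ for some $\varphi\in\mathbb R$. Furthermore, for each $\varphi\in\mathbb R$, with $a(\theta)=\bar\gamma_{p,q}(\theta+\varphi)^p$ and $b(\theta)=\bar\gamma_{p,q}(\theta+\varphi)^q$, a function $w\not\equiv0$ is admissible in (1)--(2) and attains equality in (1) if and only if $w(\theta)=C\,\bar w_{p,q}(\theta+\varphi)$ for some constant $C\ne0$, where $\bar w_{p,q}$ is the $2\pi$-periodic function given on $[0,2\pi)$ by \[ \bar w_{p,q}(\theta)=\begin{cases} \sin\left[\sqrt\mu\left(c^{-1}\theta-\frac\pi4\right)\right], & 0\le\theta<c\frac\pi2,\\ M^{-(p+q)/4}\cos\left[\sqrt\mu\left(\frac\pi2+c^{-1}M^{(p-q)/2}\left(\theta-c\frac\pi2\right)-\frac{3\pi}4\right)\right],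 & c\frac\pi2\le\theta<\pi,\\ -\sin\left[\sqrt\mu\left(\pi+c^{-1}(\theta-\pi)-\frac{5\pi}4\right)\right], & \pi\le\theta<\pi+c\frac\pi2,\\ -M^{-(p+q)/4}\cos\left[\sqrt\mu\left(\frac{3\pi}2+c^{-1}M^{(p-q)/2}\left(\theta-\pi-c\frac\pi2\right)-\frac{7\pi}4\right)\right], & \pi+c\frac\pi2\le\theta<2\pi. \end{cases} \] (ii) Suppose $p+q=0$. Then (3) is an equality for every $\gamma\in\mathcal B(M)$, and a function $w\not\equiv0$ is admissible in (1)--(2) with $a=\gamma^p$, $b=\gamma^{q}=\gamma^{-p}$ and attains equality in (1) if and only if \[ w(\theta)=C\cos\left(\frac{2\pi}{\int_0^{2\pi}\gamma^p}\int_0^\theta\gamma^p+\varphi\right) \] for some $C\neq0$ and $\varphi\in\mathbb R$. -/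

import Mathlib

open MeasureTheory

/-- `v` is a weak (distributional) derivative of `w` on the real line. -/
def HasWeakDeriv (w v : ℝ → ℝ) : Prop :=
  ∀ f : ℝ → ℝ, ContDiff ℝ ((⊤ : ℕ∞) : WithTop ℕ∞) f → HasCompactSupport f →
    ∫ x, w x * deriv f x = -∫ x, v x * f x

/-- `w ∈ L²_loc(ℝ)`. -/
def MemL2Loc (w : ℝ → ℝ) : Prop :=
  ∀ K : Set ℝ, IsCompact K → MemLp w 2 (volume.restrict K)

/-- `w ∈ H¹_loc(ℝ)`, with weak derivative `v`. -/
structure MemH1Loc (w v : ℝ → ℝ) : Prop where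
  memL2Loc : MemL2Loc w
  deriv_memL2Loc : MemL2Loc v
  hasWeakDeriv : HasWeakDeriv w v

/-- `a` is `2π`-periodic, as an almost-everywhere class. -/
def AEPeriodic (a : ℝ → ℝ) : Prop :=
  ∀ᵐ θ : ℝ, a (θ + 2 * Real.pi) = a θ

/-- `w ∈ H¹_loc(ℝ)` (with weak derivative `v`) is `2π`-periodic and `∫₀^{2π} a w = 0`. -/
structure Admissible (a w v : ℝ → ℝ) : Prop where
  memH1Loc : MemH1Loc w v
  periodic : AEPeriodic w
  constraint : ∫ θ in (0 : ℝ)..(2 * Real.pi), a θ * w θ = 0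

/-- The constants `C` for which `∫₀^{2π} a w² ≤ C ∫₀^{2π} b w'²` for all admissible `w`. -/
def wirtingerConstants (a b : ℝ → ℝ) : Set ℝ :=
  {C | ∀ w v : ℝ → ℝ, Admissible a w v →
    ∫ θ in (0 : ℝ)..(2 * Real.pi), a θ * w θ ^ 2
      ≤ C * ∫ θ in (0 : ℝ)..(2 * Real.pi), b θ * v θ ^ 2}

/-- The best constant `C(a, b)` in the weighted Wirtinger inequality. -/
noncomputable def bestConst (a b : ℝ → ℝ) : ℝ :=
  sInf (wirtingerConstants a b)

/-- `w` is a nontrivial admissible function for which equality holds in the weighted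
Wirtinger inequality with the best constant. -/
def IsExtremal (a b w : ℝ → ℝ) : Prop :=
  (¬ ∀ᵐ θ : ℝ, w θ = 0) ∧
    ∃ v : ℝ → ℝ, Admissible a w v ∧
      ∫ θ in (0 : ℝ)..(2 * Real.pi), a θ * w θ ^ 2
        = bestConst a b * ∫ θ in (0 : ℝ)..(2 * Real.pi), b θ * v θ ^ 2

/-- The class `𝓑(M)`: essentially bounded `2π`-periodic functions with essential infimum `1`
and essential supremum `M`. -/
structure WeightClass (M : ℝ) (γ : ℝ → ℝ) : Prop where
  memLp_top : MemLp γ ⊤ volume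
  periodic : AEPeriodic γ
  essInf_eq : essInf γ volume = 1
  essSup_eq : essSup γ volume = M

/-- The upper bound `((1/2π) ∫₀^{2π} γ^{(p-q)/2} / ((4/π) arctan (M^{-(p+q)/4})))²`. -/
noncomputable def wirtingerBound (M p q : ℝ) (γ : ℝ → ℝ) : ℝ :=
  ((1 / (2 * Real.pi) * ∫ θ in (0 : ℝ)..(2 * Real.pi), γ θ ^ ((p - q) / 2)) /
    (4 / Real.pi * Real.arctan (M ^ (-(p + q) / 4)))) ^ 2

/-- `c_{p,q} = 2 / (1 + M^{-(p-q)/2})`. -/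
noncomputable def cpq (M p q : ℝ) : ℝ :=
  2 / (1 + M ^ (-(p - q) / 2))

/-- The representative of `θ` modulo `2π` in `[0, 2π)`. -/
noncomputable def angle (θ : ℝ) : ℝ :=
  toIcoMod Real.two_pi_pos 0 θ

/-- The step weight on `[0, 2π)`. -/
noncomputable def gammaBase (M p q θ : ℝ) : ℝ :=
  if θ < cpq M p q * (Real.pi / 2) then 1
  else if θ < Real.pi then M
  else if θ < Real.pi + cpq M p q * (Real.pi / 2) then 1
  else M

/-- The step weight, extended `2π`-periodically to the real line. -/
noncomputable def gammaBar (M p q θ : ℝ) : ℝ :=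
  gammaBase M p q (angle θ)

/-- `√μ = (4/π) arctan (M^{-(p+q)/4})`. -/
noncomputable def sqrtMu (M p q : ℝ) : ℝ :=
  4 / Real.pi * Real.arctan (M ^ (-(p + q) / 4))

/-- The extremal function on `[0, 2π)`. -/
noncomputable def wBase (M p q θ : ℝ) : ℝ :=
  if θ < cpq M p q * (Real.pi / 2) then
    Real.sin (sqrtMu M p q * ((cpq M p q)⁻¹ * θ - Real.pi / 4))
  else if θ < Real.pi then
    M ^ (-(p + q) / 4) *
      Real.cos (sqrtMu M p q *
        (Real.pi / 2
          + (cpq M p q)⁻¹ * M ^ ((p - q) / 2) * (θ - cpq M p q * (Real.pi / 2))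
          - 3 * Real.pi / 4))
  else if θ < Real.pi + cpq M p q * (Real.pi / 2) then
    -Real.sin (sqrtMu M p q * (Real.pi + (cpq M p q)⁻¹ * (θ - Real.pi) - 5 * Real.pi / 4))
  else
    -(M ^ (-(p + q) / 4) *
      Real.cos (sqrtMu M p q *
        (3 * Real.pi / 2
          + (cpq M p q)⁻¹ * M ^ ((p - q) / 2) * (θ - Real.pi - cpq M p q * (Real.pi / 2))
          - 7 * Real.pi / 4)))

/-- The extremal function, extended `2π`-periodically to the real line. -/
noncomputable def wBar (M p q θ : ℝ) : ℝ :=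
  wBase M p q (angle θ)

/-! The best constant is the reciprocal of the least eigenvalue of a periodic Sturm–Liouville
problem, and that eigenvalue is bounded below by timing a Prüfer angle.

Compactness gives a maximizer of the Rayleigh quotient (`exists_extremal_pair`), and the first
variation turns it into a nonzero periodic solution of `w' = U / b`, `U' = -lam a w` with `lam = 1 /
C` (`exists_isPeriodicSol_of_extremal`). Write `σ = γ^((p-q)/2)`, `β = γ^((p+q)/2)`, so that `a =
σβ` and `1/b = σ/β`; put `ℓ = M^((p+q)/4)`, so that `1 ≤ β ≤ ℓ²`, and `ν = √lam`. In the coordinates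
`U = r cos φ`, `νℓ w = r sin φ` the angle satisfies `φ' = νσ (ℓ/β cos² φ + β/ℓ sin² φ)`. The bracket
is convex in `β`, hence largest at `β = 1` or `β = ℓ²`, according to the sign of `cos 2φ`; the scale
`ℓ` makes this maximum `π/2`-periodic in `φ`. At maximal speed a quarter turn from `-π/4` to `π/4`
takes time `2 arctan(1/ℓ)`, measured by `ν ∫ σ`. Since `w` and `U` are periodic and `φ` increases,
one period contains at least one full turn, so `ν ∫ σ ≥ 8 arctan(1/ℓ)`
(`IsPrueferAngle.le_integral`), which is the upper bound for `C`.

Equality forces maximal speed almost everywhere. If `p + q > 0` this makes `γ = 1` where `cos 2φ >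
0` and `γ = M` where `cos 2φ < 0`; the four quarter turns then have known lengths and `γ` is a
translate of the step weight (`ae_eq_gammaBar_of_isPrueferAngle`). Conversely, the explicit function
is a periodic solution for the step weight whose eigenvalue meets the bound. The phase at a jump is
determined modulo `π` (`flux_eq_at_jump`), so uniqueness for the initial value problem leaves a
single line of extremals. If `p + q = 0`, then `1/b = a` and the variable `∫ γ^p` reduces the system
to the harmonic oscillator, whose solution space is two-dimensional. -/

/-! ### Calculus of absolutely continuous functions -/

/-- `f` is a primitive on the real line of the locally integrable function `g`. -/
structure IsPrimitive (f g : ℝ → ℝ) : Prop where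
  locallyIntegrable : LocallyIntegrable g volume
  sub_eq : ∀ x y, f y - f x = ∫ t in x..y, g t

theorem MeasureTheory.LocallyIntegrable.intervalIntegrable_real {g : ℝ → ℝ}
    (h : LocallyIntegrable g volume) (x y : ℝ) : IntervalIntegrable g volume x y :=
  intervalIntegrable_iff.mpr <|
    (h.integrableOn_isCompact isCompact_uIcc).mono_set Set.uIoc_subset_uIcc

theorem locallyIntegrable_of_intervalIntegrable {g : ℝ → ℝ}
    (h : ∀ x y, IntervalIntegrable g volume x y) : LocallyIntegrable g volume := by
  intro x
  refine ⟨Set.Ioc (x - 1) (x + 1), Ioc_mem_nhds (by linarith) (by linarith), ?_⟩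
  exact (intervalIntegrable_iff_integrableOn_Ioc_of_le (by linarith)).1 (h _ _)

/-- On the bounded range of `f` the outer function is Lipschitz, so the variation sums are
multiplied by at most a constant. -/
theorem AbsolutelyContinuousOnInterval.contDiff_comp {f F : ℝ → ℝ} {x y : ℝ}
    (hf : AbsolutelyContinuousOnInterval f x y) (hF : ContDiff ℝ 1 F) :
    AbsolutelyContinuousOnInterval (fun t => F (f t)) x y := by
  obtain ⟨R, hR⟩ := hf.exists_bound
  obtain ⟨K, hK⟩ := hF.contDiffOn.exists_lipschitzOnWith (s := Set.Icc (-R) R) (by decide)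
    (convex_Icc _ _) isCompact_Icc
  have hmem : ∀ t ∈ Set.uIcc x y, f t ∈ Set.Icc (-R) R := fun t ht => abs_le.1 (hR t ht)
  unfold AbsolutelyContinuousOnInterval at hf ⊢
  have h0 := hf.const_mul (K : ℝ)
  rw [mul_zero] at h0
  refine squeeze_zero' (Filter.Eventually.of_forall fun _ =>
    Finset.sum_nonneg fun _ _ => dist_nonneg) ?_ h0
  rw [Filter.eventually_inf_principal]
  filter_upwards with ⟨n, I⟩ hnI
  rw [Finset.mul_sum]
  refine Finset.sum_le_sum fun i hi => ?_
  exact hK.dist_le_mul _ (hmem _ (hnI.1 i hi).1) _ (hmem _ (hnI.1 i hi).2)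

namespace IsPrimitive

variable {f g f₁ g₁ f₂ g₂ : ℝ → ℝ}

theorem intervalIntegrable (h : IsPrimitive f g) (x y : ℝ) : IntervalIntegrable g volume x y :=
  h.locallyIntegrable.intervalIntegrable_real x y

theorem eq_add (h : IsPrimitive f g) (x y : ℝ) : f y = f x + ∫ t in x..y, g t := by
  linarith [h.sub_eq x y]

theorem ae_hasDerivAt (h : IsPrimitive f g) : ∀ᵐ x, HasDerivAt f (g x) x := by
  filter_upwards [LocallyIntegrable.ae_hasDerivAt_integral h.locallyIntegrable] with x hx
  have : f = fun y => f 0 + ∫ t in (0 : ℝ)..y, g t := funext fun y => h.eq_add 0 y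
  rw [this]
  exact (hx 0).const_add _

theorem absolutelyContinuous (h : IsPrimitive f g) (x y : ℝ) :
    AbsolutelyContinuousOnInterval f x y := by
  have h1 := (h.intervalIntegrable x y).absolutelyContinuousOnInterval_intervalIntegral
    (c := x) Set.left_mem_uIcc
  have h2 : AbsolutelyContinuousOnInterval (fun _ : ℝ => f x) x y :=
    (contDiff_const (c := f x) (𝕜 := ℝ) (n := 1)).contDiffOn.absolutelyContinuousOnInterval
  have : f = (fun _ : ℝ => f x) + fun y => ∫ t in x..y, g t := funext fun y => h.eq_add x y
  rw [this]
  exact h2.add h1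

theorem continuous (h : IsPrimitive f g) : Continuous f := by
  have : f = fun y => f 0 + ∫ t in (0 : ℝ)..y, g t := funext fun y => h.eq_add 0 y
  rw [this]
  exact continuous_const.add (intervalIntegral.continuous_primitive
    (fun x y => h.intervalIntegrable x y) 0)

/-- The closure rules below all reduce to this: absolute continuity is stable under the operation,
and the derivative need only be identified almost everywhere. -/
theorem of_absolutelyContinuous (h : ∀ x y, AbsolutelyContinuousOnInterval f x y)
    (hd : ∀ᵐ x, HasDerivAt f (g x) x) : IsPrimitive f g := by
  have hd' : deriv f =ᵐ[volume] g := hd.mono fun x hx => hx.deriv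
  have hi : ∀ x y, IntervalIntegrable g volume x y := fun x y =>
    (h x y).intervalIntegrable_deriv.congr_ae (ae_restrict_of_ae hd')
  refine ⟨locallyIntegrable_of_intervalIntegrable hi, fun x y => ?_⟩
  rw [← (h x y).integral_deriv_eq_sub]
  exact intervalIntegral.integral_congr_ae (hd'.mono fun _ ht _ => ht)

theorem congr_ae (h : IsPrimitive f g) (hg : g =ᵐ[volume] g₁) : IsPrimitive f g₁ :=
  of_absolutelyContinuous h.absolutelyContinuous
    (by filter_upwards [h.ae_hasDerivAt, hg] with x hx hx'; rwa [← hx'])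

theorem ae_unique (h : IsPrimitive f g) (h₁ : IsPrimitive f g₁) : g =ᵐ[volume] g₁ := by
  filter_upwards [h.ae_hasDerivAt, h₁.ae_hasDerivAt] with x hx hx'
  exact hx.unique hx'

theorem of_locallyIntegrable (hg : LocallyIntegrable g volume) (c x : ℝ) :
    IsPrimitive (fun y => c + ∫ t in x..y, g t) g :=
  ⟨hg, fun y z => by
    have := intervalIntegral.integral_add_adjacent_intervals
      (hg.intervalIntegrable_real x y) (hg.intervalIntegrable_real y z)
    linarith⟩

theorem mul (h₁ : IsPrimitive f₁ g₁) (h₂ : IsPrimitive f₂ g₂) :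
    IsPrimitive (fun x => f₁ x * f₂ x) (fun x => g₁ x * f₂ x + f₁ x * g₂ x) := by
  refine of_absolutelyContinuous
    (fun x y => (h₁.absolutelyContinuous x y).fun_mul (h₂.absolutelyContinuous x y)) ?_
  filter_upwards [h₁.ae_hasDerivAt, h₂.ae_hasDerivAt] with x hx hx'
  exact hx.mul hx'

theorem add (h₁ : IsPrimitive f₁ g₁) (h₂ : IsPrimitive f₂ g₂) :
    IsPrimitive (fun x => f₁ x + f₂ x) (fun x => g₁ x + g₂ x) := by
  refine of_absolutelyContinuous
    (fun x y => (h₁.absolutelyContinuous x y).add (h₂.absolutelyContinuous x y)) ?_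
  filter_upwards [h₁.ae_hasDerivAt, h₂.ae_hasDerivAt] with x hx hx'
  exact hx.add hx'

theorem sub (h₁ : IsPrimitive f₁ g₁) (h₂ : IsPrimitive f₂ g₂) :
    IsPrimitive (fun x => f₁ x - f₂ x) (fun x => g₁ x - g₂ x) := by
  refine of_absolutelyContinuous
    (fun x y => (h₁.absolutelyContinuous x y).sub (h₂.absolutelyContinuous x y)) ?_
  filter_upwards [h₁.ae_hasDerivAt, h₂.ae_hasDerivAt] with x hx hx'
  exact hx.sub hx'

theorem const_mul (h : IsPrimitive f g) (c : ℝ) :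
    IsPrimitive (fun x => c * f x) (fun x => c * g x) := by
  refine of_absolutelyContinuous (fun x y => (h.absolutelyContinuous x y).const_mul c) ?_
  filter_upwards [h.ae_hasDerivAt] with x hx
  exact hx.const_mul c

theorem add_const (h : IsPrimitive f g) (c : ℝ) : IsPrimitive (fun x => f x + c) g :=
  ⟨h.locallyIntegrable, fun x y => by rw [← h.sub_eq x y]; ring⟩

theorem comp {F F' : ℝ → ℝ} (h : IsPrimitive f g) (hF : ∀ x, HasDerivAt F (F' x) x)
    (hF' : Continuous F') : IsPrimitive (fun x => F (f x)) (fun x => F' (f x) * g x) := by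
  have hc : ContDiff ℝ 1 F := by
    rw [contDiff_one_iff_deriv]
    refine ⟨fun x => (hF x).differentiableAt, ?_⟩
    rwa [show deriv F = F' from funext fun x => (hF x).deriv]
  refine of_absolutelyContinuous (fun x y => (h.absolutelyContinuous x y).contDiff_comp hc) ?_
  filter_upwards [h.ae_hasDerivAt] with x hx
  exact (hF (f x)).comp x hx

theorem of_hasDerivAt (h : ∀ x, HasDerivAt f (g x) x) (hg : Continuous g) : IsPrimitive f g :=
  ⟨hg.locallyIntegrable, fun x y => (intervalIntegral.integral_eq_sub_of_hasDerivAt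
    (fun t _ => h t) (hg.intervalIntegrable x y)).symm⟩

theorem monotone (h : IsPrimitive f g) (hg : ∀ᵐ x, 0 ≤ g x) : Monotone f := by
  intro x y hxy
  have := intervalIntegral.integral_nonneg_of_ae hxy hg
  linarith [h.sub_eq x y]

theorem strictMono (h : IsPrimitive f g) (hg : ∀ᵐ x, 0 < g x) : StrictMono f := by
  have hm := h.monotone (hg.mono fun _ hx => hx.le)
  intro x y hlt
  refine lt_of_le_of_ne (hm hlt.le) fun hxy => ?_
  -- A monotone function with equal end values is constant in between, so its derivative vanishes on
  -- an interval of positive measure.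
  have hconst : ∀ t ∈ Set.Ioo x y, HasDerivAt f 0 t := by
    intro t ht
    refine (hasDerivAt_const t (f x)).congr_of_eventuallyEq ?_
    filter_upwards [Ioo_mem_nhds ht.1 ht.2] with s hs
    exact le_antisymm ((hm hs.2.le).trans_eq hxy.symm) (hm hs.1.le)
  have h2 : ∀ᵐ t, t ∉ Set.Ioo x y := by
    filter_upwards [hg, h.ae_hasDerivAt] with t ht ht' hmem
    exact ht.ne' (ht'.unique (hconst t hmem))
  have h3 : volume (Set.Ioo x y) = 0 := measure_eq_zero_iff_ae_notMem.2 h2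
  simp [hlt.not_ge] at h3

/-- Grönwall: a nonnegative function with `|f'| ≤ K f` that vanishes somewhere is zero. -/
theorem eq_zero_of_abs_le {K x₀ : ℝ} (h : IsPrimitive f g) (hf : ∀ x, 0 ≤ f x)
    (hg : ∀ᵐ x, |g x| ≤ K * f x) (h0 : f x₀ = 0) (x : ℝ) : f x = 0 := by
  have hexp : ∀ c : ℝ, IsPrimitive (fun x => Real.exp (c * x)) (fun x => c * Real.exp (c * x)) :=
    fun c => of_hasDerivAt
      (fun x => by simpa [mul_comm] using ((hasDerivAt_id x).const_mul c).exp) (by fun_prop)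
  -- The factor `exp (K x)` makes `f` increase and `exp (-K x)` makes it decrease; the first
  -- controls the points left of `x₀`, the second those to its right.
  have hinc : Monotone fun x => f x * Real.exp (K * x) := by
    refine (h.mul (hexp K)).monotone ?_
    filter_upwards [hg] with x hx
    have := (abs_le.1 hx).1
    have h2 := Real.exp_pos (K * x)
    nlinarith
  have hdec : Monotone fun x => -1 * (f x * Real.exp (-K * x)) := by
    refine ((h.mul (hexp (-K))).const_mul (-1)).monotone ?_
    filter_upwards [hg] with x hx
    have := (abs_le.1 hx).2
    have h2 := Real.exp_pos (-K * x)
    nlinarith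
  rcases le_total x x₀ with hx | hx
  · have := hinc hx
    simp only [h0, zero_mul] at this
    exact le_antisymm (by
      by_contra hc
      nlinarith [mul_pos (not_le.1 hc) (Real.exp_pos (K * x))]) (hf x)
  · have := hdec hx
    simp only [h0, zero_mul, mul_zero] at this
    exact le_antisymm (by
      by_contra hc
      nlinarith [mul_pos (not_le.1 hc) (Real.exp_pos (-K * x))]) (hf x)

end IsPrimitive

/-! ### Functions periodic up to null sets -/

theorem AEPeriodic.ae_forall_int {f : ℝ → ℝ} (hf : AEPeriodic f) :
    ∀ᵐ θ : ℝ, ∀ n : ℤ, f (θ + n * (2 * Real.pi)) = f θ := by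
  have h : ∀ᵐ θ : ℝ, ∀ n : ℤ,
      f (θ + n * (2 * Real.pi) + 2 * Real.pi) = f (θ + n * (2 * Real.pi)) := by
    rw [ae_all_iff]
    intro n
    exact (measurePreserving_add_right volume
      ((n : ℝ) * (2 * Real.pi))).quasiMeasurePreserving.ae hf
  filter_upwards [h] with θ hθ n
  induction n using Int.induction_on with
  | zero => simp
  | succ n ih => rw [← ih, ← hθ n]; push_cast; congr 1; ring
  | pred n ih =>
    rw [← ih, ← hθ (-n - 1)]; push_cast; congr 1; ring

theorem angle_eq_add (θ : ℝ) :
    angle θ = θ + ((-(toIcoDiv Real.two_pi_pos 0 θ) : ℤ) : ℝ) * (2 * Real.pi) := by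
  unfold angle toIcoMod
  push_cast
  rw [zsmul_eq_mul]
  ring

theorem angle_mem (θ : ℝ) : angle θ ∈ Set.Ico 0 (2 * Real.pi) := by
  have := toIcoMod_mem_Ico Real.two_pi_pos 0 θ
  rwa [zero_add] at this

theorem AEPeriodic.ae_eq_comp_angle {f : ℝ → ℝ} (hf : AEPeriodic f) :
    f =ᵐ[volume] fun θ => f (angle θ) := by
  filter_upwards [hf.ae_forall_int] with θ hθ
  rw [angle_eq_add, hθ]

theorem AEPeriodic.ae_eq_of_ae_eq_on {f g : ℝ → ℝ} (hf : AEPeriodic f) (hg : AEPeriodic g) (x : ℝ)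
    (h : ∀ᵐ θ, θ ∈ Set.Ico x (x + 2 * Real.pi) → f θ = g θ) : f =ᵐ[volume] g := by
  have h' : ∀ᵐ θ : ℝ, ∀ n : ℤ, θ + n * (2 * Real.pi) ∈ Set.Ico x (x + 2 * Real.pi) →
      f (θ + n * (2 * Real.pi)) = g (θ + n * (2 * Real.pi)) := by
    rw [ae_all_iff]
    intro n
    exact (measurePreserving_add_right volume
      ((n : ℝ) * (2 * Real.pi))).quasiMeasurePreserving.ae h
  filter_upwards [hf.ae_forall_int, hg.ae_forall_int, h'] with θ h1 h2 h3
  have h4 := h3 (-(toIcoDiv Real.two_pi_pos x θ)) (by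
    have := sub_toIcoDiv_zsmul_mem_Ico Real.two_pi_pos x θ
    rw [zsmul_eq_mul] at this
    push_cast
    rwa [neg_mul, ← sub_eq_add_neg])
  rwa [h1, h2] at h4

theorem angle_add_two_pi (θ : ℝ) : angle (θ + 2 * Real.pi) = angle θ :=
  toIcoMod_add_right _ _ _

theorem angle_eq_self {θ : ℝ} (h0 : 0 ≤ θ) (h1 : θ < 2 * Real.pi) : angle θ = θ :=
  (toIcoMod_eq_self _).2 ⟨h0, by linarith⟩

theorem AEPeriodic.intervalIntegral_eq {f : ℝ → ℝ} (hf : AEPeriodic f) (x : ℝ) :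
    ∫ θ in x..x + 2 * Real.pi, f θ = ∫ θ in (0 : ℝ)..2 * Real.pi, f θ := by
  have h := hf.ae_eq_comp_angle
  have hp : Function.Periodic (fun θ => f (angle θ)) (2 * Real.pi) := fun θ => by
    simp only [angle_add_two_pi]
  rw [intervalIntegral.integral_congr_ae (h.mono fun _ ht _ => ht),
    hp.intervalIntegral_add_eq x 0, zero_add]
  exact (intervalIntegral.integral_congr_ae (h.mono fun _ ht _ => ht)).symm

theorem AEPeriodic.congr {f g : ℝ → ℝ} (hf : AEPeriodic f) (h : f =ᵐ[volume] g) :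
    AEPeriodic g := by
  have h2 : ∀ᵐ θ : ℝ, f (θ + 2 * Real.pi) = g (θ + 2 * Real.pi) :=
    (measurePreserving_add_right volume (2 * Real.pi)).quasiMeasurePreserving.ae h
  filter_upwards [hf, h, h2] with θ h1 h2 h3
  rw [← h3, ← h2, h1]

theorem AEPeriodic.comp₂ {f g : ℝ → ℝ} (hf : AEPeriodic f) (hg : AEPeriodic g)
    (F : ℝ → ℝ → ℝ) : AEPeriodic fun θ => F (f θ) (g θ) := by
  filter_upwards [hf, hg] with θ h1 h2
  rw [h1, h2]

theorem Function.Periodic.aePeriodic {f : ℝ → ℝ} (hf : Function.Periodic f (2 * Real.pi)) :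
    AEPeriodic f :=
  Filter.Eventually.of_forall hf

theorem AEPeriodic.periodic {f : ℝ → ℝ} (hf : AEPeriodic f) (hc : Continuous f) :
    Function.Periodic f (2 * Real.pi) := by
  have : (fun θ => f (θ + 2 * Real.pi)) = f :=
    Continuous.ae_eq_iff_eq (μ := volume) (hc.comp (continuous_add_const _)) hc |>.1 hf
  exact fun θ => congrFun this θ

/-! ### Local square integrability and weak derivatives -/

theorem MemL2Loc.locallyIntegrable {w : ℝ → ℝ} (h : MemL2Loc w) :
    LocallyIntegrable w volume := by
  rw [locallyIntegrable_iff]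
  intro K hK
  have : IsFiniteMeasure (volume.restrict K) := ⟨by simpa using hK.measure_lt_top⟩
  exact (h K hK).integrable (by norm_num)

theorem Continuous.memL2Loc {w : ℝ → ℝ} (h : Continuous w) : MemL2Loc w := by
  intro K hK
  obtain ⟨R, hR⟩ := hK.exists_bound_of_continuousOn h.continuousOn
  have : IsFiniteMeasure (volume.restrict K) := ⟨by simpa using hK.measure_lt_top⟩
  exact MemLp.of_bound h.aestronglyMeasurable R
    ((ae_restrict_iff' hK.measurableSet).2 (Filter.Eventually.of_forall hR))

theorem MemL2Loc.congr {w w' : ℝ → ℝ} (h : MemL2Loc w) (hw : w =ᵐ[volume] w') :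
    MemL2Loc w' := fun K hK => (memLp_congr_ae (ae_restrict_of_ae hw)).1 (h K hK)

theorem HasCompactSupport.exists_eq_zero {f : ℝ → ℝ} (hf : HasCompactSupport f) :
    ∃ R > 0, ∀ x, R ≤ |x| → f x = 0 := by
  obtain ⟨R, h0, hR⟩ := hf.exists_pos_le_norm
  exact ⟨R, h0, hR⟩

theorem integral_eq_intervalIntegral_of_zero {f : ℝ → ℝ} {R : ℝ}
    (h : ∀ x, R ≤ |x| → f x = 0) : ∫ x, f x = ∫ x in (-R)..R, f x := by
  symm
  refine intervalIntegral.integral_eq_integral_of_support_subset fun x hx => ?_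
  have : |x| < R := not_le.1 fun hc => hx (h x hc)
  exact ⟨(abs_lt.1 this).1, (abs_lt.1 this).2.le⟩

theorem deriv_eq_zero_of_eq_zero {f : ℝ → ℝ} {R : ℝ}
    (h : ∀ x, R ≤ |x| → f x = 0) (x : ℝ) (hx : R < |x|) : deriv f x = 0 := by
  have : f =ᶠ[nhds x] fun _ => 0 := by
    filter_upwards [(continuous_abs.isOpen_preimage _ isOpen_Ioi).mem_nhds hx] with y hy
    exact h y (le_of_lt hy)
  rw [this.deriv_eq]; simp

theorem IsPrimitive.hasWeakDeriv {w v : ℝ → ℝ} (h : IsPrimitive w v) : HasWeakDeriv w v := by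
  intro f hf hfc
  obtain ⟨R, hR0, hR⟩ := hfc.exists_eq_zero
  have hf1 : ContDiff ℝ 1 f := hf.of_le (by exact_mod_cast le_top)
  have hd : IsPrimitive f (deriv f) := .of_hasDerivAt
    (fun x => (hf1.differentiable (by simp) x).hasDerivAt) (hf1.continuous_deriv (by simp))
  have hm := h.mul hd
  have h1 := hm.sub_eq (-(R + 1)) (R + 1)
  rw [hR _ (by rw [abs_of_pos] <;> linarith), hR _ (by rw [abs_neg, abs_of_pos] <;> linarith)] at h1
  have i1 : IntervalIntegrable (fun x => v x * f x) volume (-(R + 1)) (R + 1) :=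
    (h.intervalIntegrable _ _).mul_continuousOn hd.continuous.continuousOn
  have i2 : IntervalIntegrable (fun x => w x * deriv f x) volume (-(R + 1)) (R + 1) :=
    (h.continuous.mul (hf1.continuous_deriv (by simp))).intervalIntegrable _ _
  rw [intervalIntegral.integral_add i1 i2] at h1
  rw [integral_eq_intervalIntegral_of_zero (R := R + 1),
    integral_eq_intervalIntegral_of_zero (f := fun x => v x * f x) (R := R + 1)]
  · linarith
  · intro x hx
    rw [hR x (by linarith), mul_zero]
  · intro x hx
    rw [deriv_eq_zero_of_eq_zero hR x (by linarith), mul_zero]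

/-- du Bois-Reymond: a locally integrable function with zero weak derivative is constant. -/
theorem ae_eq_const_of_integral_mul_deriv_eq_zero {u : ℝ → ℝ} (hu : LocallyIntegrable u volume)
    (h : ∀ f : ℝ → ℝ, ContDiff ℝ ((⊤ : ℕ∞) : WithTop ℕ∞) f → HasCompactSupport f →
      ∫ x, u x * deriv f x = 0) : ∃ c, ∀ᵐ x, u x = c := by
  -- With `r` of integral one, any test function `ψ` minus `(∫ ψ) r` has integral zero, hence is the
  -- derivative of a compactly supported smooth function. Testing against it identifies the constant
  -- as `∫ u r`.
  let ρ : ContDiffBump (0 : ℝ) := ⟨1, 2, one_pos, one_lt_two⟩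
  obtain ⟨r, hr⟩ : ∃ r : ℝ → ℝ, r = ρ.normed volume := ⟨_, rfl⟩
  have hr_smooth : ContDiff ℝ ((⊤ : ℕ∞) : WithTop ℕ∞) r := hr ▸ ρ.contDiff_normed
  have hr_supp : HasCompactSupport r := hr ▸ ρ.hasCompactSupport_normed
  have hr_int : ∫ x, r x = 1 := hr ▸ ρ.integral_normed
  refine ⟨∫ x, u x * r x, ?_⟩
  set c := ∫ x, u x * r x with hc
  have hmulint : ∀ g : ℝ → ℝ, Continuous g → HasCompactSupport g →
      Integrable (fun x => u x * g x) volume := fun g hg hgc =>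
    (hu.integrable_smul_right_of_hasCompactSupport hg hgc)
  have key := ae_eq_zero_of_integral_contDiff_smul_eq_zero (f := fun x => u x - c) (μ := volume)
    (hu.sub (locallyIntegrable_const c)) ?_
  · filter_upwards [key] with x hx
    linarith
  intro ψ hψ hψc
  set I := ∫ x, ψ x with hI
  have hψr_smooth : ContDiff ℝ ((⊤ : ℕ∞) : WithTop ℕ∞) (fun x => ψ x - I * r x) :=
    hψ.sub (contDiff_const.mul hr_smooth)
  obtain ⟨R₁, hR₁0, hR₁⟩ := hψc.exists_eq_zero
  obtain ⟨R₂, hR₂0, hR₂⟩ := hr_supp.exists_eq_zero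
  set R := max R₁ R₂ with hRdef
  have hR0 : 0 < R := lt_max_of_lt_left hR₁0
  have hz : ∀ x, R ≤ |x| → ψ x - I * r x = 0 := fun x hx => by
    rw [hR₁ x ((le_max_left _ _).trans hx), hR₂ x ((le_max_right _ _).trans hx)]; ring
  have hψi : Integrable ψ volume := hψ.continuous.integrable_of_hasCompactSupport hψc
  have hri : Integrable r volume := hr_smooth.continuous.integrable_of_hasCompactSupport hr_supp
  have htot : ∫ x in (-R)..R, (ψ x - I * r x) = 0 := by
    rw [← integral_eq_intervalIntegral_of_zero hz, integral_sub hψi (hri.const_mul I),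
      integral_const_mul, hr_int]
    simp [hI]
  have hcont := hψr_smooth.continuous
  have hderiv : ∀ x, HasDerivAt (fun y => ∫ t in (-R)..y, (ψ t - I * r t)) (ψ x - I * r x) x :=
    fun x => intervalIntegral.integral_hasDerivAt_right (hcont.intervalIntegrable _ _)
      (hcont.stronglyMeasurableAtFilter _ _) hcont.continuousAt
  have hderiv' : deriv (fun y => ∫ t in (-R)..y, (ψ t - I * r t)) = fun x => ψ x - I * r x :=
    funext fun x => (hderiv x).deriv
  have hFsmooth : ContDiff ℝ ((⊤ : ℕ∞) : WithTop ℕ∞)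
      (fun y => ∫ t in (-R)..y, (ψ t - I * r t)) := by
    rw [contDiff_infty_iff_deriv]
    exact ⟨fun x => (hderiv x).differentiableAt, by rw [hderiv']; exact hψr_smooth⟩
  have hFc : HasCompactSupport (fun y => ∫ t in (-R)..y, (ψ t - I * r t)) := by
    refine HasCompactSupport.intro (isCompact_Icc (a := -R) (b := R)) fun x hx => ?_
    have hx' : x < -R ∨ R < x := by
      by_contra hcon
      push Not at hcon
      exact hx ⟨hcon.1, hcon.2⟩
    rcases hx' with hx' | hx'
    · rw [intervalIntegral.integral_symm, intervalIntegral.integral_congr (g := fun _ => 0)]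
      · simp
      · intro t ht
        rw [Set.uIcc_of_le hx'.le] at ht
        exact hz t (by rw [abs_of_neg] <;> linarith [ht.2])
    · rw [← intervalIntegral.integral_add_adjacent_intervals
        (hcont.intervalIntegrable (-R) R) (hcont.intervalIntegrable R x), htot,
        intervalIntegral.integral_congr (a := R) (g := fun _ => 0)]
      · simp
      · intro t ht
        rw [Set.uIcc_of_le hx'.le] at ht
        exact hz t (by rw [abs_of_pos] <;> linarith [ht.1])
  have h0 := h _ hFsmooth hFc
  rw [hderiv'] at h0
  have i1 := hmulint ψ hψ.continuous hψc
  have i2 := hmulint r hr_smooth.continuous hr_supp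
  have e1 : ∫ x, u x * (ψ x - I * r x) = (∫ x, u x * ψ x) - I * c := by
    rw [hc, ← integral_const_mul, ← integral_sub i1 (i2.const_mul I)]
    congr 1; ext x; ring
  have e2 : ∫ x, ψ x • (u x - c) = (∫ x, u x * ψ x) - c * I := by
    rw [hI, ← integral_const_mul, ← integral_sub i1 (hψi.const_mul c)]
    congr 1; ext x; simp only [smul_eq_mul]; ring
  rw [e2]; linarith

/-- The function and the primitive of its weak derivative have the same weak derivative, so they
differ by a constant almost everywhere. From here on only continuous representatives are used. -/
theorem memH1Loc_iff {w v : ℝ → ℝ} :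
    MemH1Loc w v ↔ ∃ W, w =ᵐ[volume] W ∧ IsPrimitive W v ∧ MemL2Loc v := by
  constructor
  · intro h
    have hv := h.deriv_memL2Loc.locallyIntegrable
    have hP := IsPrimitive.of_locallyIntegrable hv 0 0
    set P : ℝ → ℝ := fun y => 0 + ∫ t in (0 : ℝ)..y, v t with hPdef
    obtain ⟨c, hc⟩ := ae_eq_const_of_integral_mul_deriv_eq_zero
      (h.memL2Loc.locallyIntegrable.sub hP.continuous.locallyIntegrable) fun f hf hfc => by
        have hdc : HasCompactSupport (deriv f) := hfc.deriv
        have hdcont : Continuous (deriv f) := hf.continuous_deriv (by simp)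
        have h1 := h.hasWeakDeriv f hf hfc
        have h2 := hP.hasWeakDeriv f hf hfc
        have i1 : Integrable (fun x => w x * deriv f x) volume :=
          h.memL2Loc.locallyIntegrable.integrable_smul_right_of_hasCompactSupport hdcont hdc
        have i2 : Integrable (fun x => P x * deriv f x) volume :=
          hP.continuous.locallyIntegrable.integrable_smul_right_of_hasCompactSupport hdcont hdc
        simp only [Pi.sub_apply, sub_mul]
        rw [integral_sub i1 i2, h1, h2, sub_self]
    refine ⟨fun x => P x + c, ?_, hP.add_const c, h.deriv_memL2Loc⟩
    filter_upwards [hc] with x hx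
    simp only [Pi.sub_apply] at hx
    linarith
  · rintro ⟨W, hw, hW, hv⟩
    refine ⟨hW.continuous.memL2Loc.congr hw.symm, hv, fun f hf hfc => ?_⟩
    rw [← hW.hasWeakDeriv f hf hfc]
    exact integral_congr_ae (hw.mono fun x hx => by simp only [hx])

/-! ### Compact operators and attained Rayleigh quotients -/

/-- A nonnegative-definite quadratic functional, composed with a compact operator, attains its
Rayleigh quotient. -/
theorem exists_rayleigh_maximizer {E Y : Type*} [NormedAddCommGroup E] [InnerProductSpace ℝ E]
    [CompleteSpace E] [NormedAddCommGroup Y] [NormedSpace ℝ Y] (T : E →L[ℝ] Y) (K : Set Y)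
    (hK : IsCompact K) (hTK : ∀ x, ‖x‖ ≤ 1 → T x ∈ K) (β : Y → ℝ) (hβ : Continuous β)
    (hhom : ∀ (c : ℝ) u, β (c • u) = c ^ 2 * β u)
    (hpar : ∀ u v, β (u + v) + β (u - v) = 2 * β u + 2 * β v)
    (hpos : ∃ x, 0 < β (T x)) :
    ∃ C > 0, ∃ x, x ≠ 0 ∧ β (T x) = C * ‖x‖ ^ 2 ∧ ∀ y, β (T y) ≤ C * ‖y‖ ^ 2 := by
  set S : Set ℝ := (fun x => β (T x)) '' Metric.closedBall 0 1 with hS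
  have hbdd : BddAbove S := by
    refine (hK.image hβ).bddAbove.mono ?_
    rintro _ ⟨x, hx, rfl⟩
    exact ⟨T x, hTK x (by simpa using hx), rfl⟩
  have hne : S.Nonempty := ⟨_, 0, by simp, rfl⟩
  set C := sSup S with hC
  have hβ0 : β 0 = 0 := by simpa using hhom 0 0
  have hle : ∀ y, β (T y) ≤ C * ‖y‖ ^ 2 := by
    intro y
    rcases eq_or_ne y 0 with rfl | hy
    · simp [hβ0]
    · have h1 : β (T (‖y‖⁻¹ • y)) ≤ C := by
        refine le_csSup hbdd ⟨_, ?_, rfl⟩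
        simp [norm_smul, norm_ne_zero_iff.2 hy]
      rw [map_smul, hhom] at h1
      have h2 : 0 < ‖y‖ := norm_pos_iff.2 hy
      rw [inv_pow, inv_mul_le_iff₀ (by positivity)] at h1
      linarith
  have hCpos : 0 < C := by
    obtain ⟨x, hx⟩ := hpos
    by_contra hc
    nlinarith [hle x, sq_nonneg ‖x‖, not_lt.1 hc]
  obtain ⟨u, -, hu, huS⟩ := exists_seq_tendsto_sSup hne hbdd
  choose x hx hxu using huS
  have hx1 : ∀ n, ‖x n‖ ≤ 1 := fun n => by simpa using hx n
  obtain ⟨y, -, φ, hφ, hy⟩ := hK.tendsto_subseq fun n => hTK (x n) (hx1 n)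
  have hβlim : Filter.Tendsto (fun n => β (T (x (φ n)))) Filter.atTop (nhds C) := by
    have : (fun n => β (T (x (φ n)))) = u ∘ φ := funext fun n => hxu (φ n)
    rw [this]
    exact hu.comp hφ.tendsto_atTop
  -- Parallelogram laws for the norm and for `β`, with the bound applied to `z + w`. Along a
  -- maximizing sequence whose images converge, the right side tends to zero, so the sequence itself
  -- is Cauchy and no weak compactness is needed.
  have hest : ∀ z w : E, ‖z‖ ≤ 1 → ‖w‖ ≤ 1 → C * ‖z - w‖ ^ 2 ≤
      2 * (C - β (T z)) + 2 * (C - β (T w)) + β (T z - T w) := by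
    intro z w hz hw
    have h1 := hle (z + w)
    have h2 := hpar (T z) (T w)
    rw [map_add] at h1
    have h3 := parallelogram_law_with_norm ℝ z w
    have hz2 : ‖z‖ ^ 2 ≤ 1 := by nlinarith [norm_nonneg z]
    have hw2 : ‖w‖ ^ 2 ≤ 1 := by nlinarith [norm_nonneg w]
    nlinarith
  have hcauchy : CauchySeq fun n => x (φ n) := by
    rw [Metric.cauchySeq_iff]
    intro ε hε
    have h1 : ∀ᶠ d in nhds (0 : Y), β d < C * ε ^ 2 / 2 :=
      (hβ.tendsto' 0 0 hβ0).eventually_lt_const (by positivity)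
    obtain ⟨δ, hδ, h2⟩ := Metric.eventually_nhds_iff.1 h1
    obtain ⟨N₁, hN₁⟩ := Metric.cauchySeq_iff.1 hy.cauchySeq δ hδ
    obtain ⟨N₂, hN₂⟩ := Filter.eventually_atTop.1
      (hβlim.eventually_const_lt (u := C - C * ε ^ 2 / 8) (by nlinarith [sq_pos_of_pos hε]))
    refine ⟨max N₁ N₂, fun m hm n hn => ?_⟩
    have hm1 := hN₂ m ((le_max_right _ _).trans hm)
    have hn1 := hN₂ n ((le_max_right _ _).trans hn)
    have hd := hN₁ m ((le_max_left _ _).trans hm) n ((le_max_left _ _).trans hn)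
    have hd2 : β (T (x (φ m)) - T (x (φ n))) < C * ε ^ 2 / 2 :=
      h2 (by rw [dist_zero_right, ← dist_eq_norm]; exact hd)
    have h3 := hest _ _ (hx1 (φ m)) (hx1 (φ n))
    rw [dist_eq_norm]
    refine lt_of_pow_lt_pow_left₀ 2 hε.le ?_
    have : C * ‖x (φ m) - x (φ n)‖ ^ 2 < C * ε ^ 2 := by linarith
    exact lt_of_mul_lt_mul_left this hCpos.le
  obtain ⟨z, hz⟩ := cauchySeq_tendsto_of_complete hcauchy
  have hβz : β (T z) = C :=
    tendsto_nhds_unique (((hβ.comp T.continuous).tendsto z).comp hz) hβlim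
  have hz1 : ‖z‖ ≤ 1 := le_of_tendsto hz.norm (Filter.Eventually.of_forall fun n => hx1 _)
  refine ⟨C, hCpos, z, ?_, ?_, hle⟩
  · rintro rfl
    rw [map_zero, hβ0] at hβz
    exact hCpos.ne hβz
  · refine le_antisymm (hle z) ?_
    rw [hβz]
    nlinarith [mul_le_mul_of_nonneg_left (pow_le_one₀ (n := 2) (norm_nonneg z) hz1) hCpos.le]

open scoped BoundedContinuousFunction in
/-- A family of vectors depending continuously on a point of a compact space defines a compact
operator into the continuous functions. -/
theorem exists_inner_operator {E α : Type*} [NormedAddCommGroup E] [InnerProductSpace ℝ E]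
    [TopologicalSpace α] [CompactSpace α] (g : α → E) (hg : Continuous g) :
    ∃ T : E →L[ℝ] (α →ᵇ ℝ), (∀ f t, T f t = inner ℝ (g t) f) ∧
      ∃ K, IsCompact K ∧ ∀ f, ‖f‖ ≤ 1 → T f ∈ K := by
  obtain ⟨R, hR⟩ := isCompact_univ.exists_bound_of_continuousOn hg.continuousOn
  have hR' : ∀ t, ‖g t‖ ≤ R ⊔ 0 := fun t => (hR t trivial).trans (le_max_left _ _)
  have hcont : ∀ f : E, Continuous fun t => inner ℝ (g t) f := fun f => hg.inner continuous_const
  let L : E →ₗ[ℝ] (α →ᵇ ℝ) :=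
    { toFun := fun f => BoundedContinuousFunction.mkOfCompact ⟨fun t => inner ℝ (g t) f, hcont f⟩
      map_add' := fun f f' => by ext t; simp [inner_add_right]
      map_smul' := fun c f => by ext t; simp [inner_smul_right] }
  have hL : ∀ f t, L f t = inner ℝ (g t) f := fun f t => rfl
  have hbound : ∀ f t, ‖L f t‖ ≤ (R ⊔ 0) * ‖f‖ := fun f t => by
    rw [hL]
    exact (norm_inner_le_norm _ _).trans (mul_le_mul_of_nonneg_right (hR' t) (norm_nonneg _))
  refine ⟨L.mkContinuous (R ⊔ 0) fun f => ?_, fun f t => rfl, ?_⟩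
  · exact (BoundedContinuousFunction.norm_le (by positivity)).2 (hbound f)
  set A : Set (α →ᵇ ℝ) := L '' Metric.closedBall 0 1 with hA
  refine ⟨closure A, BoundedContinuousFunction.arzela_ascoli (Set.Icc (-(R ⊔ 0)) (R ⊔ 0))
    isCompact_Icc A ?_ ?_, fun f hf => subset_closure ⟨f, by simpa using hf, rfl⟩⟩
  · rintro _ t ⟨f, hf, rfl⟩
    have hf1 : ‖f‖ ≤ 1 := by simpa using hf
    have h0 : (0 : ℝ) ≤ R ⊔ 0 := le_max_right _ _
    exact abs_le.1 ((hbound f t).trans (by nlinarith))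
  · intro t
    rw [Metric.equicontinuousAt_iff_right]
    intro ε hε
    obtain ⟨U, hU, hUt⟩ : ∃ U ∈ nhds t, ∀ s ∈ U, dist (g s) (g t) < ε :=
      ⟨_, Metric.tendsto_nhds.1 (hg.tendsto t) ε hε, fun s hs => hs⟩
    filter_upwards [hU] with s hs
    rintro ⟨_, f, hf, rfl⟩
    have hf1 : ‖f‖ ≤ 1 := by simpa using hf
    change dist (L f t) (L f s) < ε
    rw [hL, hL, Real.dist_eq, ← inner_sub_left]
    refine (abs_real_inner_le_norm _ _).trans_lt ?_
    have := hUt s hs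
    rw [dist_comm, dist_eq_norm] at this
    nlinarith [norm_nonneg (g t - g s), norm_nonneg f]

/-! ### Periodic weights -/

theorem measurable_angle : Measurable angle := by
  have : angle = fun θ => Int.fract (θ / (2 * Real.pi)) * (2 * Real.pi) :=
    funext fun θ => toIcoMod_eq_fract_mul _ θ
  rw [this]
  exact (measurable_fract.comp (measurable_id.div_const _)).mul_const _

theorem MeasureTheory.LocallyIntegrable.bdd_mul_of_ae {c f : ℝ → ℝ} {K : ℝ}
    (hf : LocallyIntegrable f volume) (hc : AEStronglyMeasurable c volume)
    (hK : ∀ᵐ x, |c x| ≤ K) : LocallyIntegrable (fun x => c x * f x) volume := by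
  rw [locallyIntegrable_iff] at hf ⊢
  exact fun k hk => (hf k hk).bdd_mul hc.restrict (ae_restrict_of_ae hK)

theorem AEPeriodic.locallyIntegrable {g : ℝ → ℝ} (hg : AEPeriodic g)
    (hi : IntervalIntegrable g volume 0 (2 * Real.pi)) : LocallyIntegrable g volume := by
  have h := hg.ae_eq_comp_angle
  have hp : Function.Periodic (fun θ => g (angle θ)) (2 * Real.pi) := fun θ => by
    simp only [angle_add_two_pi]
  have h1 := hp.intervalIntegrable₀ Real.two_pi_pos.ne'
    (hi.congr_ae (ae_restrict_of_ae h))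
  exact (locallyIntegrable_of_intervalIntegrable h1).congr h.symm

theorem MemL2Loc.locallyIntegrable_sq {v : ℝ → ℝ} (h : MemL2Loc v) :
    LocallyIntegrable (fun x => v x ^ 2) volume :=
  locallyIntegrable_iff.2 fun K hK => (h K hK).integrable_sq

theorem MemL2Loc.locallyIntegrable_mul {u v : ℝ → ℝ} (hu : MemL2Loc u) (hv : MemL2Loc v) :
    LocallyIntegrable (fun x => u x * v x) volume :=
  locallyIntegrable_iff.2 fun K hK => (hu K hK).integrable_mul (hv K hK)

theorem memL2Loc_of_locallyIntegrable_sq {v : ℝ → ℝ} (hv : AEStronglyMeasurable v volume)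
    (h : LocallyIntegrable (fun x => v x ^ 2) volume) : MemL2Loc v := fun K hK =>
  (memLp_two_iff_integrable_sq hv.restrict).2 ((locallyIntegrable_iff.1 h) K hK)

theorem MemL2Loc.bdd_mul_of_ae {c f : ℝ → ℝ} {K : ℝ} (hf : MemL2Loc f)
    (hc : AEStronglyMeasurable c volume) (hK : ∀ᵐ x, |c x| ≤ K) :
    MemL2Loc (fun x => c x * f x) := fun k hk => by
  have h1 : MemLp c ⊤ (volume.restrict k) :=
    memLp_top_of_bound hc.restrict K (ae_restrict_of_ae hK)
  exact (hf k hk).mul (p := ⊤) (q := 2) (r := 2) h1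

/-- A measurable periodic weight bounded above and below away from zero. -/
structure IsWeight (a : ℝ → ℝ) : Prop where
  aestronglyMeasurable : AEStronglyMeasurable a volume
  periodic : AEPeriodic a
  bounds : ∃ m K : ℝ, 0 < m ∧ ∀ᵐ x, m ≤ a x ∧ a x ≤ K

namespace IsWeight

variable {a : ℝ → ℝ}

theorem ae_pos (ha : IsWeight a) : ∀ᵐ x, 0 < a x := by
  obtain ⟨m, K, hm, h⟩ := ha.bounds
  exact h.mono fun x hx => hm.trans_le hx.1

theorem exists_abs_le (ha : IsWeight a) : ∃ K, ∀ᵐ x, |a x| ≤ K := by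
  obtain ⟨m, K, hm, h⟩ := ha.bounds
  exact ⟨K, h.mono fun x hx => by rw [abs_of_pos (hm.trans_le hx.1)]; exact hx.2⟩

theorem locallyIntegrable_mul (ha : IsWeight a) {f : ℝ → ℝ} (hf : LocallyIntegrable f volume) :
    LocallyIntegrable (fun x => a x * f x) volume := by
  obtain ⟨K, hK⟩ := ha.exists_abs_le
  exact hf.bdd_mul_of_ae ha.aestronglyMeasurable hK

theorem memL2Loc_mul (ha : IsWeight a) {f : ℝ → ℝ} (hf : MemL2Loc f) :
    MemL2Loc (fun x => a x * f x) := by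
  obtain ⟨K, hK⟩ := ha.exists_abs_le
  exact hf.bdd_mul_of_ae ha.aestronglyMeasurable hK

theorem locallyIntegrable (ha : IsWeight a) : LocallyIntegrable a volume := by
  simpa using ha.locallyIntegrable_mul (locallyIntegrable_const (1 : ℝ))

theorem intervalIntegrable_mul (ha : IsWeight a) {f : ℝ → ℝ} (hf : Continuous f) (x y : ℝ) :
    IntervalIntegrable (fun x => a x * f x) volume x y :=
  (ha.locallyIntegrable_mul hf.locallyIntegrable).intervalIntegrable_real x y

theorem comp_pow (ha : IsWeight a) {m : ℝ} (hm : 0 < m) (h : ∀ᵐ x, m ≤ a x) (r : ℝ) :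
    IsWeight fun x => a x ^ r := by
  obtain ⟨_, K, _, hK⟩ := ha.bounds
  refine ⟨(ha.aestronglyMeasurable.aemeasurable.pow_const r).aestronglyMeasurable,
    ha.periodic.comp₂ ha.periodic fun s _ => s ^ r, ?_⟩
  rcases le_total 0 r with hr | hr
  · refine ⟨m ^ r, K ^ r, Real.rpow_pos_of_pos hm r, ?_⟩
    filter_upwards [h, hK] with x h1 h2
    exact ⟨Real.rpow_le_rpow hm.le h1 hr, Real.rpow_le_rpow (hm.le.trans h1) h2.2 hr⟩
  · have hK0 : 0 < K := by
      obtain ⟨x, h1, h2⟩ := (h.and hK).exists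
      linarith [h2.2]
    refine ⟨K ^ r, m ^ r, Real.rpow_pos_of_pos hK0 r, ?_⟩
    filter_upwards [h, hK] with x h1 h2
    exact ⟨Real.rpow_le_rpow_of_nonpos (hm.trans_le h1) h2.2 hr,
      Real.rpow_le_rpow_of_nonpos hm h1 hr⟩

theorem rpow (ha : IsWeight a) (r : ℝ) : IsWeight fun x => a x ^ r := by
  obtain ⟨m, K, hm, h⟩ := ha.bounds
  exact ha.comp_pow hm (h.mono fun _ hx => hx.1) r

theorem inv (ha : IsWeight a) : IsWeight fun x => (a x)⁻¹ := by
  have h := ha.rpow (-1)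
  simp only [Real.rpow_neg_one] at h
  exact h

theorem sqrt (ha : IsWeight a) : IsWeight fun x => √(a x) := by
  have h := ha.rpow (1 / 2)
  simp only [← Real.sqrt_eq_rpow] at h
  exact h

theorem integral_pos (ha : IsWeight a) : 0 < ∫ x in (0 : ℝ)..2 * Real.pi, a x := by
  obtain ⟨m, K, hm, h⟩ := ha.bounds
  have h1 : ∫ x in (0 : ℝ)..2 * Real.pi, m ≤ ∫ x in (0 : ℝ)..2 * Real.pi, a x :=
    intervalIntegral.integral_mono_ae Real.two_pi_pos.le (by simp)
      (ha.locallyIntegrable.intervalIntegrable_real _ _) (h.mono fun x hx => hx.1)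
  simp only [intervalIntegral.integral_const, smul_eq_mul] at h1
  have := mul_pos Real.two_pi_pos hm
  linarith

end IsWeight

/-! ### Admissible functions and the weighted variance -/

/-- Continuous representatives of admissible functions. -/
structure AdmissiblePair (a w v : ℝ → ℝ) : Prop where
  isPrimitive : IsPrimitive w v
  memL2Loc : MemL2Loc v
  periodic : Function.Periodic w (2 * Real.pi)
  constraint : ∫ θ in (0 : ℝ)..(2 * Real.pi), a θ * w θ = 0

theorem admissible_iff {a w v : ℝ → ℝ} :
    Admissible a w v ↔ ∃ W, w =ᵐ[volume] W ∧ AdmissiblePair a W v := by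
  constructor
  · intro h
    obtain ⟨W, hw, hW, hv⟩ := memH1Loc_iff.1 h.memH1Loc
    refine ⟨W, hw, hW, hv, (h.periodic.congr hw).periodic hW.continuous, ?_⟩
    refine Eq.trans ?_ h.constraint
    exact intervalIntegral.integral_congr_ae (hw.mono fun x hx _ => by simp only [hx])
  · rintro ⟨W, hw, h⟩
    refine ⟨memH1Loc_iff.2 ⟨W, hw, h.isPrimitive, h.memL2Loc⟩,
      h.periodic.aePeriodic.congr hw.symm, ?_⟩
    refine Eq.trans ?_ h.constraint
    exact intervalIntegral.integral_congr_ae (hw.mono fun x hx _ => by simp only [hx])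

/-- Pointwise derivatives of a periodic function at `x` and `x + 2π` agree wherever both exist. -/
theorem AdmissiblePair.aePeriodic_deriv {a w v : ℝ → ℝ} (h : AdmissiblePair a w v) :
    AEPeriodic v := by
  have h1 := h.isPrimitive.ae_hasDerivAt
  have h2 := (measurePreserving_add_right volume (2 * Real.pi)).quasiMeasurePreserving.ae h1
  filter_upwards [h1, h2] with x hx hx'
  have h3 : HasDerivAt (fun y => w (y + 2 * Real.pi)) (v (x + 2 * Real.pi)) x :=
    hx'.comp_add_const x (2 * Real.pi)
  rw [show (fun y => w (y + 2 * Real.pi)) = w from funext h.periodic] at h3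
  exact h3.unique hx

theorem IsPrimitive.periodic {f g : ℝ → ℝ} (h : IsPrimitive f g) (hg : AEPeriodic g)
    (h0 : ∫ x in (0 : ℝ)..2 * Real.pi, g x = 0) : Function.Periodic f (2 * Real.pi) := fun x => by
  have := h.sub_eq x (x + 2 * Real.pi)
  rw [hg.intervalIntegral_eq, h0] at this
  linarith

theorem integral_eq_zero_of_periodic {f g : ℝ → ℝ} (h : IsPrimitive f g)
    (hf : Function.Periodic f (2 * Real.pi)) : ∫ x in (0 : ℝ)..2 * Real.pi, g x = 0 := by
  rw [← h.sub_eq]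
  have := hf 0
  rw [zero_add] at this
  rw [this, sub_self]

/-- The weighted variance of `f` over a period. -/
noncomputable def periodVariance (a f : ℝ → ℝ) : ℝ :=
  (∫ x in (0 : ℝ)..2 * Real.pi, a x * f x ^ 2) -
    (∫ x in (0 : ℝ)..2 * Real.pi, a x * f x) ^ 2 / ∫ x in (0 : ℝ)..2 * Real.pi, a x

/-- Invariance under constants lets the variance replace the constraint: one maximizes over all
periodic functions and subtracts the weighted mean afterwards. -/
theorem periodVariance_sub_const {a f : ℝ → ℝ} (ha : IsWeight a) (hf : Continuous f) (m : ℝ) :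
    periodVariance a (fun x => f x - m) = periodVariance a f := by
  unfold periodVariance
  have hA := ha.integral_pos
  set A := ∫ x in (0 : ℝ)..2 * Real.pi, a x
  have e1 : ∫ x in (0 : ℝ)..2 * Real.pi, a x * (f x - m) =
      (∫ x in (0 : ℝ)..2 * Real.pi, a x * f x) - m * A := by
    rw [← intervalIntegral.integral_const_mul, ← intervalIntegral.integral_sub
      (ha.intervalIntegrable_mul hf _ _)
      ((ha.locallyIntegrable.intervalIntegrable_real _ _).const_mul m)]
    congr 1; ext x; ring
  have e2 : ∫ x in (0 : ℝ)..2 * Real.pi, a x * (f x - m) ^ 2 =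
      (∫ x in (0 : ℝ)..2 * Real.pi, a x * f x ^ 2) -
        (2 * m * (∫ x in (0 : ℝ)..2 * Real.pi, a x * f x) - m ^ 2 * A) := by
    rw [← intervalIntegral.integral_const_mul, ← intervalIntegral.integral_const_mul,
      ← intervalIntegral.integral_sub ((ha.intervalIntegrable_mul hf _ _).const_mul _)
        ((ha.locallyIntegrable.intervalIntegrable_real _ _).const_mul _),
      ← intervalIntegral.integral_sub (ha.intervalIntegrable_mul (f := fun x => f x ^ 2) (by fun_prop) _ _)
        (((ha.intervalIntegrable_mul hf _ _).const_mul _).sub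
        ((ha.locallyIntegrable.intervalIntegrable_real _ _).const_mul _))]
    congr 1; ext x; ring
  rw [e1, e2]
  field_simp
  ring

theorem periodVariance_of_integral_eq_zero {a f : ℝ → ℝ}
    (h : ∫ x in (0 : ℝ)..2 * Real.pi, a x * f x = 0) :
    periodVariance a f = ∫ x in (0 : ℝ)..2 * Real.pi, a x * f x ^ 2 := by
  rw [periodVariance, h]; simp

/-- Subtracting the weighted mean. -/
theorem integral_mul_sub_mean {a f : ℝ → ℝ} (ha : IsWeight a) (hf : Continuous f) :
    ∫ x in (0 : ℝ)..2 * Real.pi, a x * (f x - (∫ x in (0 : ℝ)..2 * Real.pi, a x * f x) /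
      ∫ x in (0 : ℝ)..2 * Real.pi, a x) = 0 := by
  have hA := ha.integral_pos
  simp only [mul_sub]
  rw [intervalIntegral.integral_sub (ha.intervalIntegrable_mul hf _ _)
      ((ha.locallyIntegrable.intervalIntegrable_real _ _).mul_const _),
    intervalIntegral.integral_mul_const]
  field_simp
  ring

theorem periodVariance_smul (a f : ℝ → ℝ) (c : ℝ) :
    periodVariance a (fun x => c * f x) = c ^ 2 * periodVariance a f := by
  unfold periodVariance
  have e1 : ∫ x in (0 : ℝ)..2 * Real.pi, a x * (c * f x) =
      c * ∫ x in (0 : ℝ)..2 * Real.pi, a x * f x := by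
    rw [← intervalIntegral.integral_const_mul]; congr 1; ext x; ring
  have e2 : ∫ x in (0 : ℝ)..2 * Real.pi, a x * (c * f x) ^ 2 =
      c ^ 2 * ∫ x in (0 : ℝ)..2 * Real.pi, a x * f x ^ 2 := by
    rw [← intervalIntegral.integral_const_mul]; congr 1; ext x; ring
  rw [e1, e2]; ring

theorem periodVariance_parallelogram {a f g : ℝ → ℝ} (ha : IsWeight a) (hf : Continuous f)
    (hg : Continuous g) :
    periodVariance a (fun x => f x + g x) + periodVariance a (fun x => f x - g x) =
      2 * periodVariance a f + 2 * periodVariance a g := by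
  unfold periodVariance
  have i1 := ha.intervalIntegrable_mul hf 0 (2 * Real.pi)
  have i2 := ha.intervalIntegrable_mul hg 0 (2 * Real.pi)
  have j1 := ha.intervalIntegrable_mul (f := fun x => f x ^ 2) (by fun_prop) 0 (2 * Real.pi)
  have j2 := ha.intervalIntegrable_mul (f := fun x => g x ^ 2) (by fun_prop) 0 (2 * Real.pi)
  have j3 := (ha.intervalIntegrable_mul (f := fun x => f x * g x) (by fun_prop) 0 (2 * Real.pi)).const_mul 2
  have e1 : ∫ x in (0 : ℝ)..2 * Real.pi, a x * (f x + g x) =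
      (∫ x in (0 : ℝ)..2 * Real.pi, a x * f x) + ∫ x in (0 : ℝ)..2 * Real.pi, a x * g x := by
    rw [← intervalIntegral.integral_add i1 i2]; congr 1; ext x; ring
  have e2 : ∫ x in (0 : ℝ)..2 * Real.pi, a x * (f x - g x) =
      (∫ x in (0 : ℝ)..2 * Real.pi, a x * f x) - ∫ x in (0 : ℝ)..2 * Real.pi, a x * g x := by
    rw [← intervalIntegral.integral_sub i1 i2]; congr 1; ext x; ring
  have e3 : ∫ x in (0 : ℝ)..2 * Real.pi, a x * (f x + g x) ^ 2 =
      (∫ x in (0 : ℝ)..2 * Real.pi, a x * f x ^ 2) +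
        (∫ x in (0 : ℝ)..2 * Real.pi, a x * g x ^ 2) +
        ∫ x in (0 : ℝ)..2 * Real.pi, 2 * (a x * (f x * g x)) := by
    rw [← intervalIntegral.integral_add j1 j2, ← intervalIntegral.integral_add (j1.add j2) j3]
    congr 1; ext x; ring
  have e4 : ∫ x in (0 : ℝ)..2 * Real.pi, a x * (f x - g x) ^ 2 =
      (∫ x in (0 : ℝ)..2 * Real.pi, a x * f x ^ 2) +
        (∫ x in (0 : ℝ)..2 * Real.pi, a x * g x ^ 2) -
        ∫ x in (0 : ℝ)..2 * Real.pi, 2 * (a x * (f x * g x)) := by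
    rw [← intervalIntegral.integral_add j1 j2, ← intervalIntegral.integral_sub (j1.add j2) j3]
    congr 1; ext x; ring
  rw [e1, e2, e3, e4]; ring

theorem periodVariance_pos {a f : ℝ → ℝ} (ha : IsWeight a) (hf : Continuous f) {s t : ℝ}
    (hs : s ∈ Set.Ioo 0 (2 * Real.pi)) (ht : t ∈ Set.Ioo 0 (2 * Real.pi)) (hne : f s ≠ f t) :
    0 < periodVariance a f := by
  set m := (∫ x in (0 : ℝ)..2 * Real.pi, a x * f x) / ∫ x in (0 : ℝ)..2 * Real.pi, a x with hm
  rw [← periodVariance_sub_const ha hf m,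
    periodVariance_of_integral_eq_zero (integral_mul_sub_mean ha hf)]
  have hcont : Continuous fun x => (f x - m) ^ 2 := by fun_prop
  have hnn : ∀ᵐ x, 0 ≤ a x * (f x - m) ^ 2 := ha.ae_pos.mono fun x hx => by positivity
  refine lt_of_le_of_ne (intervalIntegral.integral_nonneg_of_ae Real.two_pi_pos.le hnn) fun h0 => ?_
  have h1 := (intervalIntegral.integral_eq_zero_iff_of_le_of_nonneg_ae Real.two_pi_pos.le
    (ae_restrict_of_ae hnn) (ha.intervalIntegrable_mul hcont _ _)).1 h0.symm
  have h2 : (fun x => (f x - m) ^ 2) =ᵐ[volume.restrict (Set.Ioo 0 (2 * Real.pi))] fun _ => 0 := by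
    have h3 := ae_restrict_of_ae_restrict_of_subset (Set.Ioo_subset_Ioc_self) h1
    filter_upwards [h3, ae_restrict_of_ae ha.ae_pos] with x hx hx'
    simpa [hx'.ne'] using hx
  have h4 := Measure.eqOn_open_of_ae_eq h2 isOpen_Ioo hcont.continuousOn continuousOn_const
  have e1 := h4 hs
  have e2 := h4 ht
  simp only [ne_eq, OfNat.ofNat_ne_zero, not_false_eq_true, pow_eq_zero_iff] at e1 e2
  exact hne (by linarith)

/-! ### Existence of an extremal function -/

open scoped BoundedContinuousFunction in
theorem continuous_integral_mul_comp_bcf {α : Type*} [TopologicalSpace α] {a : ℝ → ℝ}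
    (ha : IsWeight a) {e : ℝ → α} (he : Continuous e) {F : ℝ → ℝ} (hF : Continuous F) :
    Continuous fun u : α →ᵇ ℝ => ∫ x in (0 : ℝ)..2 * Real.pi, a x * F (u (e x)) := by
  rw [continuous_iff_continuousAt]
  intro u₀
  obtain ⟨R, hR⟩ := (isCompact_Icc (a := -(‖u₀‖ + 1)) (b := ‖u₀‖ + 1)).exists_bound_of_continuousOn
    hF.continuousOn
  obtain ⟨K, hK⟩ := ha.exists_abs_le
  refine intervalIntegral.continuousAt_of_dominated_interval (bound := fun _ => K * R) ?_ ?_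
    (by simp) ?_
  · refine Filter.Eventually.of_forall fun u => ?_
    exact (ha.aestronglyMeasurable.mul
      (hF.comp (u.continuous.comp he)).aestronglyMeasurable).restrict
  · filter_upwards [Metric.ball_mem_nhds u₀ one_pos] with u hu
    filter_upwards [hK] with x hx _
    have h1 : ‖u‖ ≤ ‖u₀‖ + 1 := by
      rw [Metric.mem_ball, dist_eq_norm] at hu
      linarith [norm_le_norm_add_norm_sub' u u₀]
    have h2 := hR (u (e x)) (abs_le.1 ((u.norm_coe_le_norm _).trans h1))
    rw [norm_mul]
    exact mul_le_mul hx h2 (norm_nonneg _) ((abs_nonneg _).trans hx)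
  · refine Filter.Eventually.of_forall fun x _ => ?_
    exact (continuous_const.mul (hF.comp (BoundedContinuousFunction.evalCLM ℝ (e x)).continuous)
      ).continuousAt

theorem norm_toLp_sq {μ : Measure ℝ} {F : ℝ → ℝ} (hF : MemLp F 2 μ) :
    ‖hF.toLp F‖ ^ 2 = ∫ x, F x ^ 2 ∂μ := by
  rw [← real_inner_self_eq_norm_sq, L2.inner_def]
  refine integral_congr_ae (hF.coeFn_toLp.mono fun x hx => ?_)
  simp only [hx, real_inner_self_eq_norm_sq, Real.norm_eq_abs, sq_abs]

theorem norm_sq_eq_integral {μ : Measure ℝ} (f : Lp ℝ 2 μ) : ‖f‖ ^ 2 = ∫ x, f x ^ 2 ∂μ := by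
  rw [← real_inner_self_eq_norm_sq, L2.inner_def]
  simp only [real_inner_self_eq_norm_sq, Real.norm_eq_abs, sq_abs]

theorem continuous_of_norm_sub_sq_le {X E : Type*} [MetricSpace X] [NormedAddCommGroup E]
    {g : X → E} {K : ℝ} (h : ∀ s t, ‖g s - g t‖ ^ 2 ≤ K * dist s t) : Continuous g := by
  rw [continuous_iff_continuousAt]
  intro t
  rw [ContinuousAt, tendsto_iff_norm_sub_tendsto_zero]
  have h1 : Filter.Tendsto (fun s => √(K * dist s t)) (nhds t) (nhds 0) := by
    have : Continuous fun s => √(K * dist s t) := by fun_prop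
    simpa using this.tendsto t
  exact squeeze_zero (fun _ => norm_nonneg _) (fun s => Real.le_sqrt_of_sq_le (h s t)) h1

open scoped BoundedContinuousFunction in
/-- The operator `f ↦ ∫₀ˣ c f` is compact from `L²(0, 2π)` to the continuous functions. -/
theorem exists_primitive_operator {c : ℝ → ℝ} {K : ℝ} (hc : AEStronglyMeasurable c volume)
    (hK : ∀ᵐ x, |c x| ≤ K) :
    ∃ T : Lp ℝ 2 (volume.restrict (Set.Ioc 0 (2 * Real.pi))) →L[ℝ]
        (Set.Icc (0 : ℝ) (2 * Real.pi) →ᵇ ℝ),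
      (∀ f t, T f t = ∫ x in (0 : ℝ)..t, c x * f x) ∧
      ∃ S, IsCompact S ∧ ∀ f, ‖f‖ ≤ 1 → T f ∈ S := by
  set μ := volume.restrict (Set.Ioc 0 (2 * Real.pi)) with hμ
  have hKμ : ∀ᵐ x ∂μ, |c x| ≤ K := ae_restrict_of_ae hK
  have hG : ∀ t : ℝ, MemLp ((Set.Ioc 0 t).indicator c) 2 μ := fun t =>
    MemLp.indicator measurableSet_Ioc (MemLp.of_bound hc.restrict K hKμ)
  -- The primitive at `t` is the inner product with `c` cut off to `(0, t]`, and these vectors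
  -- depend continuously on `t`, with exponent one half.
  let g : Set.Icc (0 : ℝ) (2 * Real.pi) → Lp ℝ 2 μ := fun t => (hG t).toLp _
  have hle : ∀ s t : Set.Icc (0 : ℝ) (2 * Real.pi), (s : ℝ) ≤ t →
      ‖g t - g s‖ ^ 2 ≤ K ^ 2 * ((t : ℝ) - s) := by
    intro s t hst
    rw [← MemLp.toLp_sub, norm_toLp_sq]
    have h1 : ∫ x, ((Set.Ioc 0 (t : ℝ)).indicator c - (Set.Ioc 0 (s : ℝ)).indicator c) x ^ 2 ∂μ ≤
        ∫ x, (Set.Ioc (s : ℝ) t).indicator (fun _ => K ^ 2) x ∂μ := by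
      refine integral_mono_ae (((hG t).sub (hG s)).integrable_sq)
        ((integrable_const _).indicator measurableSet_Ioc) ?_
      filter_upwards [hKμ] with x hx
      have hsq : c x ^ 2 ≤ K ^ 2 := sq_le_sq' (abs_le.1 hx).1 (abs_le.1 hx).2
      have hs0 := s.2.1
      simp only [Pi.sub_apply, Set.indicator, Set.mem_Ioc]
      split_ifs <;> first | (exfalso; grind) | (simp [hsq]; try positivity)
    refine h1.trans ?_
    rw [integral_indicator measurableSet_Ioc, hμ, Measure.restrict_restrict measurableSet_Ioc,
      setIntegral_const, smul_eq_mul, mul_comm,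
      Set.inter_eq_left.2 (Set.Ioc_subset_Ioc s.2.1 t.2.2)]
    simp [hst]
  have hg : Continuous g := by
    refine continuous_of_norm_sub_sq_le (K := K ^ 2) fun s t => ?_
    rw [Subtype.dist_eq, Real.dist_eq]
    rcases le_total (s : ℝ) t with h | h
    · rw [norm_sub_rev, abs_sub_comm, abs_of_nonneg (sub_nonneg.2 h)]
      exact hle s t h
    · rw [abs_of_nonneg (sub_nonneg.2 h)]
      exact hle t s h
  obtain ⟨T, hT, hS⟩ := exists_inner_operator g hg
  refine ⟨T, fun f t => ?_, hS⟩
  have h1 : ∀ F : ℝ → ℝ, ∫ x in (0 : ℝ)..t, F x = ∫ x, (Set.Ioc 0 (t : ℝ)).indicator F x ∂μ := by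
    intro F
    rw [integral_indicator measurableSet_Ioc, hμ, Measure.restrict_restrict measurableSet_Ioc,
      Set.inter_eq_left.2 (Set.Ioc_subset_Ioc (le_refl (0 : ℝ)) t.2.2),
      intervalIntegral.integral_of_le t.2.1]
  rw [hT, L2.inner_def, h1 fun x => c x * f x]
  refine integral_congr_ae ((hG t).coeFn_toLp.mono fun x hx => ?_)
  have hx' : (g t) x = (Set.Ioc 0 (t : ℝ)).indicator c x := hx
  simp only [hx', Set.indicator]
  split_ifs <;> simp [mul_comm]

/-- The unknown is `f = √b w'` in `L²(0, 2π)`: then `‖f‖²` is the denominator, integrating `f / √b`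
recovers `w - w(0)` through a compact operator, and the variance of the result is the numerator for
the mean-free translate. -/
theorem exists_extremal_pair {a b : ℝ → ℝ} (ha : IsWeight a) (hb : IsWeight b) :
    ∃ C > 0,
      (∀ w v, AdmissiblePair a w v → ∫ θ in (0 : ℝ)..2 * Real.pi, a θ * w θ ^ 2 ≤
        C * ∫ θ in (0 : ℝ)..2 * Real.pi, b θ * v θ ^ 2) ∧
      ∃ w v, AdmissiblePair a w v ∧ (∃ x, w x ≠ 0) ∧
        ∫ θ in (0 : ℝ)..2 * Real.pi, a θ * w θ ^ 2 =
          C * ∫ θ in (0 : ℝ)..2 * Real.pi, b θ * v θ ^ 2 := by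
  have hc := hb.sqrt.inv
  obtain ⟨K, hK⟩ := hc.exists_abs_le
  set μ := volume.restrict (Set.Ioc 0 (2 * Real.pi)) with hμ
  obtain ⟨T, hT, S, hS, hTS⟩ := exists_primitive_operator hc.aestronglyMeasurable hK
  have h2π := Real.two_pi_pos
  -- Functions on the closed interval are read on the line through the projection; only their values
  -- on `[0, 2π]` enter the integrals.
  let e : ℝ → Set.Icc (0 : ℝ) (2 * Real.pi) := Set.projIcc 0 (2 * Real.pi) h2π.le
  have he : Continuous e := continuous_projIcc
  have hval : ∀ x ∈ Set.Icc (0 : ℝ) (2 * Real.pi), ((e x : Set.Icc (0 : ℝ) (2 * Real.pi)) : ℝ) = x :=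
    fun x hx => by simp only [e, Set.projIcc_of_mem h2π.le hx]
  let top : Set.Icc (0 : ℝ) (2 * Real.pi) := ⟨2 * Real.pi, h2π.le, le_rfl⟩
  let β : BoundedContinuousFunction (Set.Icc (0 : ℝ) (2 * Real.pi)) ℝ → ℝ :=
    fun u => periodVariance a fun x => u (e x)
  have hucont : ∀ u : BoundedContinuousFunction (Set.Icc (0 : ℝ) (2 * Real.pi)) ℝ,
    Continuous fun x => u (e x) := fun u => u.continuous.comp he
  have hβ : Continuous β := by
    have h1 := continuous_integral_mul_comp_bcf ha he (F := fun x => x ^ 2) (by fun_prop)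
    have h2 := continuous_integral_mul_comp_bcf ha he (F := fun x => x) (by fun_prop)
    exact h1.sub ((h2.pow 2).div_const _)
  let ℓ : Lp ℝ 2 μ →L[ℝ] ℝ := (BoundedContinuousFunction.evalCLM ℝ top).comp T
  have hℓ : ∀ f, ℓ f = T f top := fun f => rfl
  -- Vanishing of the primitive at `2π` is periodicity of `w`; it cuts out a closed subspace.
  let X := LinearMap.ker (ℓ : Lp ℝ 2 μ →ₗ[ℝ] ℝ)
  have hXmem : ∀ f, f ∈ X ↔ T f top = 0 := fun f => LinearMap.mem_ker
  have hXc : CompleteSpace X := (ContinuousLinearMap.isClosed_ker ℓ).completeSpace_coe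
  -- integrals over a period of functions that agree on the period
  have hcongr : ∀ f g : ℝ → ℝ, (∀ x ∈ Set.Icc (0 : ℝ) (2 * Real.pi), f x = g x) →
      periodVariance a f = periodVariance a g := by
    intro f g hfg
    unfold periodVariance
    rw [intervalIntegral.integral_congr (g := fun x => a x * g x ^ 2),
      intervalIntegral.integral_congr (f := fun x => a x * f x) (g := fun x => a x * g x)]
    · intro x hx
      rw [Set.uIcc_of_le h2π.le] at hx
      simp only [hfg x hx]
    · intro x hx
      rw [Set.uIcc_of_le h2π.le] at hx
      simp only [hfg x hx]
  -- a square-integrable derivative gives an element of the Hilbert space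
  have hlift : ∀ w v : ℝ → ℝ, IsPrimitive w v → MemL2Loc v →
      Function.Periodic w (2 * Real.pi) → ∃ f : Lp ℝ 2 μ, f ∈ X ∧
        β (T f) = periodVariance a w ∧ ‖f‖ ^ 2 = ∫ θ in (0 : ℝ)..2 * Real.pi, b θ * v θ ^ 2 := by
    intro w v hw hv hper
    have hmem : MemLp (fun x => √(b x) * v x) 2 μ :=
      ((hb.sqrt.memL2Loc_mul hv) _ isCompact_Icc).mono_measure
        (Measure.restrict_mono Set.Ioc_subset_Icc_self le_rfl)
    have hTf : ∀ t, T (hmem.toLp _) t = w t - w 0 := by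
      intro t
      rw [hT, hw.sub_eq]
      refine intervalIntegral.integral_congr_ae ?_
      have h1 := (ae_restrict_iff' measurableSet_Ioc).1 hmem.coeFn_toLp
      filter_upwards [h1, hb.ae_pos] with x hx hx' hxt
      rw [Set.uIoc_of_le t.2.1] at hxt
      rw [hx ⟨hxt.1, hxt.2.trans t.2.2⟩, inv_mul_cancel_left₀ (Real.sqrt_pos.2 hx').ne']
    refine ⟨hmem.toLp _, ?_, ?_, ?_⟩
    · rw [hXmem, hTf]
      have := hper 0
      rw [zero_add] at this
      change w (2 * Real.pi) - w 0 = 0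
      rw [this, sub_self]
    · rw [← periodVariance_sub_const ha hw.continuous (w 0)]
      refine hcongr _ _ fun x hx => ?_
      rw [hTf, hval x hx]
    · rw [norm_toLp_sq, intervalIntegral.integral_of_le h2π.le]
      refine integral_congr_ae (ae_restrict_of_ae (hb.ae_pos.mono fun x hx => ?_))
      simp only [mul_pow, Real.sq_sqrt hx.le]
  obtain ⟨C, hC, f, hf0, hfC, hmax⟩ := exists_rayleigh_maximizer (T.comp X.subtypeL) S hS
    (fun x hx => hTS _ hx) β hβ (fun c u => periodVariance_smul a _ c)
    (fun u v => periodVariance_parallelogram ha (hucont u) (hucont v)) (by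
      -- Any nonconstant periodic function shows that the supremum is positive.
      have hsin : IsPrimitive Real.sin Real.cos :=
        .of_hasDerivAt Real.hasDerivAt_sin Real.continuous_cos
      obtain ⟨f, hf, hβf, -⟩ := hlift _ _ hsin Real.continuous_cos.memL2Loc Real.sin_periodic
      refine ⟨⟨f, hf⟩, ?_⟩
      change 0 < β (T f)
      rw [hβf]
      have hπ := Real.pi_pos
      refine periodVariance_pos ha Real.continuous_sin (s := Real.pi / 2) (t := Real.pi)
        ⟨by linarith, by linarith⟩ ⟨by linarith, by linarith⟩ (by simp))
  refine ⟨C, hC, fun w v h => ?_, ?_⟩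
  · obtain ⟨f, hf, hβf, hnorm⟩ := hlift w v h.isPrimitive h.memL2Loc h.periodic
    have := hmax ⟨f, hf⟩
    change β (T f) ≤ C * ‖f‖ ^ 2 at this
    rwa [hβf, hnorm, periodVariance_of_integral_eq_zero h.constraint] at this
  · obtain ⟨f, hf⟩ := f
    change β (T f) = C * ‖f‖ ^ 2 at hfC
    have hfne : f ≠ 0 := fun h => hf0 (Subtype.ext h)
    rw [norm_sq_eq_integral] at hfC
    -- The substitution is undone: the maximizer is divided by `√b` and extended periodically.
    obtain ⟨v, hv⟩ : ∃ v : ℝ → ℝ, v = fun x => (√(b x))⁻¹ * f (angle x) := ⟨_, rfl⟩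
    have hang : ∀ᵐ x : ℝ, x ∈ Set.Ioc 0 (2 * Real.pi) → angle x = x := by
      have : ∀ᵐ x : ℝ, x ≠ 2 * Real.pi := by simp [ae_iff]
      filter_upwards [this] with x hx hx'
      exact angle_eq_self hx'.1.le (lt_of_le_of_ne hx'.2 hx)
    have hvper : AEPeriodic v := by
      rw [hv]
      filter_upwards [hb.periodic] with x hx
      rw [hx, angle_add_two_pi]
    have hvm : AEStronglyMeasurable v volume := by
      rw [hv]
      exact hc.aestronglyMeasurable.mul
        ((Lp.stronglyMeasurable f).comp_measurable measurable_angle).aestronglyMeasurable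
    have hbv : ∀ᵐ x : ℝ, x ∈ Set.Ioc 0 (2 * Real.pi) → b x * v x ^ 2 = f x ^ 2 := by
      filter_upwards [hang, hb.ae_pos] with x hx hx' hmem
      rw [hv]
      simp only [hx hmem, mul_pow, inv_pow, Real.sq_sqrt hx'.le]
      field_simp
    have hfsq : IntervalIntegrable (fun x => f x ^ 2) volume 0 (2 * Real.pi) :=
      (intervalIntegrable_iff_integrableOn_Ioc_of_le h2π.le).2 (Lp.memLp f).integrable_sq
    have hbvi : LocallyIntegrable (fun x => b x * v x ^ 2) volume := by
      refine (hb.periodic.comp₂ hvper fun s t => s * t ^ 2).locallyIntegrable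
        (hfsq.congr_ae ?_)
      rw [Set.uIoc_of_le h2π.le]
      exact (ae_restrict_iff' measurableSet_Ioc).2 (hbv.mono fun x hx hm => (hx hm).symm)
    have hvL2 : MemL2Loc v := by
      refine memL2Loc_of_locallyIntegrable_sq hvm ((hb.inv.locallyIntegrable_mul hbvi).congr ?_)
      filter_upwards [hb.ae_pos] with x hx
      field_simp
    have hP := IsPrimitive.of_locallyIntegrable hvL2.locallyIntegrable 0 0
    set P : ℝ → ℝ := fun y => 0 + ∫ t in (0 : ℝ)..y, v t with hPdef
    have hTP : ∀ t : Set.Icc (0 : ℝ) (2 * Real.pi), T f t = P t := by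
      intro t
      rw [hT, hPdef]
      simp only [zero_add]
      refine intervalIntegral.integral_congr_ae ?_
      filter_upwards [hang] with x hx hxt
      rw [Set.uIoc_of_le t.2.1] at hxt
      rw [hv]
      simp only [hx ⟨hxt.1, hxt.2.trans t.2.2⟩]
    have hPper : Function.Periodic P (2 * Real.pi) := by
      refine hP.periodic hvper ?_
      have h1 := (hXmem f).1 hf
      rw [hTP, hPdef] at h1
      simpa using h1
    set m := (∫ x in (0 : ℝ)..2 * Real.pi, a x * P x) / ∫ x in (0 : ℝ)..2 * Real.pi, a x with hm
    have hmean := integral_mul_sub_mean ha hP.continuous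
    rw [← hm] at hmean
    have hβP : β (T f) = periodVariance a P :=
      hcongr _ _ fun x hx => by rw [hTP, hval x hx]
    have hnorm : ∫ x, f x ^ 2 ∂μ = ∫ θ in (0 : ℝ)..2 * Real.pi, b θ * v θ ^ 2 := by
      rw [intervalIntegral.integral_of_le h2π.le]
      exact integral_congr_ae ((ae_restrict_iff' measurableSet_Ioc).2
        (hbv.mono fun x hx hm => (hx hm).symm))
    have heq : ∫ θ in (0 : ℝ)..2 * Real.pi, a θ * (P θ - m) ^ 2 =
        C * ∫ θ in (0 : ℝ)..2 * Real.pi, b θ * v θ ^ 2 := by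
      rw [← periodVariance_of_integral_eq_zero hmean, periodVariance_sub_const ha hP.continuous,
        ← hβP, hfC, hnorm]
    have hw := hP.add_const (-m)
    refine ⟨fun x => P x - m, v, ⟨by simpa [sub_eq_add_neg] using hw, hvL2, fun x => ?_, hmean⟩,
      ?_, heq⟩
    · rw [hPper x]
    -- If `w` vanished, equality together with `C > 0` would give `‖f‖ = 0`.
    · by_contra hzero
      push Not at hzero
      have h1 : ∫ θ in (0 : ℝ)..2 * Real.pi, a θ * (P θ - m) ^ 2 = 0 := by
        rw [intervalIntegral.integral_congr (g := fun _ => 0) fun x _ => by simp [hzero x]]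
        simp
      rw [h1, ← hnorm, ← norm_sq_eq_integral] at heq
      have := mul_pos hC (pow_pos (norm_pos_iff.2 hfne) 2)
      linarith

/-! ### Monotone periodic functions and the first-order system -/

theorem Function.Periodic.eq_of_monotone {f : ℝ → ℝ} (hf : Function.Periodic f (2 * Real.pi))
    (hm : Monotone f) (x y : ℝ) : f x = f y := by
  have key : ∀ x y, f x ≤ f y := by
    intro x y
    obtain ⟨n, hn⟩ := exists_nat_ge ((x - y) / (2 * Real.pi))
    rw [div_le_iff₀ Real.two_pi_pos] at hn
    rw [← hf.nat_mul n y]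
    exact hm (by linarith)
  exact le_antisymm (key x y) (key y x)

/-- The primitive of `g` is both monotone and periodic, hence constant. -/
theorem AEPeriodic.ae_eq_zero {g : ℝ → ℝ} (hg : AEPeriodic g) (hnn : ∀ᵐ x, 0 ≤ g x)
    (hi : LocallyIntegrable g volume) (h0 : ∫ x in (0 : ℝ)..2 * Real.pi, g x = 0) :
    ∀ᵐ x, g x = 0 := by
  have hP := IsPrimitive.of_locallyIntegrable hi 0 0
  have hconst := (hP.periodic hg h0).eq_of_monotone (hP.monotone hnn)
  have hZ : IsPrimitive (fun y => 0 + ∫ t in (0 : ℝ)..y, g t) fun _ => 0 :=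
    ⟨locallyIntegrable_const 0, fun x y => by rw [hconst y x]; simp⟩
  exact hP.ae_unique hZ

theorem ae_eq_zero_of_integral_weight_sq {a w : ℝ → ℝ} (ha : IsWeight a) (hw : MemL2Loc w)
    (hp : AEPeriodic w) (h0 : ∫ x in (0 : ℝ)..2 * Real.pi, a x * w x ^ 2 = 0) :
    ∀ᵐ x, w x = 0 := by
  have h := (ha.periodic.comp₂ hp fun s t => s * t ^ 2).ae_eq_zero
    (ha.ae_pos.mono fun x hx => by positivity)
    (ha.locallyIntegrable_mul hw.locallyIntegrable_sq) h0
  filter_upwards [h, ha.ae_pos] with x hx hx'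
  simpa [hx'.ne'] using hx

theorem Continuous.eq_zero_of_ae {w : ℝ → ℝ} (hw : Continuous w) (h : ∀ᵐ x, w x = 0) (x : ℝ) :
    w x = 0 :=
  congrFun (Continuous.ae_eq_iff_eq (μ := volume) hw (g := fun _ => 0) continuous_const |>.1 h) x

/-- Solutions of the first-order system `w' = U / b`, `U' = -lam a w`. -/
structure IsSol (a b : ℝ → ℝ) (lam : ℝ) (w U : ℝ → ℝ) : Prop where
  left : IsPrimitive w fun θ => (b θ)⁻¹ * U θ
  right : IsPrimitive U fun θ => -lam * (a θ * w θ)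

/-- `2π`-periodic solutions. -/
structure IsPeriodicSol (a b : ℝ → ℝ) (lam : ℝ) (w U : ℝ → ℝ) : Prop extends
    IsSol a b lam w U where
  periodic_left : Function.Periodic w (2 * Real.pi)
  periodic_right : Function.Periodic U (2 * Real.pi)

namespace IsSol

variable {a b w U w₁ U₁ : ℝ → ℝ} {lam : ℝ}

theorem sub_const_mul (h : IsSol a b lam w U) (h₁ : IsSol a b lam w₁ U₁) (c : ℝ) :
    IsSol a b lam (fun x => w x - c * w₁ x) (fun x => U x - c * U₁ x) :=
  ⟨(h.left.sub (h₁.left.const_mul c)).congr_ae (Filter.Eventually.of_forall fun x => by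
      simp only; ring),
    (h.right.sub (h₁.right.const_mul c)).congr_ae (Filter.Eventually.of_forall fun x => by
      simp only; ring)⟩

/-- Uniqueness for the initial value problem. -/
theorem eq_zero (ha : IsWeight a) (hb : IsWeight b) (h : IsSol a b lam w U) {x₀ : ℝ}
    (hw : w x₀ = 0) (hU : U x₀ = 0) (x : ℝ) : w x = 0 ∧ U x = 0 := by
  obtain ⟨Ka, hKa⟩ := ha.exists_abs_le
  obtain ⟨Kb, hKb⟩ := hb.inv.exists_abs_le
  -- The energy `w² + U²` has derivative bounded by a multiple of itself, so Grönwall applies.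
  have hE := (h.left.mul h.left).add (h.right.mul h.right)
  have h0 := hE.eq_zero_of_abs_le (K := Kb + |lam| * Ka) (x₀ := x₀)
    (fun x => add_nonneg (mul_self_nonneg _) (mul_self_nonneg _)) ?_
    (by simp [hw, hU]) x
  · constructor <;> nlinarith [mul_self_nonneg (w x), mul_self_nonneg (U x)]
  · filter_upwards [hKa, hKb] with x h1 h2
    have e : (b x)⁻¹ * U x * w x + w x * ((b x)⁻¹ * U x) +
        (-lam * (a x * w x) * U x + U x * (-lam * (a x * w x))) =
        ((b x)⁻¹ - lam * a x) * (2 * (w x * U x)) := by ring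
    rw [e, abs_mul]
    have h3 : |(b x)⁻¹ - lam * a x| ≤ Kb + |lam| * Ka := by
      refine (abs_sub _ _).trans (add_le_add h2 ?_)
      rw [abs_mul]
      exact mul_le_mul_of_nonneg_left h1 (abs_nonneg _)
    have h4 : |2 * (w x * U x)| ≤ w x * w x + U x * U x :=
      abs_le.2 ⟨by nlinarith [sq_nonneg (w x + U x)], by nlinarith [sq_nonneg (w x - U x)]⟩
    exact mul_le_mul h3 h4 (abs_nonneg _) ((abs_nonneg _).trans h3)

end IsSol

/-- The constraint comes for free: integrating `U' = -lam a w` over a period gives zero, and `lam ≠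
0`. -/
theorem IsPeriodicSol.admissiblePair {a b w U : ℝ → ℝ} {lam : ℝ} (hb : IsWeight b)
    (hlam : lam ≠ 0) (h : IsPeriodicSol a b lam w U) :
    AdmissiblePair a w fun θ => (b θ)⁻¹ * U θ := by
  refine ⟨h.left, hb.inv.memL2Loc_mul h.right.continuous.memL2Loc, h.periodic_left, ?_⟩
  have h1 := integral_eq_zero_of_periodic h.right h.periodic_right
  rw [intervalIntegral.integral_const_mul] at h1
  simpa [hlam] using h1

/-- Integration of `(wU)'` over a period. A periodic solution thus has Rayleigh quotient exactly `1
/ lam`. -/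
theorem IsPeriodicSol.energy {a b w U : ℝ → ℝ} {lam : ℝ} (hb : IsWeight b)
    (h : IsPeriodicSol a b lam w U) :
    ∫ θ in (0 : ℝ)..2 * Real.pi, b θ * ((b θ)⁻¹ * U θ) ^ 2 =
      lam * ∫ θ in (0 : ℝ)..2 * Real.pi, a θ * w θ ^ 2 := by
  have h1 := integral_eq_zero_of_periodic (h.left.mul h.right) fun x => by
    simp only [h.periodic_left x, h.periodic_right x]
  have i1 : IntervalIntegrable (fun θ => (b θ)⁻¹ * U θ * U θ) volume 0 (2 * Real.pi) :=
    (h.left.intervalIntegrable _ _).mul_continuousOn h.right.continuous.continuousOn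
  have i2 := (h.right.intervalIntegrable 0 (2 * Real.pi)).continuousOn_mul
    h.left.continuous.continuousOn
  rw [intervalIntegral.integral_add i1 i2] at h1
  have e1 : ∫ θ in (0 : ℝ)..2 * Real.pi, b θ * ((b θ)⁻¹ * U θ) ^ 2 =
      ∫ θ in (0 : ℝ)..2 * Real.pi, (b θ)⁻¹ * U θ * U θ := by
    refine intervalIntegral.integral_congr_ae (hb.ae_pos.mono fun x hx _ => ?_)
    field_simp
  have e2 : ∫ θ in (0 : ℝ)..2 * Real.pi, w θ * (-lam * (a θ * w θ)) =
      -(lam * ∫ θ in (0 : ℝ)..2 * Real.pi, a θ * w θ ^ 2) := by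
    rw [← intervalIntegral.integral_const_mul, ← intervalIntegral.integral_neg]
    congr 1; ext x; ring
  rw [e1]
  linarith

/-! ### Euler–Lagrange equation and the best constant -/

/-- The Euler–Lagrange equation. -/
theorem exists_isPeriodicSol_of_extremal {a b w v : ℝ → ℝ} {C : ℝ} (ha : IsWeight a)
    (hb : IsWeight b) (hC : 0 < C)
    (hmax : ∀ w v, AdmissiblePair a w v → ∫ θ in (0 : ℝ)..2 * Real.pi, a θ * w θ ^ 2 ≤
        C * ∫ θ in (0 : ℝ)..2 * Real.pi, b θ * v θ ^ 2)
    (h : AdmissiblePair a w v)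
    (heq : ∫ θ in (0 : ℝ)..2 * Real.pi, a θ * w θ ^ 2 =
        C * ∫ θ in (0 : ℝ)..2 * Real.pi, b θ * v θ ^ 2) :
    ∃ U, IsPeriodicSol a b C⁻¹ w U := by
  have hwc := h.isPrimitive.continuous
  have hA := IsPrimitive.of_locallyIntegrable (ha.locallyIntegrable_mul hwc.locallyIntegrable) 0 0
  set A : ℝ → ℝ := fun y => 0 + ∫ t in (0 : ℝ)..y, a t * w t
  have hAper : Function.Periodic A (2 * Real.pi) :=
    hA.periodic (ha.periodic.comp₂ h.periodic.aePeriodic fun s t => s * t) h.constraint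
  have hbv : MemL2Loc fun x => C * (b x * v x) := by
    have := (hb.memL2Loc_mul h.memL2Loc).bdd_mul_of_ae (c := fun _ => C) (K := |C|)
      aestronglyMeasurable_const (by simp)
    exact this
  -- The equation to prove says that `C b w' + A` is constant, `A` being a primitive of `a w`. So
  -- `ζ` is its deviation from the mean, and a single test function suffices: the primitive `η` of
  -- `ζ`, shifted to be admissible.
  obtain ⟨μ, hμ⟩ : ∃ μ, μ = (∫ x in (0 : ℝ)..2 * Real.pi, (C * (b x * v x) + A x)) /
    (2 * Real.pi) := ⟨_, rfl⟩
  obtain ⟨ζ, hζ⟩ : ∃ ζ : ℝ → ℝ, ζ = fun x => C * (b x * v x) + A x - μ := ⟨_, rfl⟩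
  have hζ2 : MemL2Loc ζ := by
    rw [hζ]
    have h1 : Continuous fun x => A x - μ := hA.continuous.sub continuous_const
    intro k hk
    have := (hbv k hk).add (h1.memL2Loc k hk)
    refine (memLp_congr_ae (Filter.Eventually.of_forall fun x => ?_)).1 this
    simp only [Pi.add_apply]; ring
  have hζp : AEPeriodic ζ := by
    rw [hζ]
    filter_upwards [hb.periodic, h.aePeriodic_deriv] with x h1 h2
    rw [h1, h2, hAper x]
  have i0 : IntervalIntegrable (fun x => C * (b x * v x) + A x) volume 0 (2 * Real.pi) :=
    (hbv.locallyIntegrable.intervalIntegrable_real _ _).add (hA.continuous.intervalIntegrable _ _)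
  have hζ0 : ∫ x in (0 : ℝ)..2 * Real.pi, ζ x = 0 := by
    rw [hζ, intervalIntegral.integral_sub i0 (by simp), intervalIntegral.integral_const, hμ]
    have := Real.pi_pos
    simp only [smul_eq_mul]
    field_simp
    ring
  have hη0 := IsPrimitive.of_locallyIntegrable hζ2.locallyIntegrable 0 0
  set η₀ : ℝ → ℝ := fun y => 0 + ∫ t in (0 : ℝ)..y, ζ t
  obtain ⟨m, hm⟩ : ∃ m, m = (∫ x in (0 : ℝ)..2 * Real.pi, a x * η₀ x) /
    ∫ x in (0 : ℝ)..2 * Real.pi, a x := ⟨_, rfl⟩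
  obtain ⟨η, hηdef⟩ : ∃ η : ℝ → ℝ, η = fun x => η₀ x + -m := ⟨_, rfl⟩
  have hη : IsPrimitive η ζ := hηdef ▸ hη0.add_const (-m)
  have hηc := hη.continuous
  have hηper : Function.Periodic η (2 * Real.pi) := hη.periodic hζp hζ0
  have hηa : ∫ x in (0 : ℝ)..2 * Real.pi, a x * η x = 0 := by
    have := integral_mul_sub_mean ha hη0.continuous
    rw [← hm] at this
    rw [hηdef]
    simpa only [sub_eq_add_neg] using this
  -- the first variation
  have i1 := ha.intervalIntegrable_mul (f := fun x => w x ^ 2) (by fun_prop) 0 (2 * Real.pi)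
  have i2 := ha.intervalIntegrable_mul (f := fun x => w x * η x) (by fun_prop) 0 (2 * Real.pi)
  have i3 := ha.intervalIntegrable_mul (f := fun x => η x ^ 2) (by fun_prop) 0 (2 * Real.pi)
  have j1 := (hb.locallyIntegrable_mul h.memL2Loc.locallyIntegrable_sq).intervalIntegrable_real
    0 (2 * Real.pi)
  have j2 := (hb.locallyIntegrable_mul
    (h.memL2Loc.locallyIntegrable_mul hζ2)).intervalIntegrable_real 0 (2 * Real.pi)
  have j3 := (hb.locallyIntegrable_mul hζ2.locallyIntegrable_sq).intervalIntegrable_real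
    0 (2 * Real.pi)
  have hvar : ∫ θ in (0 : ℝ)..2 * Real.pi, a θ * (w θ * η θ) =
      C * ∫ θ in (0 : ℝ)..2 * Real.pi, b θ * (v θ * ζ θ) := by
    set α₁ := ∫ θ in (0 : ℝ)..2 * Real.pi, a θ * w θ ^ 2
    set α₂ := ∫ θ in (0 : ℝ)..2 * Real.pi, a θ * (w θ * η θ)
    set α₃ := ∫ θ in (0 : ℝ)..2 * Real.pi, a θ * η θ ^ 2
    set β₁ := ∫ θ in (0 : ℝ)..2 * Real.pi, b θ * v θ ^ 2
    set β₂ := ∫ θ in (0 : ℝ)..2 * Real.pi, b θ * (v θ * ζ θ)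
    set β₃ := ∫ θ in (0 : ℝ)..2 * Real.pi, b θ * ζ θ ^ 2
    -- The inequality for `w + t η` is a nonnegative quadratic in `t` without constant term, because
    -- `w` attains equality; its linear coefficient must vanish.
    have hq : ∀ t : ℝ, 0 ≤ (C * β₃ - α₃) * (t * t) + (2 * (C * β₂ - α₂)) * t + 0 := by
      intro t
      have hadm : AdmissiblePair a (fun x => w x + t * η x) (fun x => v x + t * ζ x) := by
        refine ⟨h.isPrimitive.add (hη.const_mul t), fun k hk => ?_, fun x => ?_, ?_⟩
        · exact (h.memL2Loc k hk).add ((hζ2 k hk).const_mul t)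
        · simp only [h.periodic x, hηper x]
        · have e : ∀ x, a x * (w x + t * η x) = a x * w x + t * (a x * η x) := fun x => by ring
          simp only [e]
          rw [intervalIntegral.integral_add (ha.intervalIntegrable_mul hwc _ _)
            ((ha.intervalIntegrable_mul hηc _ _).const_mul t), h.constraint,
            intervalIntegral.integral_const_mul, hηa]
          simp
      have h1 := hmax _ _ hadm
      have e1 : ∫ θ in (0 : ℝ)..2 * Real.pi, a θ * (w θ + t * η θ) ^ 2 =
          α₁ + 2 * t * α₂ + t ^ 2 * α₃ := by
        rw [← intervalIntegral.integral_const_mul, ← intervalIntegral.integral_const_mul,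
          ← intervalIntegral.integral_add i1 (i2.const_mul _),
          ← intervalIntegral.integral_add (i1.add (i2.const_mul _)) (i3.const_mul _)]
        congr 1; ext x; ring
      have e2 : ∫ θ in (0 : ℝ)..2 * Real.pi, b θ * (v θ + t * ζ θ) ^ 2 =
          β₁ + 2 * t * β₂ + t ^ 2 * β₃ := by
        rw [← intervalIntegral.integral_const_mul, ← intervalIntegral.integral_const_mul,
          ← intervalIntegral.integral_add j1 (j2.const_mul _),
          ← intervalIntegral.integral_add (j1.add (j2.const_mul _)) (j3.const_mul _)]
        congr 1; ext x; ring
      rw [e1, e2] at h1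
      nlinarith
    have hdisc := discrim_le_zero hq
    rw [discrim] at hdisc
    have : (C * β₂ - α₂) ^ 2 = 0 := le_antisymm (by nlinarith) (sq_nonneg _)
    have := pow_eq_zero_iff (two_ne_zero) |>.1 this
    linarith
  have hparts := integral_eq_zero_of_periodic (hA.mul hη) fun x => by
    simp only [hAper x, hηper x]
  have k1 : IntervalIntegrable (fun x => a x * w x * η x) volume 0 (2 * Real.pi) :=
    i2.congr (fun x _ => by ring)
  have k2 : IntervalIntegrable (fun x => A x * ζ x) volume 0 (2 * Real.pi) :=
    (hη.intervalIntegrable _ _).continuousOn_mul hA.continuous.continuousOn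
  rw [intervalIntegral.integral_add k1 k2] at hparts
  -- Integrating by parts gives `∫ a w η = -∫ A ζ`, so `ζ` is orthogonal to `C b w' + A`; it is also
  -- orthogonal to constants, hence to itself.
  have hζsq : ∫ x in (0 : ℝ)..2 * Real.pi, 1 * ζ x ^ 2 = 0 := by
    have e1 : ∫ x in (0 : ℝ)..2 * Real.pi, 1 * ζ x ^ 2 =
        C * (∫ θ in (0 : ℝ)..2 * Real.pi, b θ * (v θ * ζ θ)) +
        (∫ θ in (0 : ℝ)..2 * Real.pi, A θ * ζ θ) - μ * ∫ x in (0 : ℝ)..2 * Real.pi, ζ x := by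
      rw [← intervalIntegral.integral_const_mul, ← intervalIntegral.integral_const_mul,
        ← intervalIntegral.integral_add (j2.const_mul _) k2,
        ← intervalIntegral.integral_sub ((j2.const_mul _).add k2)
          ((hη.intervalIntegrable _ _).const_mul _)]
      congr 1; ext x
      have : ζ x = C * (b x * v x) + A x - μ := by rw [hζ]
      nth_rewrite 1 [pow_two, this]
      ring
    have e2 : ∫ x in (0 : ℝ)..2 * Real.pi, a x * w x * η x =
        ∫ θ in (0 : ℝ)..2 * Real.pi, a θ * (w θ * η θ) := by congr 1; ext x; ring
    rw [e1, hζ0, ← hvar, ← e2]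
    linarith
  have hone : IsWeight fun _ => (1 : ℝ) :=
    ⟨aestronglyMeasurable_const, Filter.Eventually.of_forall fun _ => rfl, 1, 1, one_pos, by simp⟩
  have hae := ae_eq_zero_of_integral_weight_sq hone hζ2 hζp hζsq
  refine ⟨fun x => C⁻¹ * (μ - A x), ⟨?_, ?_⟩, h.periodic, fun x => by simp only [hAper x]⟩
  · refine h.isPrimitive.congr_ae ?_
    filter_upwards [hae, hb.ae_pos] with x h1 h2
    rw [hζ] at h1
    simp only at h1
    rw [show μ - A x = C * (b x * v x) by linarith]
    field_simp
  · have hconst : IsPrimitive (fun _ => μ) fun _ => 0 :=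
      ⟨locallyIntegrable_const 0, fun x y => by simp⟩
    exact ((hconst.sub hA).const_mul C⁻¹).congr_ae
      (Filter.Eventually.of_forall fun x => by simp only; ring)

theorem wirtingerConstants_eq {a b : ℝ → ℝ} :
    wirtingerConstants a b = {C | ∀ w v, AdmissiblePair a w v →
      ∫ θ in (0 : ℝ)..2 * Real.pi, a θ * w θ ^ 2 ≤
        C * ∫ θ in (0 : ℝ)..2 * Real.pi, b θ * v θ ^ 2} := by
  ext C
  constructor
  · intro h w v hwv
    exact h w v (admissible_iff.2 ⟨w, Filter.EventuallyEq.rfl, hwv⟩)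
  · intro h w v hwv
    obtain ⟨W, hW, hWv⟩ := admissible_iff.1 hwv
    rw [intervalIntegral.integral_congr_ae (hW.mono fun x hx _ => by rw [hx])]
    exact h W v hWv

theorem AdmissiblePair.integral_sq_pos {a w v : ℝ → ℝ} (ha : IsWeight a)
    (h : AdmissiblePair a w v) {x : ℝ} (hx : w x ≠ 0) :
    0 < ∫ θ in (0 : ℝ)..2 * Real.pi, a θ * w θ ^ 2 := by
  refine lt_of_le_of_ne (intervalIntegral.integral_nonneg_of_ae Real.two_pi_pos.le
    (ha.ae_pos.mono fun x hx => by positivity)) fun h0 => hx ?_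
  exact h.isPrimitive.continuous.eq_zero_of_ae (ae_eq_zero_of_integral_weight_sq ha
    h.isPrimitive.continuous.memL2Loc h.periodic.aePeriodic h0.symm) x

theorem bestConst_spec {a b : ℝ → ℝ} (ha : IsWeight a) (hb : IsWeight b) :
    IsLeast (wirtingerConstants a b) (bestConst a b) ∧ 0 < bestConst a b ∧
      ∃ w U, IsPeriodicSol a b (bestConst a b)⁻¹ w U ∧ ∃ x, w x ≠ 0 := by
  obtain ⟨C, hC, hmax, w, v, hwv, ⟨x, hx⟩, heq⟩ := exists_extremal_pair ha hb
  have hleast : IsLeast (wirtingerConstants a b) C := by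
    rw [wirtingerConstants_eq]
    refine ⟨hmax, fun C' hC' => ?_⟩
    have h1 := hC' w v hwv
    have h2 := hwv.integral_sq_pos ha hx
    rw [heq] at h1 h2
    exact le_of_mul_le_mul_right h1 ((mul_pos_iff_of_pos_left hC).1 h2)
  have hbest : bestConst a b = C := hleast.csInf_eq
  rw [hbest]
  obtain ⟨U, hU⟩ := exists_isPeriodicSol_of_extremal ha hb hC hmax hwv heq
  exact ⟨hleast, hC, w, U, hU, x, hx⟩

/-- By the energy identity the solution is itself a test function with quotient `1 / lam`. This
yields the lower bounds for the best constant. -/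
theorem IsPeriodicSol.inv_le_bestConst {a b w U : ℝ → ℝ} {lam : ℝ} (ha : IsWeight a)
    (hb : IsWeight b) (hlam : 0 < lam) (h : IsPeriodicSol a b lam w U) {x : ℝ} (hx : w x ≠ 0) :
    lam⁻¹ ≤ bestConst a b := by
  have hadm := h.admissiblePair hb hlam.ne'
  have h1 := (bestConst_spec ha hb).1.1
  rw [wirtingerConstants_eq] at h1
  have h2 := h1 _ _ hadm
  rw [h.energy hb] at h2
  have h3 := hadm.integral_sq_pos ha hx
  rw [inv_le_iff_one_le_mul₀' hlam]
  by_contra hc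
  nlinarith [not_le.1 hc]

/-- Reduces the search for extremals to a linear periodic boundary value problem: Euler–Lagrange in
one direction, the energy identity in the other. -/
theorem isExtremal_iff {a b w : ℝ → ℝ} (ha : IsWeight a) (hb : IsWeight b) :
    IsExtremal a b w ↔ ∃ W U, w =ᵐ[volume] W ∧ IsPeriodicSol a b (bestConst a b)⁻¹ W U ∧
      ∃ x, W x ≠ 0 := by
  obtain ⟨hleast, hpos, -⟩ := bestConst_spec ha hb
  constructor
  · rintro ⟨hne, v, hadm, heq⟩
    obtain ⟨W, hW, hWv⟩ := admissible_iff.1 hadm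
    rw [intervalIntegral.integral_congr_ae (hW.mono fun x hx _ => by rw [hx])] at heq
    have hmax := hleast.1
    rw [wirtingerConstants_eq] at hmax
    obtain ⟨U, hU⟩ := exists_isPeriodicSol_of_extremal ha hb hpos hmax hWv heq
    refine ⟨W, U, hW, hU, ?_⟩
    by_contra hzero
    push Not at hzero
    exact hne (hW.mono fun x hx => by rw [hx, hzero])
  · rintro ⟨W, U, hW, hU, x, hx⟩
    refine ⟨fun h0 => hx ?_, _, admissible_iff.2 ⟨W, hW, hU.admissiblePair hb (by positivity)⟩, ?_⟩
    · exact hU.left.continuous.eq_zero_of_ae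
        (by filter_upwards [h0, hW] with y h1 h2; rw [← h2, h1]) x
    · rw [intervalIntegral.integral_congr_ae (hW.mono fun x hx _ => by rw [hx]),
        hU.energy hb, mul_inv_cancel_left₀ hpos.ne']

/-! ### Prüfer coordinates -/

theorem exists_polar (x y : ℝ) : ∃ φ, x = √(x ^ 2 + y ^ 2) * Real.cos φ ∧
    y = √(x ^ 2 + y ^ 2) * Real.sin φ := by
  refine ⟨Complex.arg ⟨x, y⟩, ?_, ?_⟩
  · have := Complex.norm_mul_cos_arg ⟨x, y⟩
    rw [Complex.norm_eq_sqrt_sq_add_sq] at this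
    exact this.symm
  · have := Complex.norm_mul_sin_arg ⟨x, y⟩
    rw [Complex.norm_eq_sqrt_sq_add_sq] at this
    exact this.symm

theorem Continuous.pos_of_ne_zero {f : ℝ → ℝ} (hf : Continuous f) (hne : ∀ x, f x ≠ 0) {x₀ : ℝ}
    (h0 : 0 < f x₀) (x : ℝ) : 0 < f x := by
  by_contra hc
  obtain ⟨y, hy⟩ := mem_range_of_exists_le_of_exists_ge hf ⟨x, not_lt.1 hc⟩ ⟨x₀, h0.le⟩
  exact hne y hy

/-- Prüfer coordinates. -/
theorem IsSol.exists_pruefer {a b w U : ℝ → ℝ} {lam κ x₁ : ℝ} (ha : IsWeight a)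
    (hb : IsWeight b) (h : IsSol a b lam w U) (hκ : 0 < κ) (hx₁ : w x₁ ≠ 0) :
    ∃ φ r : ℝ → ℝ, IsPrimitive φ (fun θ => κ * (b θ)⁻¹ * Real.cos (φ θ) ^ 2 +
        lam * a θ / κ * Real.sin (φ θ) ^ 2) ∧ (∀ θ, 0 < r θ) ∧
      (∀ θ, U θ = r θ * Real.cos (φ θ)) ∧ ∀ θ, κ * w θ = r θ * Real.sin (φ θ) := by
  have hwc := h.left.continuous
  have hUc := h.right.continuous
  obtain ⟨N, hN⟩ : ∃ N : ℝ → ℝ, N = fun θ => U θ ^ 2 + (κ * w θ) ^ 2 := ⟨_, rfl⟩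
  have hNθ : ∀ θ, N θ = U θ ^ 2 + (κ * w θ) ^ 2 := fun θ => by rw [hN]
  have hNc : Continuous N := by rw [hN]; fun_prop
  have hNpos : ∀ θ, 0 < N θ := by
    intro θ
    rw [hNθ]
    by_contra hc
    have h1 : U θ = 0 := by nlinarith [sq_nonneg (U θ), sq_nonneg (κ * w θ)]
    have h2 : κ * w θ = 0 := by nlinarith [sq_nonneg (U θ), sq_nonneg (κ * w θ)]
    have h3 : w θ = 0 := by simpa [hκ.ne'] using h2
    exact hx₁ (h.eq_zero ha hb h3 h1 x₁).1
  have hNne : ∀ θ, N θ ≠ 0 := fun θ => (hNpos θ).ne'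
  obtain ⟨φ₀, hφ₀U, hφ₀w⟩ := exists_polar (U 0) (κ * w 0)
  rw [← hNθ] at hφ₀U hφ₀w
  -- This is the derivative that the angle of `(U, κ w)` must have, so the angle is defined as an
  -- integral and no branch of the argument has to be chosen beyond the initial value `φ₀`.
  obtain ⟨g, hg⟩ : ∃ g : ℝ → ℝ, g = fun θ => (b θ)⁻¹ * (κ * U θ ^ 2 / N θ) +
    a θ * (lam * κ * w θ ^ 2 / N θ) := ⟨_, rfl⟩
  have hgi : LocallyIntegrable g volume := by
    rw [hg]
    refine (hb.inv.locallyIntegrable_mul (Continuous.locallyIntegrable ?_)).add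
      (ha.locallyIntegrable_mul (Continuous.locallyIntegrable ?_))
    · exact Continuous.div (by fun_prop) hNc hNne
    · exact Continuous.div (by fun_prop) hNc hNne
  have hφ := IsPrimitive.of_locallyIntegrable hgi φ₀ 0
  obtain ⟨φ, hφdef⟩ : ∃ φ : ℝ → ℝ, φ = fun y => φ₀ + ∫ t in (0 : ℝ)..y, g t := ⟨_, rfl⟩
  rw [← hφdef] at hφ
  have hφ0 : φ 0 = φ₀ := by rw [hφdef]; simp
  have hφc := hφ.continuous
  have hcos := hφ.comp Real.hasDerivAt_cos (by fun_prop)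
  have hsin := hφ.comp Real.hasDerivAt_sin Real.continuous_cos
  have hRp := ((h.left.const_mul κ).mul hcos).sub (h.right.mul hsin)
  obtain ⟨R, hR⟩ : ∃ R : ℝ → ℝ, R = fun θ => κ * w θ * Real.cos (φ θ) - U θ * Real.sin (φ θ) :=
    ⟨_, rfl⟩
  have hRθ : ∀ θ, R θ = κ * w θ * Real.cos (φ θ) - U θ * Real.sin (φ θ) := fun θ => by rw [hR]
  rw [← hR] at hRp
  obtain ⟨P, hP⟩ : ∃ P : ℝ → ℝ, P = fun θ => U θ * Real.cos (φ θ) + κ * w θ * Real.sin (φ θ) :=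
    ⟨_, rfl⟩
  have hPθ : ∀ θ, P θ = U θ * Real.cos (φ θ) + κ * w θ * Real.sin (φ θ) := fun θ => by rw [hP]
  obtain ⟨Ka, hKa⟩ := ha.exists_abs_le
  obtain ⟨Kb, hKb⟩ := hb.inv.exists_abs_le
  have hR0 : R 0 = 0 := by
    rw [hRθ, hφ0]
    linear_combination Real.cos φ₀ * hφ₀w - Real.sin φ₀ * hφ₀U
  -- `R` measures the failure of `(U, κ w)` to point in the direction `φ`. Its derivative is a
  -- bounded multiple of `R`, and `R 0 = 0`, so Grönwall gives `R = 0`.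
  have hRzero : ∀ θ, R θ = 0 := by
    intro θ
    have hsq := (hRp.mul hRp).eq_zero_of_abs_le (x₀ := 0)
      (K := 2 * ((|lam| * Ka + κ ^ 2 * Kb) / κ)) (fun x => mul_self_nonneg _) ?_ (by simp [hR0]) θ
    · exact mul_self_eq_zero.1 hsq
    filter_upwards [hKa, hKb] with x h1 h2
    have hd : κ * ((b x)⁻¹ * U x) * Real.cos (φ x) + κ * w x * (-Real.sin (φ x) * g x) -
        (-lam * (a x * w x) * Real.sin (φ x) + U x * (Real.cos (φ x) * g x)) =
        U x * (κ * w x) / N x * ((κ ^ 2 * (b x)⁻¹ - lam * a x) / κ) * R x := by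
      rw [hRθ, hg]
      have := hNne x
      field_simp
      rw [hNθ]
      ring
    rw [hd]
    have e : ∀ s t : ℝ, s * t * t + t * (s * t) = 2 * s * (t * t) := fun s t => by ring
    rw [e, abs_mul, abs_mul, abs_mul_self, abs_mul, abs_two]
    refine mul_le_mul_of_nonneg_right ?_ (mul_self_nonneg _)
    refine mul_le_mul_of_nonneg_left ?_ two_pos.le
    have h3 : |U x * (κ * w x) / N x| ≤ 1 := by
      rw [abs_div, abs_of_pos (hNpos x), div_le_one (hNpos x), hNθ, abs_le]
      constructor <;> nlinarith [sq_nonneg (U x + κ * w x), sq_nonneg (U x - κ * w x)]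
    have h4 : |(κ ^ 2 * (b x)⁻¹ - lam * a x) / κ| ≤ (|lam| * Ka + κ ^ 2 * Kb) / κ := by
      rw [abs_div, abs_of_pos hκ]
      refine div_le_div_of_nonneg_right ?_ hκ.le
      refine (abs_sub _ _).trans ?_
      rw [abs_mul, abs_mul, abs_of_pos (pow_pos hκ 2), add_comm]
      exact add_le_add (mul_le_mul_of_nonneg_left h1 (abs_nonneg _))
        (mul_le_mul_of_nonneg_left h2 (by positivity))
    calc |U x * (κ * w x) / N x| * |(κ ^ 2 * (b x)⁻¹ - lam * a x) / κ| ≤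
        1 * ((|lam| * Ka + κ ^ 2 * Kb) / κ) := mul_le_mul h3 h4 (abs_nonneg _) one_pos.le
      _ = _ := one_mul _
  have hcs : ∀ θ, Real.cos (φ θ) ^ 2 + Real.sin (φ θ) ^ 2 = 1 := fun θ => by
    rw [add_comm]; exact Real.sin_sq_add_cos_sq _
  have hUP : ∀ θ, U θ = P θ * Real.cos (φ θ) := fun θ => by
    have h1 := hRzero θ
    rw [hRθ] at h1
    rw [hPθ]
    linear_combination (-(U θ)) * hcs θ - Real.sin (φ θ) * h1
  have hwP : ∀ θ, κ * w θ = P θ * Real.sin (φ θ) := fun θ => by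
    have h1 := hRzero θ
    rw [hRθ] at h1
    rw [hPθ]
    linear_combination (-(κ * w θ)) * hcs θ + Real.cos (φ θ) * h1
  have hPN : ∀ θ, N θ = P θ ^ 2 := fun θ => by
    rw [hNθ, hUP θ, hwP θ]
    linear_combination P θ ^ 2 * hcs θ
  have hPc : Continuous P := by rw [hP]; fun_prop
  have hP0 : 0 < P 0 := by
    rw [hPθ, hφ0]
    have h1 := Real.sqrt_pos.2 (hNpos 0)
    have h2 : U 0 * Real.cos φ₀ + κ * w 0 * Real.sin φ₀ = √(N 0) := by
      have h3 := hcs 0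
      rw [hφ0] at h3
      linear_combination Real.cos φ₀ * hφ₀U + Real.sin φ₀ * hφ₀w + √(N 0) * h3
    rwa [h2]
  -- The radial coordinate satisfies `P² = N > 0`, so it keeps the positive sign it has at `0`.
  have hPpos := hPc.pos_of_ne_zero (fun θ h0 => hNne θ (by rw [hPN, h0]; ring)) hP0
  refine ⟨φ, P, hφ.congr_ae (Filter.Eventually.of_forall fun θ => ?_), hPpos, hUP, hwP⟩
  have h1 := hPpos θ
  have h2 : w θ = P θ * Real.sin (φ θ) / κ := by rw [← hwP]; field_simp
  rw [hg]
  simp only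
  rw [hPN, h2]
  nth_rewrite 1 [hUP θ]
  field_simp

/-! ### Maximal Prüfer speed and the time of a turn -/

/-- The normalized speed of the Prüfer angle at the value `β` of the weight. -/
noncomputable def prueferSpeed (ℓ β φ : ℝ) : ℝ :=
  ℓ / β * Real.cos φ ^ 2 + β / ℓ * Real.sin φ ^ 2

/-- The maximal normalized speed of the Prüfer angle. -/
noncomputable def prueferMax (ℓ φ : ℝ) : ℝ :=
  max (prueferSpeed ℓ 1 φ) (prueferSpeed ℓ (ℓ ^ 2) φ)

section PrueferMax

variable {ℓ β φ : ℝ}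

theorem prueferSpeed_pos (hℓ : 0 < ℓ) (hβ : 0 < β) : 0 < prueferSpeed ℓ β φ := by
  have h := Real.sin_sq_add_cos_sq φ
  have h1 : 0 < ℓ / β := by positivity
  have h2 : 0 < β / ℓ := by positivity
  unfold prueferSpeed
  rcases eq_or_ne (Real.cos φ) 0 with hc | hc
  · rw [hc] at h ⊢
    nlinarith
  · have := sq_pos_of_ne_zero hc
    have := mul_pos h1 this
    nlinarith [mul_nonneg h2.le (sq_nonneg (Real.sin φ))]

theorem prueferMax_pos (hℓ : 0 < ℓ) : 0 < prueferMax ℓ φ :=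
  lt_max_of_lt_left (prueferSpeed_pos hℓ one_pos)

/-- The speed is convex in `β`, so only the ends `1` and `ℓ²` compete. The factored difference shows
when `1` wins; as `β ≤ ℓ²`, the condition `sin² ≤ cos²` is enough. -/
theorem prueferSpeed_one_sub (hℓ : 0 < ℓ) (hβ : 0 < β) :
    prueferSpeed ℓ 1 φ - prueferSpeed ℓ β φ =
      (β - 1) / (β * ℓ) * (ℓ ^ 2 * Real.cos φ ^ 2 - β * Real.sin φ ^ 2) := by
  unfold prueferSpeed; field_simp; ring

theorem prueferSpeed_sq_sub (hℓ : 0 < ℓ) (hβ : 0 < β) :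
    prueferSpeed ℓ (ℓ ^ 2) φ - prueferSpeed ℓ β φ =
      (ℓ ^ 2 - β) / (β * ℓ) * (β * Real.sin φ ^ 2 - Real.cos φ ^ 2) := by
  unfold prueferSpeed; field_simp; ring

theorem prueferSpeed_le_one (hβ1 : 1 ≤ β) (hβ2 : β ≤ ℓ ^ 2) (hℓ : 0 < ℓ)
    (h : Real.sin φ ^ 2 ≤ Real.cos φ ^ 2) : prueferSpeed ℓ β φ ≤ prueferSpeed ℓ 1 φ := by
  have h1 := prueferSpeed_one_sub (φ := φ) hℓ (one_pos.trans_le hβ1)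
  have h2 : 0 ≤ (β - 1) / (β * ℓ) :=
    div_nonneg (by linarith) (mul_nonneg (by linarith) hℓ.le)
  have h3 : 0 ≤ ℓ ^ 2 * Real.cos φ ^ 2 - β * Real.sin φ ^ 2 := by
    nlinarith [sq_nonneg (Real.sin φ), sq_nonneg ℓ]
  linarith [mul_nonneg h2 h3]

theorem prueferSpeed_le_sq (hβ1 : 1 ≤ β) (hβ2 : β ≤ ℓ ^ 2) (hℓ : 0 < ℓ)
    (h : Real.cos φ ^ 2 ≤ Real.sin φ ^ 2) : prueferSpeed ℓ β φ ≤ prueferSpeed ℓ (ℓ ^ 2) φ := by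
  have h1 := prueferSpeed_sq_sub (φ := φ) hℓ (one_pos.trans_le hβ1)
  have h2 : 0 ≤ (ℓ ^ 2 - β) / (β * ℓ) :=
    div_nonneg (by linarith) (mul_nonneg (by linarith) hℓ.le)
  have h3 : 0 ≤ β * Real.sin φ ^ 2 - Real.cos φ ^ 2 := by
    nlinarith [sq_nonneg (Real.sin φ)]
  linarith [mul_nonneg h2 h3]

theorem prueferMax_eq_one (hℓ : 1 ≤ ℓ) (h : Real.sin φ ^ 2 ≤ Real.cos φ ^ 2) :
    prueferMax ℓ φ = prueferSpeed ℓ 1 φ :=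
  max_eq_left (prueferSpeed_le_one (one_le_pow₀ hℓ) le_rfl (one_pos.trans_le hℓ) h)

theorem prueferMax_eq_sq (hℓ : 1 ≤ ℓ) (h : Real.cos φ ^ 2 ≤ Real.sin φ ^ 2) :
    prueferMax ℓ φ = prueferSpeed ℓ (ℓ ^ 2) φ :=
  max_eq_right (prueferSpeed_le_sq le_rfl (one_le_pow₀ hℓ) (one_pos.trans_le hℓ) h)

theorem prueferSpeed_le_max (hℓ : 1 ≤ ℓ) (hβ1 : 1 ≤ β) (hβ2 : β ≤ ℓ ^ 2) :
    prueferSpeed ℓ β φ ≤ prueferMax ℓ φ := by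
  have h0 := one_pos.trans_le hℓ
  rcases le_total (Real.sin φ ^ 2) (Real.cos φ ^ 2) with h | h
  · exact (prueferSpeed_le_one hβ1 hβ2 h0 h).trans (le_max_left _ _)
  · exact (prueferSpeed_le_sq hβ1 hβ2 h0 h).trans (le_max_right _ _)

theorem eq_one_of_prueferSpeed_eq (hℓ : 1 ≤ ℓ) (hβ1 : 1 ≤ β) (hβ2 : β ≤ ℓ ^ 2)
    (h : Real.sin φ ^ 2 < Real.cos φ ^ 2) (heq : prueferSpeed ℓ β φ = prueferMax ℓ φ) :
    β = 1 := by
  have h0 := one_pos.trans_le hℓ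
  have hβ := one_pos.trans_le hβ1
  rw [prueferMax_eq_one hℓ h.le] at heq
  have h1 := prueferSpeed_one_sub (φ := φ) h0 hβ
  rw [heq, sub_self, eq_comm, mul_eq_zero, div_eq_zero_iff] at h1
  have h3 : 0 < ℓ ^ 2 * Real.cos φ ^ 2 - β * Real.sin φ ^ 2 := by
    have := pow_pos h0 2
    nlinarith [sq_nonneg (Real.sin φ)]
  rcases h1 with (h1 | h1) | h1
  · linarith
  · exact absurd h1 (by positivity)
  · exact absurd h1 h3.ne'

theorem eq_sq_of_prueferSpeed_eq (hℓ : 1 ≤ ℓ) (hβ1 : 1 ≤ β)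
    (h : Real.cos φ ^ 2 < Real.sin φ ^ 2) (heq : prueferSpeed ℓ β φ = prueferMax ℓ φ) :
    β = ℓ ^ 2 := by
  have h0 := one_pos.trans_le hℓ
  have hβ := one_pos.trans_le hβ1
  rw [prueferMax_eq_sq hℓ h.le] at heq
  have h1 := prueferSpeed_sq_sub (φ := φ) h0 hβ
  rw [heq, sub_self, eq_comm, mul_eq_zero, div_eq_zero_iff] at h1
  have h3 : 0 < β * Real.sin φ ^ 2 - Real.cos φ ^ 2 := by nlinarith [sq_nonneg (Real.sin φ)]
  rcases h1 with (h1 | h1) | h1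
  · linarith
  · exact absurd h1 (by positivity)
  · exact absurd h1 h3.ne'

theorem continuous_prueferMax (ℓ : ℝ) : Continuous (prueferMax ℓ) := by
  unfold prueferMax prueferSpeed
  fun_prop

/-- A quarter turn exchanges the speeds at `β = 1` and `β = ℓ²`. This symmetry is the reason for
scaling by `ℓ`, the geometric mean of the two ends. -/
theorem prueferMax_add_pi_div_two (hℓ : 0 < ℓ) :
    prueferMax ℓ (φ + Real.pi / 2) = prueferMax ℓ φ := by
  unfold prueferMax prueferSpeed
  rw [Real.cos_add_pi_div_two, Real.sin_add_pi_div_two, max_comm]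
  congr 1 <;> field_simp <;> ring

end PrueferMax

/-- The least time in which the Prüfer angle goes from `0` to `x`. -/
noncomputable def prueferTime (ℓ x : ℝ) : ℝ := ∫ s in (0 : ℝ)..x, (prueferMax ℓ s)⁻¹

section PrueferTime

variable {ℓ : ℝ}

theorem continuous_inv_prueferMax (hℓ : 0 < ℓ) : Continuous fun s => (prueferMax ℓ s)⁻¹ :=
  (continuous_prueferMax ℓ).inv₀ fun _ => (prueferMax_pos hℓ).ne'

theorem hasDerivAt_prueferTime (hℓ : 0 < ℓ) (x : ℝ) :
    HasDerivAt (prueferTime ℓ) (prueferMax ℓ x)⁻¹ x := by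
  have hc := continuous_inv_prueferMax hℓ
  exact intervalIntegral.integral_hasDerivAt_right (hc.intervalIntegrable _ _)
    (hc.stronglyMeasurableAtFilter _ _) hc.continuousAt

theorem strictMono_prueferTime (hℓ : 0 < ℓ) : StrictMono (prueferTime ℓ) :=
  strictMono_of_hasDerivAt_pos (hasDerivAt_prueferTime hℓ) fun _ => inv_pos.2 (prueferMax_pos hℓ)

theorem sin_sq_le_cos_sq {x : ℝ} (h1 : -(Real.pi / 4) ≤ x) (h2 : x ≤ Real.pi / 4) :
    Real.sin x ^ 2 ≤ Real.cos x ^ 2 := by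
  have h : 0 ≤ Real.cos (2 * x) := Real.cos_nonneg_of_mem_Icc ⟨by linarith, by linarith⟩
  rw [Real.cos_two_mul'] at h
  linarith

/-- On this range the maximal speed is `ℓ cos² + ℓ⁻¹ sin²`, whose reciprocal is the derivative of
`arctan (tan s / ℓ)`. -/
theorem prueferTime_sub_arctan (hℓ : 1 ≤ ℓ) {x y : ℝ} (hx : -(Real.pi / 4) ≤ x) (hxy : x ≤ y)
    (hy : y ≤ Real.pi / 4) : prueferTime ℓ y - prueferTime ℓ x =
      Real.arctan (Real.tan y / ℓ) - Real.arctan (Real.tan x / ℓ) := by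
  have h0 := one_pos.trans_le hℓ
  have hc := continuous_inv_prueferMax h0
  unfold prueferTime
  rw [intervalIntegral.integral_interval_sub_left (hc.intervalIntegrable _ _)
    (hc.intervalIntegrable _ _)]
  refine intervalIntegral.integral_eq_sub_of_hasDerivAt
    (f := fun s => Real.arctan (Real.tan s / ℓ)) (fun s hs => ?_) (hc.intervalIntegrable _ _)
  rw [Set.uIcc_of_le hxy] at hs
  have hπ := Real.pi_pos
  have hcos : 0 < Real.cos s :=
    Real.cos_pos_of_mem_Ioo ⟨by linarith [hs.1], by linarith [hs.2]⟩
  have hd := ((Real.hasDerivAt_tan hcos.ne').div_const ℓ).arctan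
  refine hd.congr_deriv ?_
  rw [prueferMax_eq_one hℓ (sin_sq_le_cos_sq (hx.trans hs.1) (hs.2.trans hy)), prueferSpeed,
    Real.tan_eq_sin_div_cos]
  field_simp

theorem prueferTime_pi_div_four (hℓ : 1 ≤ ℓ) :
    prueferTime ℓ (Real.pi / 4) = Real.arctan ℓ⁻¹ := by
  have hπ := Real.pi_pos
  have h := prueferTime_sub_arctan hℓ (x := 0) (y := Real.pi / 4) (by linarith) (by linarith) le_rfl
  simpa [prueferTime] using h

theorem prueferTime_neg_pi_div_four (hℓ : 1 ≤ ℓ) :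
    prueferTime ℓ (-(Real.pi / 4)) = -Real.arctan ℓ⁻¹ := by
  have hπ := Real.pi_pos
  have h := prueferTime_sub_arctan hℓ (x := -(Real.pi / 4)) (y := 0) le_rfl (by linarith)
    (by linarith)
  simp [prueferTime, neg_div] at h
  simp only [prueferTime]
  linarith

theorem prueferTime_add_pi_div_two (hℓ : 1 ≤ ℓ) (x : ℝ) :
    prueferTime ℓ (x + Real.pi / 2) = prueferTime ℓ x + 2 * Real.arctan ℓ⁻¹ := by
  have h0 := one_pos.trans_le hℓ
  have hc := continuous_inv_prueferMax h0
  have hp : Function.Periodic (fun s => (prueferMax ℓ s)⁻¹) (Real.pi / 2) := fun s => by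
    simp only [prueferMax_add_pi_div_two h0]
  have h1 : ∀ z, prueferTime ℓ (z + Real.pi / 2) - prueferTime ℓ z =
      ∫ s in z..z + Real.pi / 2, (prueferMax ℓ s)⁻¹ := fun z =>
    intervalIntegral.integral_interval_sub_left (hc.intervalIntegrable _ _)
      (hc.intervalIntegrable _ _)
  have h2 := hp.intervalIntegral_add_eq x (-(Real.pi / 4))
  rw [← h1, ← h1, prueferTime_neg_pi_div_four hℓ,
    show -(Real.pi / 4) + Real.pi / 2 = Real.pi / 4 by ring, prueferTime_pi_div_four hℓ] at h2
  linarith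

theorem prueferTime_add_two_pi (hℓ : 1 ≤ ℓ) (x : ℝ) :
    prueferTime ℓ (x + 2 * Real.pi) = prueferTime ℓ x + 8 * Real.arctan ℓ⁻¹ := by
  rw [show x + 2 * Real.pi = x + Real.pi / 2 + Real.pi / 2 + Real.pi / 2 + Real.pi / 2 by ring]
  simp only [prueferTime_add_pi_div_two hℓ]
  ring

end PrueferTime

/-! ### The frequency bound and its equality case -/

/-- A Prüfer angle for weights `σ β` and `β / σ` with frequency `ν`. -/
structure IsPrueferAngle (σ β : ℝ → ℝ) (ν ℓ : ℝ) (φ : ℝ → ℝ) : Prop where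
  isPrimitive : IsPrimitive φ fun θ => ν * (σ θ * prueferSpeed ℓ (β θ) (φ θ))
  add_two_pi_le : ∀ θ, φ θ + 2 * Real.pi ≤ φ (θ + 2 * Real.pi)

theorem IsPeriodicSol.exists_isPrueferAngle {a b σ β w U : ℝ → ℝ} {lam ℓ x₁ : ℝ}
    (ha : IsWeight a) (hb : IsWeight b) (hσ : IsWeight σ) (haσ : ∀ᵐ θ, a θ = σ θ * β θ)
    (hbσ : ∀ᵐ θ, (b θ)⁻¹ = σ θ / β θ) (hβ : ∀ᵐ θ, 1 ≤ β θ) (hℓ : 0 < ℓ) (hlam : 0 < lam)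
    (h : IsPeriodicSol a b lam w U) (hx₁ : w x₁ ≠ 0) :
    ∃ φ r : ℝ → ℝ, IsPrueferAngle σ β √lam ℓ φ ∧ (∀ θ, 0 < r θ) ∧
      (∀ θ, U θ = r θ * Real.cos (φ θ)) ∧ ∀ θ, √lam * ℓ * w θ = r θ * Real.sin (φ θ) := by
  have hν : 0 < √lam := Real.sqrt_pos.2 hlam
  have hν2 : √lam ^ 2 = lam := Real.sq_sqrt hlam.le
  obtain ⟨φ, r, hφ, hr, hU, hw⟩ := h.toIsSol.exists_pruefer ha hb (mul_pos hν hℓ) hx₁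
  have hφ' : IsPrimitive φ fun θ => √lam * (σ θ * prueferSpeed ℓ (β θ) (φ θ)) := by
    refine hφ.congr_ae ?_
    filter_upwards [haσ, hbσ] with θ h1 h2
    rw [h1, h2, prueferSpeed]
    nth_rewrite 2 [← hν2]
    field_simp
  have hmono : StrictMono φ := by
    refine hφ'.strictMono ?_
    filter_upwards [hσ.ae_pos, hβ] with θ h1 h2
    exact mul_pos hν (mul_pos h1 (prueferSpeed_pos hℓ (one_pos.trans_le h2)))
  refine ⟨φ, r, ⟨hφ', fun θ => ?_⟩, hr, hU, hw⟩
  have hr2 : ∀ θ, r θ ^ 2 = U θ ^ 2 + (√lam * ℓ * w θ) ^ 2 := fun θ => by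
    rw [hU, hw]
    linear_combination (-(r θ ^ 2)) * Real.sin_sq_add_cos_sq (φ θ)
  have hrper : r (θ + 2 * Real.pi) = r θ := by
    have h1 : r (θ + 2 * Real.pi) ^ 2 = r θ ^ 2 := by
      rw [hr2, hr2, h.periodic_left, h.periodic_right]
    exact (pow_left_inj₀ (hr _).le (hr _).le two_ne_zero).1 h1
  have hcos : Real.cos (φ (θ + 2 * Real.pi)) = Real.cos (φ θ) := by
    have h1 := hU (θ + 2 * Real.pi)
    rw [h.periodic_right, hrper, hU θ] at h1
    exact (mul_left_cancel₀ (hr θ).ne' h1).symm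
  have hsin : Real.sin (φ (θ + 2 * Real.pi)) = Real.sin (φ θ) := by
    have h1 := hw (θ + 2 * Real.pi)
    rw [h.periodic_left, hrper, hw θ] at h1
    exact (mul_left_cancel₀ (hr θ).ne' h1).symm
  -- By periodicity of `(U, w)` the increment over a period is `2πk`; strict monotonicity of the
  -- angle forces `k ≥ 1`.
  obtain ⟨k, hk⟩ := Real.Angle.angle_eq_iff_two_pi_dvd_sub.1 (Real.Angle.cos_sin_inj hcos hsin)
  have hlt := hmono (show θ < θ + 2 * Real.pi by linarith [Real.pi_pos])
  have hk1 : 1 ≤ k := by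
    by_contra hc
    have : (k : ℝ) ≤ 0 := by exact_mod_cast (by omega : k ≤ 0)
    nlinarith [Real.pi_pos]
  have : (1 : ℝ) ≤ k := by exact_mod_cast hk1
  nlinarith [Real.pi_pos]

namespace IsPrueferAngle

variable {σ β φ : ℝ → ℝ} {ν ℓ : ℝ}

/-- The defect compares the elapsed weighted time with the least time the angle needs. Its
derivative is `νσ` times one minus the ratio of actual to maximal speed, hence nonnegative. -/
theorem defect_isPrimitive (h : IsPrueferAngle σ β ν ℓ φ) (hσ : IsWeight σ) (hℓ : 0 < ℓ) :
    IsPrimitive (fun θ => ν * (0 + ∫ t in (0 : ℝ)..θ, σ t) - prueferTime ℓ (φ θ))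
      fun θ => ν * σ θ -
        (prueferMax ℓ (φ θ))⁻¹ * (ν * (σ θ * prueferSpeed ℓ (β θ) (φ θ))) :=
  ((IsPrimitive.of_locallyIntegrable hσ.locallyIntegrable 0 0).const_mul ν).sub
    (h.isPrimitive.comp (hasDerivAt_prueferTime hℓ) (continuous_inv_prueferMax hℓ))

theorem defect_nonneg (hσ : IsWeight σ) (hν : 0 < ν) (hℓ : 1 ≤ ℓ)
    (hβ : ∀ᵐ θ, 1 ≤ β θ ∧ β θ ≤ ℓ ^ 2) : ∀ᵐ θ, 0 ≤ ν * σ θ -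
        (prueferMax ℓ (φ θ))⁻¹ * (ν * (σ θ * prueferSpeed ℓ (β θ) (φ θ))) := by
  filter_upwards [hσ.ae_pos, hβ] with θ h1 h2
  have h3 := prueferSpeed_le_max (φ := φ θ) hℓ h2.1 h2.2
  have h4 := prueferMax_pos (φ := φ θ) (one_pos.trans_le hℓ)
  have h5 : (prueferMax ℓ (φ θ))⁻¹ * (ν * (σ θ * prueferSpeed ℓ (β θ) (φ θ))) =
      ν * σ θ * (prueferSpeed ℓ (β θ) (φ θ) / prueferMax ℓ (φ θ)) := by
    field_simp
  rw [h5]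
  have h6 := (div_le_one h4).2 h3
  nlinarith [mul_pos hν h1]

theorem prueferTime_add_le (h : IsPrueferAngle σ β ν ℓ φ) (hℓ : 1 ≤ ℓ) (θ : ℝ) :
    prueferTime ℓ (φ θ) + 8 * Real.arctan ℓ⁻¹ ≤ prueferTime ℓ (φ (θ + 2 * Real.pi)) := by
  rw [← prueferTime_add_two_pi hℓ]
  exact (strictMono_prueferTime (one_pos.trans_le hℓ)).monotone (h.add_two_pi_le θ)

/-- The lower bound for the frequency. -/
theorem le_integral (h : IsPrueferAngle σ β ν ℓ φ) (hσ : IsWeight σ) (hν : 0 < ν) (hℓ : 1 ≤ ℓ)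
    (hβ : ∀ᵐ θ, 1 ≤ β θ ∧ β θ ≤ ℓ ^ 2) :
    8 * Real.arctan ℓ⁻¹ ≤ ν * ∫ θ in (0 : ℝ)..2 * Real.pi, σ θ := by
  have h1 := (h.defect_isPrimitive hσ (one_pos.trans_le hℓ)).monotone (defect_nonneg hσ hν hℓ hβ)
    Real.two_pi_pos.le
  have h2 := h.prueferTime_add_le hℓ 0
  simp only [zero_add, intervalIntegral.integral_same, mul_zero, zero_sub] at h1 h2
  linarith

section Equality

variable (h : IsPrueferAngle σ β ν ℓ φ) (hσ : IsWeight σ) (hν : 0 < ν) (hℓ : 1 ≤ ℓ)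
  (hβ : ∀ᵐ θ, 1 ≤ β θ ∧ β θ ≤ ℓ ^ 2)
  (heq : ν * ∫ θ in (0 : ℝ)..2 * Real.pi, σ θ = 8 * Real.arctan ℓ⁻¹)

include h hσ hν hℓ hβ heq

/-- Under equality the weighted time gains exactly `8 arctan ℓ⁻¹` per period while the least time
gains at least that much. The monotone defect therefore cannot increase over a period: it is
periodic, hence constant. -/
theorem defect_eq (x y : ℝ) :
    ν * (0 + ∫ t in (0 : ℝ)..x, σ t) - prueferTime ℓ (φ x) =
      ν * (0 + ∫ t in (0 : ℝ)..y, σ t) - prueferTime ℓ (φ y) := by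
  have hmono := (h.defect_isPrimitive hσ (one_pos.trans_le hℓ)).monotone
    (defect_nonneg hσ hν hℓ hβ)
  refine Function.Periodic.eq_of_monotone
    (f := fun x => ν * (0 + ∫ t in (0 : ℝ)..x, σ t) - prueferTime ℓ (φ x))
    (fun θ => le_antisymm ?_ (hmono (by linarith [Real.pi_pos]))) hmono x y
  have h1 := h.prueferTime_add_le hℓ θ
  have h2 := intervalIntegral.integral_add_adjacent_intervals
    (hσ.locallyIntegrable.intervalIntegrable_real 0 θ)
    (hσ.locallyIntegrable.intervalIntegrable_real θ (θ + 2 * Real.pi))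
  rw [hσ.periodic.intervalIntegral_eq] at h2
  simp only [← h2]
  linarith

theorem prueferTime_sub_eq (x y : ℝ) :
    prueferTime ℓ (φ y) - prueferTime ℓ (φ x) = ν * ∫ t in x..y, σ t := by
  have h1 := h.defect_eq hσ hν hℓ hβ heq x y
  have h2 := intervalIntegral.integral_add_adjacent_intervals
    (hσ.locallyIntegrable.intervalIntegrable_real 0 x)
    (hσ.locallyIntegrable.intervalIntegrable_real x y)
  rw [← h2] at h1
  linarith

theorem add_two_pi (θ : ℝ) : φ (θ + 2 * Real.pi) = φ θ + 2 * Real.pi := by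
  refine (strictMono_prueferTime (one_pos.trans_le hℓ)).injective ?_
  have h1 := h.prueferTime_sub_eq hσ hν hℓ hβ heq θ (θ + 2 * Real.pi)
  rw [hσ.periodic.intervalIntegral_eq, heq] at h1
  rw [prueferTime_add_two_pi hℓ]
  linarith

/-- A constant defect has zero derivative, and `νσ > 0` can be cancelled. -/
theorem prueferSpeed_eq : ∀ᵐ θ, prueferSpeed ℓ (β θ) (φ θ) = prueferMax ℓ (φ θ) := by
  have h0 := one_pos.trans_le hℓ
  have hP := h.defect_isPrimitive hσ h0
  have hZ : IsPrimitive (fun θ => ν * (0 + ∫ t in (0 : ℝ)..θ, σ t) - prueferTime ℓ (φ θ))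
      fun _ => 0 :=
    ⟨locallyIntegrable_const 0, fun x y => by
      rw [h.defect_eq hσ hν hℓ hβ heq x y]; simp⟩
  filter_upwards [hP.ae_unique hZ, hσ.ae_pos] with θ h1 h2
  have h3 := prueferMax_pos (φ := φ θ) h0
  have h4 := mul_pos hν h2
  field_simp at h1
  have h5 : ν * σ θ * (prueferMax ℓ (φ θ) - prueferSpeed ℓ (β θ) (φ θ)) = 0 := by
    linear_combination h1
  rcases mul_eq_zero.1 h5 with h6 | h6
  · exact absurd h6 h4.ne'
  · linarith

theorem ae_eq_one : ∀ᵐ θ, Real.sin (φ θ) ^ 2 < Real.cos (φ θ) ^ 2 → β θ = 1 := by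
  filter_upwards [h.prueferSpeed_eq hσ hν hℓ hβ heq, hβ] with θ h1 h2 h3
  exact eq_one_of_prueferSpeed_eq hℓ h2.1 h2.2 h3 h1

theorem ae_eq_sq : ∀ᵐ θ, Real.cos (φ θ) ^ 2 < Real.sin (φ θ) ^ 2 → β θ = ℓ ^ 2 := by
  filter_upwards [h.prueferSpeed_eq hσ hν hℓ hβ heq, hβ] with θ h1 h2 h3
  exact eq_sq_of_prueferSpeed_eq hℓ h2.1 h3 h1

omit heq in
theorem strictMono : StrictMono φ := by
  refine h.isPrimitive.strictMono ?_
  filter_upwards [hσ.ae_pos, hβ] with θ h1 h2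
  exact mul_pos hν (mul_pos h1 (prueferSpeed_pos (one_pos.trans_le hℓ) (one_pos.trans_le h2.1)))

end Equality

end IsPrueferAngle

/-! ### Constants and powers of the weight -/

section Constants

variable {M p q : ℝ}

theorem cpq_mul (hM : 0 < M) : cpq M p q * (1 + (M ^ ((p - q) / 2))⁻¹) = 2 := by
  have h : 0 < M ^ ((p - q) / 2) := Real.rpow_pos_of_pos hM _
  rw [cpq, neg_div, Real.rpow_neg hM.le]
  field_simp

theorem cpq_pos (hM : 0 < M) : 0 < cpq M p q := by
  have h : 0 < M ^ (-(p - q) / 2) := Real.rpow_pos_of_pos hM _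
  rw [cpq]
  positivity

theorem cpq_lt_two (hM : 0 < M) : cpq M p q < 2 := by
  have h := cpq_mul (p := p) (q := q) hM
  have h1 := cpq_pos (p := p) (q := q) hM
  have h2 : 0 < (M ^ ((p - q) / 2))⁻¹ := inv_pos.2 (Real.rpow_pos_of_pos hM _)
  nlinarith [mul_pos h1 h2]

theorem rpow_neg_eq_inv (hM : 0 < M) : M ^ (-(p + q) / 4) = (M ^ ((p + q) / 4))⁻¹ := by
  rw [neg_div, Real.rpow_neg hM.le]

theorem rpow_sq (hM : 0 < M) : (M ^ ((p + q) / 4)) ^ 2 = M ^ ((p + q) / 2) := by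
  rw [← Real.rpow_natCast, ← Real.rpow_mul hM.le]
  congr 1
  push_cast
  ring

theorem wirtingerBound_eq (hM : 0 < M) (γ : ℝ → ℝ) :
    wirtingerBound M p q γ = ((∫ θ in (0 : ℝ)..2 * Real.pi, γ θ ^ ((p - q) / 2)) /
      (8 * Real.arctan (M ^ ((p + q) / 4))⁻¹)) ^ 2 := by
  have hπ := Real.pi_pos
  have h : 0 < Real.arctan (M ^ ((p + q) / 4))⁻¹ :=
    Real.arctan_pos.2 (inv_pos.2 (Real.rpow_pos_of_pos hM _))
  rw [wirtingerBound, rpow_neg_eq_inv hM]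
  congr 1
  field_simp
  ring

end Constants

theorem WeightClass.isWeight {M : ℝ} {γ : ℝ → ℝ} (h : WeightClass M γ) :
    IsWeight γ ∧ ∀ᵐ θ, 1 ≤ γ θ ∧ γ θ ≤ M := by
  -- Real essential bounds are meaningful only for essentially bounded functions; the `L^∞`
  -- hypothesis supplies this before `essInf` and `essSup` are used.
  obtain ⟨K, hK⟩ : ∃ K, ∀ᵐ θ, |γ θ| ≤ K := by
    refine ⟨(eLpNorm γ ⊤ volume).toReal, ?_⟩
    filter_upwards [ae_le_eLpNormEssSup (f := γ) (μ := volume)] with θ hθ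
    rw [eLpNorm_exponent_top]
    have h1 : eLpNormEssSup γ volume ≠ ⊤ := by
      rw [← eLpNorm_exponent_top]
      exact h.memLp_top.2.ne
    have := ENNReal.toReal_mono h1 hθ
    simpa using this
  have h1 : ∀ᵐ θ, essInf γ volume ≤ γ θ :=
    ae_essInf_le ⟨-K, by
      rw [Filter.eventually_map]
      exact hK.mono fun θ hθ => (abs_le.1 hθ).1⟩
  have h2 : ∀ᵐ θ, γ θ ≤ essSup γ volume :=
    ae_le_essSup ⟨K, by
      rw [Filter.eventually_map]
      exact hK.mono fun θ hθ => (abs_le.1 hθ).2⟩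
  rw [h.essInf_eq] at h1
  rw [h.essSup_eq] at h2
  exact ⟨⟨h.memLp_top.1, h.periodic, 1, M, one_pos, h1.and h2⟩, h1.and h2⟩

section Powers

variable {M p q : ℝ} {γ : ℝ → ℝ}

/-- With the next identity this gives `a = σβ` and `1/b = σ/β` for `σ = γ^((p-q)/2)` and `β =
γ^((p+q)/2)`: the factor `σ` only changes the time scale, and the bound depends on `β` only through
its range. -/
theorem rpow_eq_mul {x : ℝ} (hx : 0 < x) :
    x ^ p = x ^ ((p - q) / 2) * x ^ ((p + q) / 2) := by
  rw [← Real.rpow_add hx]; congr 1; ring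

theorem rpow_inv_eq_div {x : ℝ} (hx : 0 < x) :
    (x ^ q)⁻¹ = x ^ ((p - q) / 2) / x ^ ((p + q) / 2) := by
  rw [← Real.rpow_sub hx, ← Real.rpow_neg hx.le]; congr 1; ring

theorem rpow_half_bounds (hM : 1 < M) (hpq : 0 ≤ p + q) (hγM : ∀ᵐ θ, 1 ≤ γ θ ∧ γ θ ≤ M) :
    ∀ᵐ θ, 1 ≤ γ θ ^ ((p + q) / 2) ∧ γ θ ^ ((p + q) / 2) ≤ (M ^ ((p + q) / 4)) ^ 2 := by
  filter_upwards [hγM] with θ h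
  rw [rpow_sq (one_pos.trans hM)]
  exact ⟨Real.one_le_rpow h.1 (by linarith),
    Real.rpow_le_rpow (by linarith [h.1]) h.2 (by linarith)⟩

theorem exists_isPrueferAngle_of_isPeriodicSol {w U : ℝ → ℝ} {lam x₁ : ℝ} (hM : 1 < M)
    (hpq : 0 ≤ p + q) (hγ : IsWeight γ) (hγM : ∀ᵐ θ, 1 ≤ γ θ ∧ γ θ ≤ M) (hlam : 0 < lam)
    (h : IsPeriodicSol (fun θ => γ θ ^ p) (fun θ => γ θ ^ q) lam w U) (hx₁ : w x₁ ≠ 0) :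
    ∃ φ r : ℝ → ℝ, IsPrueferAngle (fun θ => γ θ ^ ((p - q) / 2)) (fun θ => γ θ ^ ((p + q) / 2))
        √lam (M ^ ((p + q) / 4)) φ ∧ (∀ θ, 0 < r θ) ∧
      (∀ θ, U θ = r θ * Real.cos (φ θ)) ∧
      ∀ θ, √lam * M ^ ((p + q) / 4) * w θ = r θ * Real.sin (φ θ) :=
  h.exists_isPrueferAngle (hγ.rpow p) (hγ.rpow q) (hγ.rpow _)
    (hγ.ae_pos.mono fun _ hx => rpow_eq_mul hx) (hγ.ae_pos.mono fun _ hx => rpow_inv_eq_div hx)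
    ((rpow_half_bounds hM hpq hγM).mono fun _ hx => hx.1)
    (Real.rpow_pos_of_pos (one_pos.trans hM) _) hlam hx₁

theorem bestConst_le_wirtingerBound (hM : 1 < M) (hpq : 0 ≤ p + q) (hγ : IsWeight γ)
    (hγM : ∀ᵐ θ, 1 ≤ γ θ ∧ γ θ ≤ M) :
    bestConst (fun θ => γ θ ^ p) (fun θ => γ θ ^ q) ≤ wirtingerBound M p q γ := by
  have hM0 := one_pos.trans hM
  obtain ⟨-, hpos, w, U, hsol, x, hx⟩ := bestConst_spec (hγ.rpow p) (hγ.rpow q)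
  set C := bestConst (fun θ => γ θ ^ p) (fun θ => γ θ ^ q)
  obtain ⟨φ, r, hφ, -⟩ := exists_isPrueferAngle_of_isPeriodicSol hM hpq hγ hγM (inv_pos.2 hpos)
    hsol hx
  have hℓ : 1 ≤ M ^ ((p + q) / 4) := Real.one_le_rpow hM.le (by linarith)
  have h := hφ.le_integral (hγ.rpow _) (Real.sqrt_pos.2 (inv_pos.2 hpos)) hℓ
    (rpow_half_bounds hM hpq hγM)
  have hA : 0 < Real.arctan (M ^ ((p + q) / 4))⁻¹ :=
    Real.arctan_pos.2 (inv_pos.2 (one_pos.trans_le hℓ))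
  rw [wirtingerBound_eq hM0]
  rw [Real.sqrt_inv, inv_mul_eq_div, le_div_iff₀ (Real.sqrt_pos.2 hpos), mul_comm,
    ← le_div_iff₀ (by positivity)] at h
  calc C = √C ^ 2 := (Real.sq_sqrt hpos.le).symm
    _ ≤ _ := pow_le_pow_left₀ (Real.sqrt_nonneg _) h 2

theorem sqrt_inv_bestConst_mul (hM : 1 < M) (hγ : IsWeight γ) {C : ℝ}
    (heq : C = wirtingerBound M p q γ) :
    √C⁻¹ * ∫ θ in (0 : ℝ)..2 * Real.pi, γ θ ^ ((p - q) / 2) =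
      8 * Real.arctan (M ^ ((p + q) / 4))⁻¹ := by
  have hM0 := one_pos.trans hM
  have hA : 0 < Real.arctan (M ^ ((p + q) / 4))⁻¹ :=
    Real.arctan_pos.2 (inv_pos.2 (Real.rpow_pos_of_pos hM0 _))
  have hI := (hγ.rpow ((p - q) / 2)).integral_pos
  rw [wirtingerBound_eq hM0] at heq
  rw [Real.sqrt_inv, heq, Real.sqrt_sq (by positivity)]
  field_simp

end Powers

/-! ### The step weight and rigidity in the equality case -/

section GammaBar

variable {M p q : ℝ}

theorem gammaBar_periodic : Function.Periodic (gammaBar M p q) (2 * Real.pi) := fun θ => by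
  rw [gammaBar, gammaBar, angle_add_two_pi]

theorem measurable_gammaBar : Measurable (gammaBar M p q) := by
  refine Measurable.comp ?_ measurable_angle
  exact Measurable.ite measurableSet_Iio measurable_const
    (Measurable.ite measurableSet_Iio measurable_const
      (Measurable.ite measurableSet_Iio measurable_const measurable_const))

theorem gammaBar_eq (θ : ℝ) : gammaBar M p q θ = 1 ∨ gammaBar M p q θ = M := by
  unfold gammaBar gammaBase
  split_ifs <;> simp

theorem gammaBar_bounds (hM : 1 < M) (θ : ℝ) : 1 ≤ gammaBar M p q θ ∧ gammaBar M p q θ ≤ M := by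
  rcases gammaBar_eq (M := M) (p := p) (q := q) θ with h | h <;> rw [h] <;> constructor <;> linarith

theorem gammaBar_shift_isWeight (hM : 1 < M) (φ : ℝ) :
    IsWeight fun θ => gammaBar M p q (θ + φ) :=
  ⟨(measurable_gammaBar.comp (measurable_add_const φ)).aestronglyMeasurable,
    Filter.Eventually.of_forall fun θ => by
      change gammaBar M p q (θ + 2 * Real.pi + φ) = gammaBar M p q (θ + φ)
      rw [show θ + 2 * Real.pi + φ = θ + φ + 2 * Real.pi by ring, gammaBar_periodic],
    1, M, one_pos, Filter.Eventually.of_forall fun θ => gammaBar_bounds hM _⟩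

theorem gammaBase_eq_one_left {θ : ℝ} (h : θ < cpq M p q * (Real.pi / 2)) :
    gammaBase M p q θ = 1 := if_pos h

theorem gammaBase_eq_right (hM : 0 < M) {θ : ℝ} (h : Real.pi + cpq M p q * (Real.pi / 2) ≤ θ) :
    gammaBase M p q θ = M := by
  have h1 := cpq_pos (p := p) (q := q) hM
  have h2 := cpq_lt_two (p := p) (q := q) hM
  have hπ := Real.pi_pos
  have h3 := mul_pos h1 hπ
  unfold gammaBase
  rw [if_neg (by linarith), if_neg (by linarith), if_neg (by linarith)]

theorem essInf_eq_of_attained {f : ℝ → ℝ} {m : ℝ} (h : ∀ᵐ θ, m ≤ f θ) {s : Set ℝ}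
    (hs : volume s ≠ 0) (hm : ∀ θ ∈ s, f θ = m) : essInf f volume = m := by
  rw [essInf, Filter.liminf_eq]
  have : {a | ∀ᵐ θ, a ≤ f θ} = Set.Iic m := by
    ext a
    refine ⟨fun ha => ?_, fun ha => h.mono fun θ hθ => le_trans ha hθ⟩
    by_contra hc
    refine hs (measure_mono_null (fun θ hθ => ?_) (ae_iff.1 ha))
    change ¬ a ≤ f θ
    rw [hm θ hθ]
    exact hc
  rw [this, csSup_Iic]

theorem essSup_eq_of_attained {f : ℝ → ℝ} {m : ℝ} (h : ∀ᵐ θ, f θ ≤ m) {s : Set ℝ}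
    (hs : volume s ≠ 0) (hm : ∀ θ ∈ s, f θ = m) : essSup f volume = m := by
  rw [essSup, Filter.limsup_eq]
  have : {a | ∀ᵐ θ, f θ ≤ a} = Set.Ici m := by
    ext a
    refine ⟨fun ha => ?_, fun ha => h.mono fun θ hθ => le_trans hθ ha⟩
    by_contra hc
    refine hs (measure_mono_null (fun θ hθ => ?_) (ae_iff.1 ha))
    change ¬ f θ ≤ a
    rw [hm θ hθ]
    exact hc
  rw [this, csInf_Ici]

theorem gammaBar_shift_weightClass (hM : 1 < M) (φ : ℝ) :
    WeightClass M fun θ => gammaBar M p q (θ + φ) := by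
  have hM0 := one_pos.trans hM
  have hw := gammaBar_shift_isWeight (p := p) (q := q) hM φ
  have h1 := cpq_pos (p := p) (q := q) hM0
  have h2 := cpq_lt_two (p := p) (q := q) hM0
  have hπ := Real.pi_pos
  have h3 := mul_pos h1 hπ
  have h4 := mul_lt_mul_of_pos_right h2 hπ
  refine ⟨memLp_top_of_bound hw.aestronglyMeasurable M (Filter.Eventually.of_forall fun θ => ?_),
    hw.periodic,
    essInf_eq_of_attained (s := Set.Ioo (-φ) (-φ + cpq M p q * (Real.pi / 2)))
      (Filter.Eventually.of_forall fun θ => (gammaBar_bounds hM _).1) ?_ fun θ hθ => ?_,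
    essSup_eq_of_attained (s := Set.Ioo (-φ + (Real.pi + cpq M p q * (Real.pi / 2)))
      (-φ + 2 * Real.pi))
      (Filter.Eventually.of_forall fun θ => (gammaBar_bounds hM _).2) ?_ fun θ hθ => ?_⟩
  · have := gammaBar_bounds (p := p) (q := q) hM (θ + φ)
    rw [Real.norm_eq_abs, abs_of_pos (by linarith [this.1])]
    exact this.2
  · simp only [Real.volume_Ioo, ne_eq, ENNReal.ofReal_eq_zero, not_le]
    linarith
  · rw [gammaBar, angle_eq_self (by linarith [hθ.1]) (by linarith [hθ.2])]
    exact gammaBase_eq_one_left (by linarith [hθ.2])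
  · simp only [Real.volume_Ioo, ne_eq, ENNReal.ofReal_eq_zero, not_le]
    linarith
  · rw [gammaBar, angle_eq_self (by linarith [hθ.1]) (by linarith [hθ.2])]
    exact gammaBase_eq_right hM0 (by linarith [hθ.1])

theorem WeightClass.congr {γ γ' : ℝ → ℝ} (h : WeightClass M γ) (hγ : γ =ᵐ[volume] γ') :
    WeightClass M γ' :=
  ⟨(memLp_congr_ae hγ).1 h.memLp_top, h.periodic.congr hγ, by rw [← essInf_congr_ae hγ, h.essInf_eq],
    by rw [← essSup_congr_ae hγ, h.essSup_eq]⟩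

/-- Equality in the frequency bound forces the weight to be a translate of the step weight. -/
theorem ae_eq_gammaBar_of_isPrueferAngle {γ φ : ℝ → ℝ} {ν : ℝ} (hM : 1 < M) (hpq : 0 < p + q)
    (hγ : IsWeight γ) (hγM : ∀ᵐ θ, 1 ≤ γ θ ∧ γ θ ≤ M) (hν : 0 < ν)
    (h : IsPrueferAngle (fun θ => γ θ ^ ((p - q) / 2)) (fun θ => γ θ ^ ((p + q) / 2)) ν
      (M ^ ((p + q) / 4)) φ)
    (heq : ν * ∫ θ in (0 : ℝ)..2 * Real.pi, γ θ ^ ((p - q) / 2) =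
      8 * Real.arctan (M ^ ((p + q) / 4))⁻¹) :
    ∃ x, ∀ᵐ θ, γ θ = gammaBar M p q (θ + x) := by
  have hM0 := one_pos.trans hM
  have hπ := Real.pi_pos
  have hℓ : 1 ≤ M ^ ((p + q) / 4) := Real.one_le_rpow hM.le (by linarith)
  have hβ := rpow_half_bounds hM hpq.le hγM
  have hσ := hγ.rpow ((p - q) / 2)
  have hmono := h.strictMono hσ hν hℓ hβ
  have hper := h.add_two_pi hσ hν hℓ hβ heq
  have hcont := h.isPrimitive.continuous
  have htime := h.prueferTime_sub_eq hσ hν hℓ hβ heq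
  -- The angle advances by exactly `2π` per period, so it is unbounded in both directions and takes
  -- every value.
  have hiter : ∀ n : ℕ, φ (n * (2 * Real.pi)) = φ 0 + n * (2 * Real.pi) ∧
      φ (-(n * (2 * Real.pi))) = φ 0 - n * (2 * Real.pi) := by
    intro n
    induction n with
    | zero => simp
    | succ n ih =>
      constructor
      · push_cast
        rw [add_mul, one_mul, hper, ih.1]; ring
      · have h1 := hper (-(((n + 1 : ℕ) : ℝ) * (2 * Real.pi)))
        push_cast at h1 ⊢
        rw [show -(((n : ℝ) + 1) * (2 * Real.pi)) + 2 * Real.pi = -(n * (2 * Real.pi)) by ring,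
          ih.2] at h1
        linarith
  have hsurj : ∀ y, ∃ x, φ x = y := by
    intro y
    obtain ⟨n, hn⟩ := exists_nat_ge (|y - φ 0| / (2 * Real.pi))
    rw [div_le_iff₀ Real.two_pi_pos] at hn
    have := abs_le.1 hn
    exact mem_range_of_exists_le_of_exists_ge hcont ⟨_, by rw [(hiter n).2]; linarith⟩
      ⟨_, by rw [(hiter n).1]; linarith⟩
  -- These phases delimit the quarter turns on which `cos 2φ` keeps its sign, and so on which `γ` is
  -- constant, alternately `1` and `M`.
  obtain ⟨x₀, hx₀⟩ := hsurj (-(Real.pi / 4))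
  obtain ⟨x₁, hx₁⟩ := hsurj (Real.pi / 4)
  obtain ⟨x₂, hx₂⟩ := hsurj (3 * Real.pi / 4)
  obtain ⟨x₃, hx₃⟩ := hsurj (5 * Real.pi / 4)
  have hx₄ : φ (x₀ + 2 * Real.pi) = 7 * Real.pi / 4 := by rw [hper, hx₀]; ring
  have h01 : x₀ < x₁ := hmono.lt_iff_lt.1 (by rw [hx₀, hx₁]; linarith)
  have h12 : x₁ < x₂ := hmono.lt_iff_lt.1 (by rw [hx₁, hx₂]; linarith)
  have h23 : x₂ < x₃ := hmono.lt_iff_lt.1 (by rw [hx₂, hx₃]; linarith)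
  have h34 : x₃ < x₀ + 2 * Real.pi := hmono.lt_iff_lt.1 (by rw [hx₃, hx₄]; linarith)
  have hs0 : (p + q) / 2 ≠ 0 := by positivity
  have hone : ∀ᵐ θ, 0 < Real.cos (2 * φ θ) → γ θ = 1 := by
    filter_upwards [h.ae_eq_one hσ hν hℓ hβ heq, hγM] with θ h1 h2 h3
    rw [Real.cos_two_mul'] at h3
    have h4 := h1 (by linarith)
    exact (Real.rpow_left_inj (by linarith [h2.1]) one_pos.le hs0).1 (by rw [h4, Real.one_rpow])
  have hbig : ∀ᵐ θ, Real.cos (2 * φ θ) < 0 → γ θ = M := by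
    filter_upwards [h.ae_eq_sq hσ hν hℓ hβ heq, hγM] with θ h1 h2 h3
    rw [Real.cos_two_mul'] at h3
    have h4 := h1 (by linarith)
    rw [rpow_sq hM0] at h4
    exact (Real.rpow_left_inj (by linarith [h2.1]) hM0.le hs0).1 h4
  have hneg : ∀ x, Real.pi / 2 < x → x < 3 * Real.pi / 2 → Real.cos x < 0 := fun x h1 h2 =>
    Real.cos_neg_of_pi_div_two_lt_of_lt h1 (by linarith)
  have r1 : ∀ᵐ θ, θ ∈ Set.Ioo x₀ x₁ → γ θ = 1 := by
    filter_upwards [hone] with θ h1 hθ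
    refine h1 (Real.cos_pos_of_mem_Ioo ?_)
    have e1 := hmono hθ.1
    have e2 := hmono hθ.2
    constructor <;> linarith
  have r2 : ∀ᵐ θ, θ ∈ Set.Ioo x₁ x₂ → γ θ = M := by
    filter_upwards [hbig] with θ h1 hθ
    have e1 := hmono hθ.1
    have e2 := hmono hθ.2
    exact h1 (hneg _ (by linarith) (by linarith))
  have r3 : ∀ᵐ θ, θ ∈ Set.Ioo x₂ x₃ → γ θ = 1 := by
    filter_upwards [hone] with θ h1 hθ
    have e1 := hmono hθ.1
    have e2 := hmono hθ.2
    refine h1 ?_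
    rw [← Real.cos_sub_two_pi]
    exact Real.cos_pos_of_mem_Ioo ⟨by linarith, by linarith⟩
  have r4 : ∀ᵐ θ, θ ∈ Set.Ioo x₃ (x₀ + 2 * Real.pi) → γ θ = M := by
    filter_upwards [hbig] with θ h1 hθ
    have e1 := hmono hθ.1
    have e2 := hmono hθ.2
    refine h1 ?_
    rw [← Real.cos_sub_two_pi]
    exact hneg _ (by linarith) (by linarith)
  obtain ⟨A, hA⟩ : ∃ A, A = Real.arctan (M ^ ((p + q) / 4))⁻¹ := ⟨_, rfl⟩
  obtain ⟨m, hm⟩ : ∃ m, m = M ^ ((p - q) / 2) := ⟨_, rfl⟩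
  have hm0 : 0 < m := hm ▸ Real.rpow_pos_of_pos hM0 _
  have hne : ∀ x : ℝ, ∀ᵐ θ : ℝ, θ ≠ x := fun x => by simp [ae_iff]
  -- Each quarter turn costs time `2A`, which determines the length of its arc from the constant
  -- value of `γ` there.
  have hint : ∀ x y c : ℝ, x < y → (∀ᵐ θ, θ ∈ Set.Ioo x y → γ θ = c) →
      φ y = φ x + Real.pi / 2 → 2 * A = ν * ((y - x) * c ^ ((p - q) / 2)) := by
    intro x y c hxy hc hφ
    have h1 := htime x y
    rw [hφ, prueferTime_add_pi_div_two hℓ, ← hA, intervalIntegral.integral_congr_ae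
      (g := fun _ => c ^ ((p - q) / 2)), intervalIntegral.integral_const, smul_eq_mul] at h1
    · linarith
    · filter_upwards [hc, hne y] with θ e1 e2 e3
      rw [Set.uIoc_of_le hxy.le] at e3
      rw [e1 ⟨e3.1, lt_of_le_of_ne e3.2 e2⟩]
  have l1 := hint _ _ _ h01 r1 (by rw [hx₁, hx₀]; ring)
  have l2 := hint _ _ _ h12 r2 (by rw [hx₂, hx₁]; ring)
  have l3 := hint _ _ _ h23 r3 (by rw [hx₃, hx₂]; ring)
  have l4 := hint _ _ _ h34 r4 (by rw [hx₄, hx₃]; ring)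
  rw [← hm] at l2 l4
  rw [Real.one_rpow, mul_one] at l1 l3
  have hc := cpq_mul (p := p) (q := q) hM0
  rw [← hm] at hc
  have d1 : x₁ - x₀ = 2 * A / ν := by field_simp; linarith
  have d2 : x₂ - x₁ = 2 * A / ν * m⁻¹ := by field_simp; linarith
  have d3 : x₃ - x₂ = 2 * A / ν := by field_simp; linarith
  have d4 : x₀ + 2 * Real.pi - x₃ = 2 * A / ν * m⁻¹ := by field_simp; linarith
  -- The four arcs fill one period, so a consecutive pair has length `π`; this is the equation
  -- defining `cpq`.
  have hd : 2 * A / ν = cpq M p q * (Real.pi / 2) := by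
    have h1 : 2 * A / ν * (1 + m⁻¹) = Real.pi := by linarith
    have h2 : cpq M p q * (Real.pi / 2) * (1 + m⁻¹) = Real.pi := by
      linear_combination Real.pi / 2 * hc
    have h3 : 1 + m⁻¹ ≠ 0 := by positivity
    exact mul_right_cancel₀ h3 (h1.trans h2.symm)
  have hc' : cpq M p q * (Real.pi / 2) * (1 + m⁻¹) = Real.pi := by
    linear_combination Real.pi / 2 * hc
  rw [hd] at d1 d2 d3 d4
  have e1 : x₁ = x₀ + cpq M p q * (Real.pi / 2) := by linarith
  have e2 : x₂ = x₀ + Real.pi := by linarith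
  have e3 : x₃ = x₀ + (Real.pi + cpq M p q * (Real.pi / 2)) := by linarith
  refine ⟨-x₀, hγ.periodic.ae_eq_of_ae_eq_on (gammaBar_shift_isWeight hM (-x₀)).periodic x₀ ?_⟩
  filter_upwards [r1, r2, r3, r4, hne x₀, hne x₁, hne x₂, hne x₃] with θ k1 k2 k3 k4 n0 n1 n2 n3 hθ
  rw [gammaBar, angle_eq_self (by linarith [hθ.1]) (by linarith [hθ.2]), gammaBase]
  have n0' : x₀ < θ := lt_of_le_of_ne hθ.1 (Ne.symm n0)
  split_ifs with c1 c2 c3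
  · exact k1 ⟨n0', by linarith⟩
  · exact k2 ⟨lt_of_le_of_ne (by linarith) (Ne.symm n1), by linarith⟩
  · exact k3 ⟨lt_of_le_of_ne (by linarith) (Ne.symm n2), by linarith⟩
  · exact k4 ⟨lt_of_le_of_ne (by linarith) (Ne.symm n3), hθ.2⟩

end GammaBar

/-! ### Gluing and the explicit solution -/

namespace IsPrimitive

variable {f g f₁ g₁ f₂ g₂ : ℝ → ℝ}

/-- Agreement at `t` excludes a jump, so both branches can be integrated from the common base point
`t`. -/
theorem ite_lt {t : ℝ} (h₁ : IsPrimitive f₁ g₁) (h₂ : IsPrimitive f₂ g₂) (ht : f₁ t = f₂ t) :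
    IsPrimitive (fun x => if x < t then f₁ x else f₂ x)
      (fun x => if x < t then g₁ x else g₂ x) := by
  have hi : LocallyIntegrable (fun x => if x < t then g₁ x else g₂ x) volume := by
    refine ((h₁.locallyIntegrable.indicator measurableSet_Iio (s := Set.Iio t)).add
      (h₂.locallyIntegrable.indicator measurableSet_Ici (s := Set.Ici t))).congr ?_
    refine Filter.Eventually.of_forall fun x => ?_
    by_cases hx : x < t
    · simp [hx]
    · simp [hx, not_lt.1 hx]
  have key : ∀ y, (if y < t then f₁ y else f₂ y) - f₂ t =
      ∫ x in t..y, if x < t then g₁ x else g₂ x := by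
    intro y
    have hne : ∀ᵐ x : ℝ, x ≠ t := by simp [ae_iff]
    rcases lt_or_ge y t with hy | hy
    · rw [if_pos hy, ← ht, h₁.sub_eq]
      refine intervalIntegral.integral_congr_ae ?_
      filter_upwards [hne] with x hx hxy
      rw [Set.uIoc_of_ge hy.le] at hxy
      rw [if_pos (lt_of_le_of_ne hxy.2 hx)]
    · rw [if_neg hy.not_gt, h₂.sub_eq]
      refine intervalIntegral.integral_congr_ae (Filter.Eventually.of_forall fun x hxy => ?_)
      rw [Set.uIoc_of_le hy] at hxy
      rw [if_neg hxy.1.not_gt]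
  refine ⟨hi, fun x y => ?_⟩
  have h3 := intervalIntegral.integral_add_adjacent_intervals
    (hi.intervalIntegrable_real t x) (hi.intervalIntegrable_real x y)
  rw [← key, ← key] at h3
  linarith

/-- Equal end values mean that the derivative has mean zero, so the primitive of its periodic
extension is periodic and agrees with `f` on `[0, 2π]`. -/
theorem comp_angle (h : IsPrimitive f g) (h0 : f (2 * Real.pi) = f 0) :
    IsPrimitive (fun θ => f (angle θ)) (fun θ => g (angle θ)) := by
  have hper : Function.Periodic (fun θ => g (angle θ)) (2 * Real.pi) := fun θ => by
    simp only [angle_add_two_pi]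
  have hang : ∀ᵐ θ : ℝ, θ ∈ Set.Ioc 0 (2 * Real.pi) → g (angle θ) = g θ := by
    have : ∀ᵐ x : ℝ, x ≠ 2 * Real.pi := by simp [ae_iff]
    filter_upwards [this] with x hx hx'
    rw [angle_eq_self hx'.1.le (lt_of_le_of_ne hx'.2 hx)]
  have hint : ∀ y ∈ Set.Icc 0 (2 * Real.pi),
      ∫ t in (0 : ℝ)..y, g (angle t) = ∫ t in (0 : ℝ)..y, g t := fun y hy => by
    refine intervalIntegral.integral_congr_ae (hang.mono fun x hx hxy => ?_)
    rw [Set.uIoc_of_le hy.1] at hxy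
    exact hx ⟨hxy.1, hxy.2.trans hy.2⟩
  have hi : LocallyIntegrable (fun θ => g (angle θ)) volume := by
    refine hper.aePeriodic.locallyIntegrable ((h.intervalIntegrable 0 (2 * Real.pi)).congr_ae ?_)
    rw [Set.uIoc_of_le Real.two_pi_pos.le]
    exact (ae_restrict_iff' measurableSet_Ioc).2 (hang.mono fun x hx hm => (hx hm).symm)
  have hP := IsPrimitive.of_locallyIntegrable hi (f 0) 0
  have hPper := hP.periodic hper.aePeriodic (by
    rw [hint _ ⟨Real.two_pi_pos.le, le_rfl⟩, ← h.sub_eq, h0, sub_self])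
  convert hP using 1
  ext θ
  have h1 := angle_mem θ
  have h2 : (fun y => f 0 + ∫ t in (0 : ℝ)..y, g (angle t)) (angle θ) =
      f 0 + ∫ t in (0 : ℝ)..θ, g (angle t) := by
    rw [angle_eq_add]
    exact hPper.int_mul _ θ
  rw [← h2]
  simp only
  rw [hint _ ⟨h1.1, h1.2.le⟩, ← h.sub_eq]
  ring

theorem comp_add_right (h : IsPrimitive f g) (c : ℝ) :
    IsPrimitive (fun θ => f (θ + c)) (fun θ => g (θ + c)) := by
  refine ⟨locallyIntegrable_of_intervalIntegrable fun x y => ?_, fun x y => ?_⟩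
  · have := (h.intervalIntegrable (x + c) (y + c)).comp_add_right c
    simpa using this
  · rw [intervalIntegral.integral_comp_add_right, h.sub_eq]

end IsPrimitive

/-- The flux `b w'` of the extremal function on `[0, 2π)`. -/
noncomputable def fluxBase (M p q θ : ℝ) : ℝ :=
  if θ < cpq M p q * (Real.pi / 2) then
    sqrtMu M p q / cpq M p q * Real.cos (sqrtMu M p q * ((cpq M p q)⁻¹ * θ - Real.pi / 4))
  else if θ < Real.pi then
    -(sqrtMu M p q / cpq M p q * M ^ ((p + q) / 4)) *
      Real.sin (sqrtMu M p q *
        (Real.pi / 2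
          + (cpq M p q)⁻¹ * M ^ ((p - q) / 2) * (θ - cpq M p q * (Real.pi / 2))
          - 3 * Real.pi / 4))
  else if θ < Real.pi + cpq M p q * (Real.pi / 2) then
    -(sqrtMu M p q / cpq M p q) *
      Real.cos (sqrtMu M p q * (Real.pi + (cpq M p q)⁻¹ * (θ - Real.pi) - 5 * Real.pi / 4))
  else
    (sqrtMu M p q / cpq M p q * M ^ ((p + q) / 4)) *
      Real.sin (sqrtMu M p q *
        (3 * Real.pi / 2
          + (cpq M p q)⁻¹ * M ^ ((p - q) / 2) * (θ - Real.pi - cpq M p q * (Real.pi / 2))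
          - 7 * Real.pi / 4))

section Extremal

variable {M p q : ℝ}

theorem sqrtMu_mul_pi_div_four (hM : 0 < M) :
    sqrtMu M p q * (Real.pi / 4) = Real.arctan (M ^ ((p + q) / 4))⁻¹ := by
  have := Real.pi_pos
  rw [sqrtMu, rpow_neg_eq_inv hM]
  field_simp

/-- `√μ` is chosen so that `tan (√μ π/4) = ℓ⁻¹`. This is the condition for the sine and cosine
pieces, and their fluxes, to match at every jump of the weight. -/
theorem sin_sqrtMu (hM : 0 < M) : M ^ ((p + q) / 4) * Real.sin (sqrtMu M p q * (Real.pi / 4)) =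
    Real.cos (sqrtMu M p q * (Real.pi / 4)) := by
  have hℓ : 0 < M ^ ((p + q) / 4) := Real.rpow_pos_of_pos hM _
  have hc := Real.cos_arctan_pos (M ^ ((p + q) / 4))⁻¹
  have ht := Real.tan_arctan (M ^ ((p + q) / 4))⁻¹
  rw [sqrtMu_mul_pi_div_four hM]
  rw [Real.tan_eq_sin_div_cos, div_eq_iff hc.ne'] at ht
  rw [ht]
  field_simp

/-- The arc on which the weight is `M` also corresponds to a parameter interval of length `π/2`. -/
theorem quarter_arg (hM : 0 < M) :
    (cpq M p q)⁻¹ * M ^ ((p - q) / 2) * (Real.pi - cpq M p q * (Real.pi / 2)) = Real.pi / 2 := by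
  have h := cpq_mul (p := p) (q := q) hM
  have hc := cpq_pos (p := p) (q := q) hM
  have hm : 0 < M ^ ((p - q) / 2) := Real.rpow_pos_of_pos hM _
  field_simp at h ⊢
  linarith

theorem hasDerivAt_sin_affine (μ k d s x : ℝ) (e : ℝ) :
    HasDerivAt (fun θ => e * Real.sin (μ * (d + k * (θ - s))))
      (e * (Real.cos (μ * (d + k * (x - s))) * (μ * k))) x := by
  have h := (((((hasDerivAt_id x).sub_const s).const_mul k).const_add d).const_mul μ).sin.const_mul e
  simpa using h

theorem hasDerivAt_cos_affine (μ k d s x : ℝ) (e : ℝ) :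
    HasDerivAt (fun θ => e * Real.cos (μ * (d + k * (θ - s))))
      (e * (-Real.sin (μ * (d + k * (x - s))) * (μ * k))) x := by
  have h := (((((hasDerivAt_id x).sub_const s).const_mul k).const_add d).const_mul μ).cos.const_mul e
  simpa using h

/-- On each arc the weights are constant and the pair is a rotated sine and cosine of frequency
given by `√μ`; the eigenvalue is `(√μ / c)²`. What remains is matching at the three interior jumps
and at the ends of the period. -/
theorem isPrimitive_wBase (hM : 0 < M) :
    IsPrimitive (wBase M p q) (fun θ => (gammaBase M p q θ ^ q)⁻¹ * fluxBase M p q θ) ∧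
      IsPrimitive (fluxBase M p q) (fun θ => -(sqrtMu M p q / cpq M p q) ^ 2 *
        (gammaBase M p q θ ^ p * wBase M p q θ)) ∧
      wBase M p q (2 * Real.pi) = wBase M p q 0 ∧
      fluxBase M p q (2 * Real.pi) = fluxBase M p q 0 := by
  have hπ := Real.pi_pos
  have hc := cpq_pos (p := p) (q := q) hM
  have hc2 := cpq_lt_two (p := p) (q := q) hM
  have hm : 0 < M ^ ((p - q) / 2) := Real.rpow_pos_of_pos hM _
  have hℓ : 0 < M ^ ((p + q) / 4) := Real.rpow_pos_of_pos hM _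
  have hsin := sin_sqrtMu (p := p) (q := q) hM
  have hquarter := quarter_arg (p := p) (q := q) hM
  have hMp : M ^ p = M ^ ((p - q) / 2) * (M ^ ((p + q) / 4)) ^ 2 := by
    rw [rpow_sq hM]; exact rpow_eq_mul hM
  have hMq : (M ^ q)⁻¹ = M ^ ((p - q) / 2) / (M ^ ((p + q) / 4)) ^ 2 := by
    rw [rpow_sq hM]; exact rpow_inv_eq_div hM
  have hcπ := mul_pos hc hπ
  have hcπ2 := mul_lt_mul_of_pos_right hc2 hπ
  unfold wBase fluxBase gammaBase
  simp only [rpow_neg_eq_inv hM]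
  obtain ⟨c, hcdef⟩ : ∃ c, c = cpq M p q := ⟨_, rfl⟩
  obtain ⟨μ, hμ⟩ : ∃ μ, μ = sqrtMu M p q := ⟨_, rfl⟩
  obtain ⟨m, hmdef⟩ : ∃ m, m = M ^ ((p - q) / 2) := ⟨_, rfl⟩
  obtain ⟨ℓ, hℓdef⟩ : ∃ ℓ, ℓ = M ^ ((p + q) / 4) := ⟨_, rfl⟩
  rw [← hcdef] at hc hc2 hquarter hcπ hcπ2
  rw [← hmdef] at hm hquarter hMp hMq
  rw [← hℓdef] at hℓ hsin hMp hMq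
  rw [← hμ] at hsin
  simp only [← hcdef, ← hμ, ← hmdef, ← hℓdef]
  -- The phases of the pieces at their ends are all `±π/4`, so every matching condition is an
  -- instance of `sin_sqrtMu`.
  have a1 : c⁻¹ * (c * (Real.pi / 2)) - Real.pi / 4 = Real.pi / 4 := by field_simp; ring
  have a2 : Real.pi / 2 + c⁻¹ * m * (c * (Real.pi / 2) - c * (Real.pi / 2)) - 3 * Real.pi / 4 =
    -(Real.pi / 4) := by ring
  have a3 : Real.pi / 2 + c⁻¹ * m * (Real.pi - c * (Real.pi / 2)) - 3 * Real.pi / 4 =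
    Real.pi / 4 := by rw [hquarter]; ring
  have a4 : Real.pi + c⁻¹ * (Real.pi - Real.pi) - 5 * Real.pi / 4 = -(Real.pi / 4) := by ring
  have a5 : Real.pi + c⁻¹ * (Real.pi + c * (Real.pi / 2) - Real.pi) - 5 * Real.pi / 4 =
    Real.pi / 4 := by field_simp; ring
  have a6 : 3 * Real.pi / 2 + c⁻¹ * m * (Real.pi + c * (Real.pi / 2) - Real.pi -
    c * (Real.pi / 2)) - 7 * Real.pi / 4 = -(Real.pi / 4) := by ring
  have a7 : 3 * Real.pi / 2 + c⁻¹ * m * (2 * Real.pi - Real.pi - c * (Real.pi / 2)) -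
      7 * Real.pi / 4 = Real.pi / 4 := by
    rw [show 2 * Real.pi - Real.pi - c * (Real.pi / 2) = Real.pi - c * (Real.pi / 2) by ring,
      hquarter]
    ring
  have a8 : c⁻¹ * 0 - Real.pi / 4 = -(Real.pi / 4) := by ring
  have hsin' : Real.sin (μ * (Real.pi / 4)) = ℓ⁻¹ * Real.cos (μ * (Real.pi / 4)) := by
    rw [← hsin]; field_simp
  have s1 := fun e x => hasDerivAt_sin_affine μ c⁻¹ (-(Real.pi / 4)) 0 x e
  have c1 := fun e x => hasDerivAt_cos_affine μ c⁻¹ (-(Real.pi / 4)) 0 x e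
  have s2 := fun e x => hasDerivAt_sin_affine μ (c⁻¹ * m) (Real.pi / 2 - 3 * Real.pi / 4)
    (c * (Real.pi / 2)) x e
  have c2 := fun e x => hasDerivAt_cos_affine μ (c⁻¹ * m) (Real.pi / 2 - 3 * Real.pi / 4)
    (c * (Real.pi / 2)) x e
  have s3 := fun e x => hasDerivAt_sin_affine μ c⁻¹ (Real.pi - 5 * Real.pi / 4) Real.pi x e
  have c3 := fun e x => hasDerivAt_cos_affine μ c⁻¹ (Real.pi - 5 * Real.pi / 4) Real.pi x e
  have s4 := fun e x => hasDerivAt_sin_affine μ (c⁻¹ * m) (3 * Real.pi / 2 - 7 * Real.pi / 4)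
    (Real.pi + c * (Real.pi / 2)) x e
  have c4 := fun e x => hasDerivAt_cos_affine μ (c⁻¹ * m) (3 * Real.pi / 2 - 7 * Real.pi / 4)
    (Real.pi + c * (Real.pi / 2)) x e
  have b1 : ∀ x, -(Real.pi / 4) + c⁻¹ * (x - 0) = c⁻¹ * x - Real.pi / 4 := fun x => by ring
  have b2 : ∀ x, Real.pi / 2 - 3 * Real.pi / 4 + c⁻¹ * m * (x - c * (Real.pi / 2)) =
    Real.pi / 2 + c⁻¹ * m * (x - c * (Real.pi / 2)) - 3 * Real.pi / 4 := fun x => by ring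
  have b3 : ∀ x, Real.pi - 5 * Real.pi / 4 + c⁻¹ * (x - Real.pi) =
    Real.pi + c⁻¹ * (x - Real.pi) - 5 * Real.pi / 4 := fun x => by ring
  have b4 : ∀ x, 3 * Real.pi / 2 - 7 * Real.pi / 4 + c⁻¹ * m *
    (x - (Real.pi + c * (Real.pi / 2))) =
    3 * Real.pi / 2 + c⁻¹ * m * (x - Real.pi - c * (Real.pi / 2)) - 7 * Real.pi / 4 :=
    fun x => by ring
  simp only [b1] at s1 c1
  simp only [b2] at s2 c2
  simp only [b3] at s3 c3
  simp only [b4] at s4 c4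
  have n1 : ¬ (2 * Real.pi < c * (Real.pi / 2)) := by linarith
  have n2 : ¬ (2 * Real.pi < Real.pi) := by linarith
  have n3 : ¬ (2 * Real.pi < Real.pi + c * (Real.pi / 2)) := by linarith
  have n4 : 0 < c * (Real.pi / 2) := by linarith
  have n5 : c * (Real.pi / 2) < Real.pi := by linarith
  have n6 : Real.pi < Real.pi + c * (Real.pi / 2) := by linarith
  refine ⟨?_, ?_, ?_, ?_⟩
  · have := (IsPrimitive.of_hasDerivAt (s1 1) (by fun_prop)).ite_lt (t := c * (Real.pi / 2))
      ((IsPrimitive.of_hasDerivAt (c2 ℓ⁻¹) (by fun_prop)).ite_lt (t := Real.pi)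
        ((IsPrimitive.of_hasDerivAt (s3 (-1)) (by fun_prop)).ite_lt
          (t := Real.pi + c * (Real.pi / 2)) (IsPrimitive.of_hasDerivAt (c4 (-ℓ⁻¹)) (by fun_prop))
          (by rw [a5, a6, mul_neg, Real.cos_neg, hsin']; ring))
        (by rw [if_pos n6, a3, a4, mul_neg, Real.sin_neg, hsin']; ring))
      (by rw [if_pos n5, a1, a2, mul_neg, Real.cos_neg, hsin']; ring)
    convert this using 1
    · ext θ
      split_ifs <;> ring
    · ext θ
      split_ifs
      · rw [Real.one_rpow]; field_simp
      · rw [hMq]; field_simp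
      · rw [Real.one_rpow]; field_simp
      · rw [hMq]; field_simp
  · have := (IsPrimitive.of_hasDerivAt (c1 (μ / c)) (by fun_prop)).ite_lt (t := c * (Real.pi / 2))
      ((IsPrimitive.of_hasDerivAt (s2 (-(μ / c * ℓ))) (by fun_prop)).ite_lt (t := Real.pi)
        ((IsPrimitive.of_hasDerivAt (c3 (-(μ / c))) (by fun_prop)).ite_lt
          (t := Real.pi + c * (Real.pi / 2))
          (IsPrimitive.of_hasDerivAt (s4 (μ / c * ℓ)) (by fun_prop))
          (by rw [a5, a6, mul_neg, Real.sin_neg, ← hsin]; ring))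
        (by rw [if_pos n6, a3, a4, mul_neg, Real.cos_neg, ← hsin]; ring))
      (by rw [if_pos n5, a1, a2, mul_neg, Real.sin_neg, ← hsin]; ring)
    convert this using 1
    ext θ
    split_ifs
    · rw [Real.one_rpow]; field_simp
    · rw [hMp]; field_simp
    · rw [Real.one_rpow]; field_simp
    · rw [hMp]; field_simp
  · rw [if_neg n1, if_neg n2, if_neg n3, if_pos n4, a7, a8, mul_neg, Real.sin_neg, hsin']
  · rw [if_neg n1, if_neg n2, if_neg n3, if_pos n4, a7, a8, mul_neg, Real.cos_neg, ← hsin]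
    ring

theorem wBar_shift_isPeriodicSol (hM : 0 < M) (φ : ℝ) :
    IsPeriodicSol (fun θ => gammaBar M p q (θ + φ) ^ p) (fun θ => gammaBar M p q (θ + φ) ^ q)
      ((sqrtMu M p q / cpq M p q) ^ 2) (fun θ => wBar M p q (θ + φ))
      (fun θ => fluxBase M p q (angle (θ + φ))) := by
  obtain ⟨h1, h2, h3, h4⟩ := isPrimitive_wBase (p := p) (q := q) hM
  refine ⟨⟨(h1.comp_angle h3).comp_add_right φ, (h2.comp_angle h4).comp_add_right φ⟩,
    fun θ => ?_, fun θ => ?_⟩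
  · simp only [wBar]
    rw [show θ + 2 * Real.pi + φ = θ + φ + 2 * Real.pi by ring, angle_add_two_pi]
  · rw [show θ + 2 * Real.pi + φ = θ + φ + 2 * Real.pi by ring, angle_add_two_pi]

theorem base_zero (hM : 0 < M) :
    wBase M p q 0 = -Real.sin (sqrtMu M p q * (Real.pi / 4)) ∧
      fluxBase M p q 0 = sqrtMu M p q / cpq M p q * Real.cos (sqrtMu M p q * (Real.pi / 4)) := by
  have h : 0 < cpq M p q * (Real.pi / 2) :=
    mul_pos (cpq_pos hM) (by linarith [Real.pi_pos])
  rw [wBase, fluxBase, if_pos h, if_pos h, mul_zero, zero_sub, mul_neg, Real.sin_neg, Real.cos_neg]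
  exact ⟨rfl, rfl⟩

theorem sin_sqrtMu_pos (hM : 0 < M) : 0 < Real.sin (sqrtMu M p q * (Real.pi / 4)) := by
  have hℓ : 0 < M ^ ((p + q) / 4) := Real.rpow_pos_of_pos hM _
  have h := sin_sqrtMu (p := p) (q := q) hM
  have hc : 0 < Real.cos (sqrtMu M p q * (Real.pi / 4)) := by
    rw [sqrtMu_mul_pi_div_four hM]
    exact Real.cos_arctan_pos _
  rw [← h] at hc
  exact (mul_pos_iff_of_pos_left hℓ).1 hc

end Extremal

/-! ### Best constant and extremals for the step weight -/

theorem IsPeriodicSol.const_mul {a b w U : ℝ → ℝ} {lam : ℝ} (h : IsPeriodicSol a b lam w U)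
    (c : ℝ) : IsPeriodicSol a b lam (fun x => c * w x) (fun x => c * U x) :=
  ⟨⟨(h.left.const_mul c).congr_ae (Filter.Eventually.of_forall fun x => by simp only; ring),
    (h.right.const_mul c).congr_ae (Filter.Eventually.of_forall fun x => by simp only; ring)⟩,
    fun x => by simp only [h.periodic_left x], fun x => by simp only [h.periodic_right x]⟩

theorem wirtingerConstants_subset_of_ae_eq {a b a' b' : ℝ → ℝ} (ha : a =ᵐ[volume] a')
    (hb : b =ᵐ[volume] b') : wirtingerConstants a b ⊆ wirtingerConstants a' b' := by
  intro C hC w v h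
  have h1 := hC w v ⟨h.memH1Loc, h.periodic, by
    refine Eq.trans ?_ h.constraint
    exact intervalIntegral.integral_congr_ae (ha.mono fun x hx _ => by rw [hx])⟩
  rwa [intervalIntegral.integral_congr_ae (ha.mono fun x hx _ => by rw [hx]),
    intervalIntegral.integral_congr_ae (f := fun θ => b θ * v θ ^ 2)
      (hb.mono fun x hx _ => by rw [hx])] at h1

theorem bestConst_congr_ae {a b a' b' : ℝ → ℝ} (ha : a =ᵐ[volume] a') (hb : b =ᵐ[volume] b') :
    bestConst a b = bestConst a' b' :=
  congrArg sInf ((wirtingerConstants_subset_of_ae_eq ha hb).antisymm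
    (wirtingerConstants_subset_of_ae_eq ha.symm hb.symm))

theorem wirtingerBound_congr_ae {M p q : ℝ} {γ γ' : ℝ → ℝ} (h : γ =ᵐ[volume] γ') :
    wirtingerBound M p q γ = wirtingerBound M p q γ' := by
  unfold wirtingerBound
  rw [intervalIntegral.integral_congr_ae (h.mono fun x hx _ => by rw [hx])]

/-- Carries a sign known almost everywhere on an arc to its end points, where the weight jumps. -/
theorem nonneg_of_ae_nonneg_Ioo {f : ℝ → ℝ} (hf : Continuous f) {u v : ℝ} (huv : u < v)
    (h : ∀ᵐ x, x ∈ Set.Ioo u v → 0 ≤ f x) : ∀ x ∈ Set.Icc u v, 0 ≤ f x := by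
  have h1 : f =ᵐ[volume.restrict (Set.Ioo u v)] fun x => |f x| :=
    (ae_restrict_iff' measurableSet_Ioo).2 (h.mono fun x hx hm => (abs_of_nonneg (hx hm)).symm)
  have h2 := (Measure.eqOn_open_of_ae_eq h1 isOpen_Ioo hf.continuousOn hf.abs.continuousOn).closure
    hf hf.abs
  rw [closure_Ioo huv.ne] at h2
  intro x hx
  rw [h2 hx]
  exact abs_nonneg _

section StepWeight

variable {M p q : ℝ}

theorem integral_gammaBar_shift (hM : 0 < M) (φ : ℝ) :
    ∫ θ in (0 : ℝ)..2 * Real.pi, gammaBar M p q (θ + φ) ^ ((p - q) / 2) =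
      2 * Real.pi * cpq M p q := by
  have hπ := Real.pi_pos
  have hc := cpq_pos (p := p) (q := q) hM
  have hc2 := cpq_lt_two (p := p) (q := q) hM
  have hquarter := quarter_arg (p := p) (q := q) hM
  have hcπ := mul_pos hc hπ
  have hcπ2 := mul_lt_mul_of_pos_right hc2 hπ
  have hper : Function.Periodic (fun θ => gammaBar M p q θ ^ ((p - q) / 2)) (2 * Real.pi) :=
    fun θ => by simp only [gammaBar_periodic θ]
  rw [intervalIntegral.integral_comp_add_right
    (f := fun θ => gammaBar M p q θ ^ ((p - q) / 2)), zero_add, add_comm (2 * Real.pi) φ,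
    hper.intervalIntegral_add_eq φ 0, zero_add]
  have h1 : ∫ θ in (0 : ℝ)..2 * Real.pi, gammaBar M p q θ ^ ((p - q) / 2) =
      ∫ θ in (0 : ℝ)..2 * Real.pi, gammaBase M p q θ ^ ((p - q) / 2) := by
    have hne : ∀ᵐ x : ℝ, x ≠ 2 * Real.pi := by simp [ae_iff]
    refine intervalIntegral.integral_congr_ae (hne.mono fun x hx hxy => ?_)
    rw [Set.uIoc_of_le Real.two_pi_pos.le] at hxy
    rw [gammaBar, angle_eq_self hxy.1.le (lt_of_le_of_ne hxy.2 hx)]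
  rw [h1]
  unfold gammaBase
  obtain ⟨c, hcdef⟩ : ∃ c, c = cpq M p q := ⟨_, rfl⟩
  obtain ⟨m, hm⟩ : ∃ m, m = M ^ ((p - q) / 2) := ⟨_, rfl⟩
  rw [← hcdef, ← hm] at hquarter
  rw [← hcdef] at hc hc2 hcπ hcπ2
  have hlin : ∀ k s d : ℝ, IsPrimitive (fun x => d + k * (x - s)) fun _ => k := fun k s d =>
    .of_hasDerivAt (fun x => by
      simpa using (((hasDerivAt_id x).sub_const s).const_mul k).const_add d) continuous_const
  -- A continuous piecewise linear primitive with slopes `1, m, 1, m`. The offsets make the pieces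
  -- meet; each half period contributes `cπ`, because `m (2 - c) = c`.
  have hF := (hlin 1 0 0).ite_lt (t := c * (Real.pi / 2))
    ((hlin m (c * (Real.pi / 2)) (c * (Real.pi / 2))).ite_lt (t := Real.pi)
      ((hlin 1 Real.pi (c * Real.pi)).ite_lt (t := Real.pi + c * (Real.pi / 2))
        (hlin m (Real.pi + c * (Real.pi / 2)) (c * Real.pi + c * (Real.pi / 2))) (by ring))
      (by
        rw [if_pos (by linarith)]
        field_simp at hquarter ⊢
        linarith))
    (by rw [if_pos (by linarith)]; ring)
  have h2 := hF.sub_eq 0 (2 * Real.pi)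
  rw [if_neg (by linarith), if_neg (by linarith), if_neg (by linarith), if_pos (by linarith)] at h2
  rw [← hcdef]
  have h3 : (fun θ => (if θ < c * (Real.pi / 2) then 1 else if θ < Real.pi then M
      else if θ < Real.pi + c * (Real.pi / 2) then 1 else M) ^ ((p - q) / 2)) =
      fun θ => if θ < c * (Real.pi / 2) then 1 else if θ < Real.pi then m
      else if θ < Real.pi + c * (Real.pi / 2) then 1 else m := by
    ext θ
    split_ifs <;> simp [hm]
  rw [h3, ← h2]
  field_simp at hquarter
  linear_combination (Real.pi / 2) * hquarter

theorem sqrtMu_pos (hM : 0 < M) : 0 < sqrtMu M p q :=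
  mul_pos (by have := Real.pi_pos; positivity) (Real.arctan_pos.2 (Real.rpow_pos_of_pos hM _))

theorem wirtingerBound_gammaBar (hM : 0 < M) (φ : ℝ) :
    wirtingerBound M p q (fun θ => gammaBar M p q (θ + φ)) =
      ((sqrtMu M p q / cpq M p q) ^ 2)⁻¹ := by
  have hπ := Real.pi_pos
  have hμ := sqrtMu_pos (p := p) (q := q) hM
  have hc := cpq_pos (p := p) (q := q) hM
  have h : sqrtMu M p q = 4 / Real.pi * Real.arctan (M ^ (-(p + q) / 4)) := rfl
  rw [wirtingerBound, integral_gammaBar_shift hM, ← h, ← inv_pow]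
  congr 1
  field_simp

theorem bestConst_gammaBar (hM : 1 < M) (hpq : 0 ≤ p + q) (φ : ℝ) :
    bestConst (fun θ => gammaBar M p q (θ + φ) ^ p) (fun θ => gammaBar M p q (θ + φ) ^ q) =
      ((sqrtMu M p q / cpq M p q) ^ 2)⁻¹ := by
  have hM0 := one_pos.trans hM
  have hw := gammaBar_shift_isWeight (p := p) (q := q) hM φ
  have hν := div_pos (sqrtMu_pos (p := p) (q := q) hM0) (cpq_pos (p := p) (q := q) hM0)
  refine le_antisymm ?_ ?_
  · rw [← wirtingerBound_gammaBar hM0 φ]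
    exact bestConst_le_wirtingerBound hM hpq hw
      (Filter.Eventually.of_forall fun θ => gammaBar_bounds hM _)
  · refine (wBar_shift_isPeriodicSol hM0 φ).inv_le_bestConst (hw.rpow p) (hw.rpow q) (by positivity)
      (x := -φ) ?_
    rw [neg_add_cancel, wBar, angle_eq_self le_rfl Real.two_pi_pos, (base_zero hM0).1]
    exact neg_ne_zero.2 (sin_sqrtMu_pos hM0).ne'

/-- At an upward jump of the Prüfer speed pattern the phase is `-π/4` modulo `π`. -/
theorem flux_eq_at_jump {W U : ℝ → ℝ} {φ x₁ : ℝ} (hM : 1 < M) (hpq : 0 < p + q)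
    (h : IsPeriodicSol (fun θ => gammaBar M p q (θ + φ) ^ p)
      (fun θ => gammaBar M p q (θ + φ) ^ q) ((sqrtMu M p q / cpq M p q) ^ 2) W U)
    (hx₁ : W x₁ ≠ 0) :
    U (-φ) = -(sqrtMu M p q / cpq M p q * M ^ ((p + q) / 4) * W (-φ)) := by
  have hM0 := one_pos.trans hM
  have hπ := Real.pi_pos
  have hc := cpq_pos (p := p) (q := q) hM0
  have hc2 := cpq_lt_two (p := p) (q := q) hM0
  have hcπ := mul_pos hc hπ
  have hcπ2 := mul_lt_mul_of_pos_right hc2 hπ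
  have hw := gammaBar_shift_isWeight (p := p) (q := q) hM φ
  have hb : ∀ᵐ θ : ℝ, 1 ≤ gammaBar M p q (θ + φ) ∧ gammaBar M p q (θ + φ) ≤ M :=
    Filter.Eventually.of_forall fun θ => gammaBar_bounds hM _
  have hν := div_pos (sqrtMu_pos (p := p) (q := q) hM0) hc
  have hℓ : 1 ≤ M ^ ((p + q) / 4) := Real.one_le_rpow hM.le (by linarith)
  have hβ := rpow_half_bounds hM hpq.le hb
  have hσ := hw.rpow ((p - q) / 2)
  obtain ⟨ψ, r, hψ, hr, hU, hW⟩ := exists_isPrueferAngle_of_isPeriodicSol hM hpq.le hw hb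
    (pow_pos hν 2) h hx₁
  rw [Real.sqrt_sq hν.le] at hψ hW
  have heq : sqrtMu M p q / cpq M p q *
      ∫ θ in (0 : ℝ)..2 * Real.pi, gammaBar M p q (θ + φ) ^ ((p - q) / 2) =
      8 * Real.arctan (M ^ ((p + q) / 4))⁻¹ := by
    rw [integral_gammaBar_shift hM0, sqrtMu, rpow_neg_eq_inv hM0]
    field_simp
    ring
  have hmono := hψ.strictMono hσ hν hℓ hβ
  have hcont := hψ.isPrimitive.continuous
  have hs : 0 < (p + q) / 2 := by positivity
  have hMs : 1 < M ^ ((p + q) / 2) := Real.one_lt_rpow hM hs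
  -- The weight is `1` just to the right of `-φ` and `M` just to the left. Since maximal speed
  -- dictates the weight wherever `cos 2ψ ≠ 0`, this gives `cos 2ψ ≥ 0` on the right and `≤ 0` on
  -- the left, hence `0` at the jump.
  have hright : ∀ᵐ θ, θ ∈ Set.Ioo (-φ) (-φ + cpq M p q * (Real.pi / 2)) →
      0 ≤ Real.cos (2 * ψ θ) := by
    filter_upwards [hψ.ae_eq_sq hσ hν hℓ hβ heq] with θ h1 hθ
    by_contra hneg
    rw [Real.cos_two_mul'] at hneg
    have h2 := h1 (by linarith)
    rw [gammaBar, angle_eq_self (by linarith [hθ.1]) (by linarith [hθ.2]),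
      gammaBase_eq_one_left (by linarith [hθ.2]), Real.one_rpow, rpow_sq hM0] at h2
    linarith
  have hleft : ∀ᵐ θ, θ ∈ Set.Ioo (-φ - (Real.pi - cpq M p q * (Real.pi / 2))) (-φ) →
      0 ≤ -Real.cos (2 * ψ θ) := by
    filter_upwards [hψ.ae_eq_one hσ hν hℓ hβ heq] with θ h1 hθ
    by_contra hneg
    rw [Real.cos_two_mul'] at hneg
    have h2 := h1 (by linarith)
    rw [← gammaBar_periodic, gammaBar, angle_eq_self (by linarith [hθ.1]) (by linarith [hθ.2]),
      gammaBase_eq_right hM0 (by linarith [hθ.1])] at h2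
    linarith
  have hcc : Continuous fun θ => Real.cos (2 * ψ θ) := by fun_prop
  have hright' := nonneg_of_ae_nonneg_Ioo hcc (by linarith) hright
  have hleft' : 0 ≤ -Real.cos (2 * ψ (-φ)) :=
    nonneg_of_ae_nonneg_Ioo hcc.neg (by linarith) hleft (-φ) ⟨by linarith, le_rfl⟩
  have hzero : Real.cos (2 * ψ (-φ)) = 0 :=
    le_antisymm (by linarith) (hright' _ ⟨le_rfl, by linarith⟩)
  have hzero' := hzero
  rw [Real.cos_two_mul'] at hzero'
  have hfac : (Real.cos (ψ (-φ)) - Real.sin (ψ (-φ))) * (Real.cos (ψ (-φ)) + Real.sin (ψ (-φ))) =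
      0 := by linear_combination hzero'
  rw [hU, hW]
  rcases mul_eq_zero.1 hfac with h1 | h1
  -- Here `sin 2ψ = 1` at the jump, and since `ψ` increases, `cos 2ψ` would become negative
  -- immediately to the right.
  · exfalso
    obtain ⟨θ, hθ1, hθ2⟩ : ∃ θ ∈ Set.Ioo (-φ) (-φ + cpq M p q * (Real.pi / 2)),
        ψ θ < ψ (-φ) + Real.pi / 2 := by
      have e1 : ∀ᶠ θ in nhdsWithin (-φ) (Set.Ioi (-φ)), ψ θ < ψ (-φ) + Real.pi / 2 :=
        (hcont.tendsto (-φ)).mono_left nhdsWithin_le_nhds |>.eventually_lt_const (by linarith)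
      have e2 : Set.Ioo (-φ) (-φ + cpq M p q * (Real.pi / 2)) ∈
          nhdsWithin (-φ) (Set.Ioi (-φ)) := Ioo_mem_nhdsGT (by linarith)
      obtain ⟨θ, h1, h2⟩ := (e1.and e2).exists
      exact ⟨θ, h2, h1⟩
    have e1 := hmono hθ1.1
    have e2 := hright' θ ⟨hθ1.1.le, hθ1.2.le⟩
    have e3 : 0 < Real.sin (2 * (ψ θ - ψ (-φ))) :=
      Real.sin_pos_of_pos_of_lt_pi (by linarith) (by linarith)
    rw [show 2 * ψ θ = 2 * ψ (-φ) + 2 * (ψ θ - ψ (-φ)) by ring, Real.cos_add, hzero,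
      Real.sin_two_mul] at e2
    have e4 := Real.sin_sq_add_cos_sq (ψ (-φ))
    have e5 : 2 * Real.sin (ψ (-φ)) * Real.cos (ψ (-φ)) = 1 := by
      linear_combination e4 - h1 * (Real.cos (ψ (-φ)) - Real.sin (ψ (-φ)))
    rw [e5] at e2
    linarith
  · linear_combination r (-φ) * h1

theorem isExtremal_gammaBar_iff (hM : 1 < M) (hpq : 0 < p + q) (φ : ℝ) (w : ℝ → ℝ) :
    IsExtremal (fun θ => gammaBar M p q (θ + φ) ^ p) (fun θ => gammaBar M p q (θ + φ) ^ q) w ↔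
      ∃ C : ℝ, C ≠ 0 ∧ ∀ᵐ θ : ℝ, w θ = C * wBar M p q (θ + φ) := by
  have hM0 := one_pos.trans hM
  have hw := gammaBar_shift_isWeight (p := p) (q := q) hM φ
  have hsol := wBar_shift_isPeriodicSol (p := p) (q := q) hM0 φ
  obtain ⟨hw0, hU0⟩ := base_zero (p := p) (q := q) hM0
  have hsinpos := sin_sqrtMu_pos (p := p) (q := q) hM0
  have hbar0 : wBar M p q (-φ + φ) = wBase M p q 0 := by
    rw [neg_add_cancel, wBar, angle_eq_self le_rfl Real.two_pi_pos]
  have hne : wBase M p q 0 ≠ 0 := by rw [hw0]; exact neg_ne_zero.2 hsinpos.ne'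
  rw [isExtremal_iff (hw.rpow p) (hw.rpow q), bestConst_gammaBar hM hpq.le, inv_inv]
  constructor
  · rintro ⟨W, U, hW, h, x, hx⟩
    have hjump := flux_eq_at_jump hM hpq h hx
    -- Matching the value at the jump also matches the flux, since both solutions have the same
    -- ratio `U / W` there; uniqueness does the rest.
    obtain ⟨C, hC⟩ : ∃ C, C = W (-φ) / wBase M p q 0 := ⟨_, rfl⟩
    have hCW : W (-φ) = C * wBase M p q 0 := by rw [hC]; field_simp
    have hdiff := h.toIsSol.sub_const_mul hsol.toIsSol C
    have hz := hdiff.eq_zero (hw.rpow p) (hw.rpow q) (x₀ := -φ)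
      (by simp only [hbar0]; linarith) (by
        simp only [neg_add_cancel]
        rw [angle_eq_self le_rfl Real.two_pi_pos, hjump, hCW, hU0, hw0, ← sin_sqrtMu hM0]
        ring)
    have hWC : ∀ θ, W θ = C * wBar M p q (θ + φ) := fun θ => by linarith [(hz θ).1]
    refine ⟨C, fun hC0 => hx ?_, hW.mono fun θ hθ => hθ.trans (hWC θ)⟩
    rw [hWC, hC0, zero_mul]
  · rintro ⟨C, hC, hCw⟩
    refine ⟨_, _, hCw, hsol.const_mul C, -φ, ?_⟩
    rw [hbar0]
    exact mul_ne_zero hC hne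

end StepWeight

/-! ### The case `p + q = 0` -/

section Critical

variable {M p q : ℝ} {γ : ℝ → ℝ}

/-- Here `1/b = a = γ^p`, so in the variable `∫ γ^p` the system is the harmonic oscillator; this
frequency makes one period of the weight exactly one turn. -/
theorem cos_isPeriodicSol (hpq : p + q = 0) (hγ : IsWeight γ) (φ : ℝ) :
    IsPeriodicSol (fun θ => γ θ ^ p) (fun θ => γ θ ^ q)
      ((2 * Real.pi / ∫ t in (0 : ℝ)..2 * Real.pi, γ t ^ p) ^ 2)
      (fun θ => Real.cos (2 * Real.pi / (∫ t in (0 : ℝ)..2 * Real.pi, γ t ^ p) *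
        (∫ t in (0 : ℝ)..θ, γ t ^ p) + φ))
      (fun θ => -(2 * Real.pi / ∫ t in (0 : ℝ)..2 * Real.pi, γ t ^ p) *
        Real.sin (2 * Real.pi / (∫ t in (0 : ℝ)..2 * Real.pi, γ t ^ p) *
        (∫ t in (0 : ℝ)..θ, γ t ^ p) + φ)) := by
  have hp := hγ.rpow p
  have hI := hp.integral_pos
  set I := ∫ t in (0 : ℝ)..2 * Real.pi, γ t ^ p
  have hS : IsPrimitive (fun θ => 2 * Real.pi / I * (∫ t in (0 : ℝ)..θ, γ t ^ p) + φ)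
      fun θ => 2 * Real.pi / I * γ θ ^ p := by
    have := ((IsPrimitive.of_locallyIntegrable hp.locallyIntegrable 0 0).const_mul
      (2 * Real.pi / I)).add_const φ
    simpa only [zero_add] using this
  have hper : ∀ θ, 2 * Real.pi / I * (∫ t in (0 : ℝ)..θ + 2 * Real.pi, γ t ^ p) + φ =
      2 * Real.pi / I * (∫ t in (0 : ℝ)..θ, γ t ^ p) + φ + 2 * Real.pi := fun θ => by
    have h1 := hS.sub_eq θ (θ + 2 * Real.pi)
    rw [intervalIntegral.integral_const_mul, hp.periodic.intervalIntegral_eq,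
      div_mul_cancel₀ _ hI.ne'] at h1
    linarith
  refine ⟨⟨(hS.comp Real.hasDerivAt_cos (by fun_prop)).congr_ae ?_,
    ((hS.comp Real.hasDerivAt_sin Real.continuous_cos).const_mul (-(2 * Real.pi / I))).congr_ae
      (Filter.Eventually.of_forall fun θ => by simp only; ring)⟩,
    fun θ => by simp only [hper, Real.cos_add_two_pi],
    fun θ => by simp only [hper, Real.sin_add_two_pi]⟩
  filter_upwards [hγ.ae_pos] with θ hθ
  rw [← Real.rpow_neg hθ.le, show -q = p by linarith]
  ring

/-- Now `ℓ = 1` and `arctan 1 = π/4`, so the denominator of the bound is `1`. -/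
theorem wirtingerBound_of_add_eq_zero (hpq : p + q = 0) :
    wirtingerBound M p q γ =
      ((2 * Real.pi / ∫ t in (0 : ℝ)..2 * Real.pi, γ t ^ p) ^ 2)⁻¹ := by
  have hπ := Real.pi_pos
  rw [wirtingerBound, hpq, show (p - q) / 2 = p by linarith]
  simp only [neg_zero, zero_div, Real.rpow_zero, Real.arctan_one]
  rw [← inv_pow, inv_div]
  congr 1
  field_simp

theorem bestConst_of_add_eq_zero (hM : 1 < M) (hpq : p + q = 0) (hγ : IsWeight γ)
    (hγM : ∀ᵐ θ, 1 ≤ γ θ ∧ γ θ ≤ M) :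
    bestConst (fun θ => γ θ ^ p) (fun θ => γ θ ^ q) = wirtingerBound M p q γ := by
  refine le_antisymm (bestConst_le_wirtingerBound hM hpq.ge hγ hγM) ?_
  rw [wirtingerBound_of_add_eq_zero hpq]
  have hI := (hγ.rpow p).integral_pos
  have hπ := Real.pi_pos
  refine (cos_isPeriodicSol hpq hγ 0).inv_le_bestConst (hγ.rpow p) (hγ.rpow q) (by positivity)
    (x := 0) ?_
  simp

theorem isExtremal_of_add_eq_zero_iff (hM : 1 < M) (hpq : p + q = 0) (hγ : IsWeight γ)
    (hγM : ∀ᵐ θ, 1 ≤ γ θ ∧ γ θ ≤ M) (w : ℝ → ℝ) :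
    IsExtremal (fun θ => γ θ ^ p) (fun θ => γ θ ^ q) w ↔
      ∃ C φ : ℝ, C ≠ 0 ∧ ∀ᵐ θ : ℝ,
        w θ = C * Real.cos (2 * Real.pi / (∫ t in (0 : ℝ)..2 * Real.pi, γ t ^ p) *
          (∫ t in (0 : ℝ)..θ, γ t ^ p) + φ) := by
  have hp := hγ.rpow p
  have hI := hp.integral_pos
  have hπ := Real.pi_pos
  rw [isExtremal_iff hp (hγ.rpow q), bestConst_of_add_eq_zero hM hpq hγ hγM,
    wirtingerBound_of_add_eq_zero hpq, inv_inv]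
  have hsol := cos_isPeriodicSol hpq hγ
  obtain ⟨ω, hω⟩ : ∃ ω, ω = 2 * Real.pi / ∫ t in (0 : ℝ)..2 * Real.pi, γ t ^ p := ⟨_, rfl⟩
  have hω0 : 0 < ω := by rw [hω]; positivity
  rw [← hω] at hsol ⊢
  constructor
  · rintro ⟨W, U, hW, h, x, hx⟩
    -- Amplitude and phase are read off from the initial value and flux at `0`; every initial
    -- condition is realized by some cosine.
    obtain ⟨φ, h1, h2⟩ := exists_polar (W 0) (-(U 0 / ω))
    set C := √(W 0 ^ 2 + (-(U 0 / ω)) ^ 2)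
    have hdiff := h.toIsSol.sub_const_mul (hsol φ).toIsSol C
    have hz := hdiff.eq_zero hp (hγ.rpow q) (x₀ := 0) (by simp; linarith) (by
      have h3 : U 0 = -ω * (C * Real.sin φ) := by rw [← h2]; field_simp
      simp only [intervalIntegral.integral_same, mul_zero, zero_add]
      rw [h3]; ring)
    have hWC : ∀ θ, W θ = C * Real.cos (ω * (∫ t in (0 : ℝ)..θ, γ t ^ p) + φ) := fun θ => by
      linarith [(hz θ).1]
    refine ⟨C, φ, fun hC0 => hx ?_, hW.mono fun θ hθ => hθ.trans (hWC θ)⟩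
    rw [hWC, hC0, zero_mul]
  · rintro ⟨C, φ, hC, hCw⟩
    refine ⟨_, _, hCw, (hsol φ).const_mul C, ?_⟩
    have hcont : Continuous fun θ => ω * ∫ t in (0 : ℝ)..θ, γ t ^ p :=
      continuous_const.mul (intervalIntegral.continuous_primitive
        (fun x y => hp.locallyIntegrable.intervalIntegrable_real x y) 0)
    -- The phase runs through a full turn, so some point lies a quarter turn after `0`, and the
    -- cosine cannot vanish at both.
    obtain ⟨θ, hθ⟩ := mem_range_of_exists_le_of_exists_ge (c := Real.pi / 2) hcont
      ⟨0, by simp; linarith⟩ ⟨2 * Real.pi, by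
        rw [hω, div_mul_cancel₀ _ hI.ne']; linarith⟩
    simp only at hθ
    by_cases hcos : Real.cos φ = 0
    · refine ⟨θ, mul_ne_zero hC ?_⟩
      rw [hθ, add_comm, Real.cos_add_pi_div_two, neg_ne_zero]
      intro hsin
      have := Real.sin_sq_add_cos_sq φ
      rw [hsin, hcos] at this
      norm_num at this
    · refine ⟨0, mul_ne_zero hC ?_⟩
      simpa using hcos

end Critical

/-! ### Assembly of the theorem -/

theorem theorem1 (M p q : ℝ) (hM : 1 < M) (hpq : 0 ≤ p + q) :
    -- the best constant exists, is positive, and obeys the upper bound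
    (∀ γ : ℝ → ℝ, WeightClass M γ →
      IsLeast (wirtingerConstants (fun θ => γ θ ^ p) (fun θ => γ θ ^ q))
        (bestConst (fun θ => γ θ ^ p) (fun θ => γ θ ^ q)) ∧
      0 < bestConst (fun θ => γ θ ^ p) (fun θ => γ θ ^ q) ∧
      bestConst (fun θ => γ θ ^ p) (fun θ => γ θ ^ q) ≤ wirtingerBound M p q γ) ∧
    -- the case `p + q > 0`: extremal weights and extremal functions
    (0 < p + q →
      (∀ γ : ℝ → ℝ,
        (WeightClass M γ ∧
          bestConst (fun θ => γ θ ^ p) (fun θ => γ θ ^ q) = wirtingerBound M p q γ) ↔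
        ∃ φ : ℝ, ∀ᵐ θ : ℝ, γ θ = gammaBar M p q (θ + φ)) ∧
      (∀ (φ : ℝ) (w : ℝ → ℝ),
        IsExtremal (fun θ => gammaBar M p q (θ + φ) ^ p)
          (fun θ => gammaBar M p q (θ + φ) ^ q) w ↔
        ∃ C : ℝ, C ≠ 0 ∧ ∀ᵐ θ : ℝ, w θ = C * wBar M p q (θ + φ))) ∧
    -- the case `p + q = 0`: equality for every weight, and the extremal functions
    (p + q = 0 →
      ∀ γ : ℝ → ℝ, WeightClass M γ →
        bestConst (fun θ => γ θ ^ p) (fun θ => γ θ ^ q) = wirtingerBound M p q γ ∧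
        (∀ w : ℝ → ℝ,
          IsExtremal (fun θ => γ θ ^ p) (fun θ => γ θ ^ q) w ↔
          ∃ C φ : ℝ, C ≠ 0 ∧ ∀ᵐ θ : ℝ,
            w θ = C * Real.cos (2 * Real.pi / (∫ t in (0 : ℝ)..(2 * Real.pi), γ t ^ p) *
              (∫ t in (0 : ℝ)..θ, γ t ^ p) + φ))) := by
  refine ⟨fun γ hγ => ?_, fun hpos => ⟨fun γ => ⟨?_, ?_⟩, isExtremal_gammaBar_iff hM hpos⟩,
    fun h0 γ hγ => ?_⟩
  · obtain ⟨hw, hb⟩ := hγ.isWeight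
    obtain ⟨h1, h2, -⟩ := bestConst_spec (hw.rpow p) (hw.rpow q)
    exact ⟨h1, h2, bestConst_le_wirtingerBound hM hpq hw hb⟩
  · rintro ⟨hγ, heq⟩
    obtain ⟨hw, hb⟩ := hγ.isWeight
    obtain ⟨-, hC, w, U, hsol, x, hx⟩ := bestConst_spec (hw.rpow p) (hw.rpow q)
    obtain ⟨φ, r, hφ, -⟩ := exists_isPrueferAngle_of_isPeriodicSol hM hpq hw hb (inv_pos.2 hC)
      hsol hx
    exact ae_eq_gammaBar_of_isPrueferAngle hM hpos hw hb (Real.sqrt_pos.2 (inv_pos.2 hC)) hφ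
      (sqrt_inv_bestConst_mul hM hw heq)
  · rintro ⟨φ, hφ⟩
    refine ⟨(gammaBar_shift_weightClass hM φ).congr (Filter.EventuallyEq.symm hφ), ?_⟩
    rw [wirtingerBound_congr_ae hφ, wirtingerBound_gammaBar (one_pos.trans hM),
      ← bestConst_gammaBar hM hpq φ]
    exact bestConst_congr_ae (hφ.mono fun θ hθ => by simp only [hθ])
      (hφ.mono fun θ hθ => by simp only [hθ])
  · obtain ⟨hw, hb⟩ := hγ.isWeight
    exact ⟨bestConst_of_add_eq_zero hM h0 hw hb, isExtremal_of_add_eq_zero_iff hM h0 hw hb⟩
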